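/- **Slot-Laminar Paging.** An instance $(k,\mathcal S,\sigma)$ consists of a set $[k]=\{1,\dots,k\}$ of cache slots, a laminar family $\mathcal S\subseteq 2^{[k]}\setminus\{\emptyset\}$ (any two members are disjoint or nested), and a sequence $\sigma=(\sigma_1,\dots,\sigma_T)$ of requests $\sigma_t=\langle p_t,S_t\rangle$ with a page $p_t$ and a set $S_t\in\mathcal S$. A cache configuration assigns to each slot one page or leaves it empty. A solution is a sequence $C_1,\dots,C_T$ of configurations such that $C_t$ assigns $p_t$ to at least one slot of $S_t$, for each $t$. Its cost is the number of retrievals, i.e. of triples $(t,s,p)$ such that $C_t$ assigns page $p$ to slot $s$ but $C_{t-1}$ does not (or $t=1$); $\mathrm{opt}(\sigma)$ is the minimum cost of a solution. The height $h$ of $\mathcal S$ is the maximum length of a chain $R_1\subsetneq R_2\subsetneq\dots\subsetneq R_h$ in $\mathcal S$, and $H_k=\sum_{i=1}^k 1/i$. An online algorithm has to produce $C_t$ from $k$, $\mathcal S$ and $\sigma_1,\dots,\sigma_t$ only (and, if it is randomized, from its random numbers). It is $c$-competitive if its cost (its expected cost, if it is randomized) is at most $c\cdot\mathrm{opt}(\sigma)+b$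 on every instance, where $b$ is a constant that does not depend on the instance. An offline algorithm knows the whole instance in advance; it is a $c$-approximation algorithm if its cost is at most $c\cdot\mathrm{opt}(\sigma)$ on every instance. Sizes of inputs are measured with $k$ in unary, slot sets as characteristic vectors and page names in binary. An online algorithm is polynomial-time if $C_t$ is computed in time polynomial in the size of $(k,\mathcal S,(\sigma_1,\dots,\sigma_t))$, where a randomized algorithm may use polynomially many independent random numbers, each uniform on $\{0,\dots,m\}$ for some polynomially bounded $m$. An offline algorithm is polynomial-time if its running time is polynomial in the size of $(k,\mathcal S,\sigma)$. **Theorem.** Slot-Laminar Paging admits the following polynomial-time algorithms, each of them a single algorithm for all instances, where $k$ is the number of slots and $h$ the height of $\mathcal S$ in the instance at hand: 1. a deterministic $3h^2k$-competitive online algorithm; 2. a randomized $3h^2H_k$-competitive online algorithm, which outputs a solution for every outcome of its random numbers; 3. an offline (deterministic) $3h^2$-approximation algorithm. -/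

import Mathlib

open scoped BigOperators

namespace SlotPaging

/-! ### Slot-Laminar Paging -/

/-- Pages are named by natural numbers. -/
abbrev Page := ℕ

/-- A request `⟨p, S⟩`: page `p` has to be in at least one slot of `S`. -/
structure Request (k : ℕ) where
  page : Page
  slots : Finset (Fin k)

/-- A cache configuration: each of the `k` slots holds one page or is empty. -/
abbrev Config (k : ℕ) := Fin k → Option Page

/-- The configuration `C` satisfies the request `r`. -/
def Config.Satisfies {k : ℕ} (C : Config k) (r : Request k) : Prop :=
  ∃ s ∈ r.slots, C s = some r.page

/-- `C₁, …, C_T` is a solution for `σ₁, …, σ_T` (in particular the lengths agree). -/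
def IsSolution {k : ℕ} (σ : List (Request k)) (Cs : List (Config k)) : Prop :=
  List.Forall₂ (fun r C => Config.Satisfies C r) σ Cs

/-- The number of retrievals when the configuration changes from `C` to `C'`: the number of slots
to which `C'` assigns a page that `C` does not assign to it. -/
def retrievals {k : ℕ} (C C' : Config k) : ℕ :=
  (Finset.univ.filter fun s : Fin k => C' s ≠ none ∧ C' s ≠ C s).card

/-- The total number of retrievals of a sequence of configurations that is entered from `C`. -/
def costFrom {k : ℕ} : Config k → List (Config k) → ℕ
  | _, [] => 0
  | C, C' :: Cs => retrievals C C' + costFrom C' Cs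

/-- The cost of a sequence of configurations: its number of retrievals, where the cache is empty
at the beginning (all pages present at time `1` are retrieved at time `1`). -/
def cost {k : ℕ} (Cs : List (Config k)) : ℕ := costFrom (fun _ => none) Cs

/-- The optimum cost of a request sequence. -/
noncomputable def opt {k : ℕ} (σ : List (Request k)) : ℕ :=
  sInf {c | ∃ Cs, IsSolution σ Cs ∧ cost Cs = c}

/-- Any two sets of the family are disjoint or nested. (Families of slot sets are given as
lists, in an arbitrary order.) -/
def IsLaminar {k : ℕ} (F : List (Finset (Fin k))) : Prop :=
  ∀ R ∈ F, ∀ R' ∈ F, Disjoint R R' ∨ R ⊆ R' ∨ R' ⊆ R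

/-- The height of a family: the maximum `h` such that the family contains sets
`R₁ ⊂ R₂ ⊂ ⋯ ⊂ R_h` (strict inclusions). -/
noncomputable def height {k : ℕ} (F : List (Finset (Fin k))) : ℕ :=
  sSup {h | ∃ R : Fin h → Finset (Fin k), StrictMono R ∧ ∀ i, R i ∈ F}

/-- `(k, F, σ)` is an instance of Slot-Laminar Paging: `F` is a laminar family of nonempty sets of
slots, and every request of `σ` specifies a set of `F`. -/
structure IsInstance {k : ℕ} (F : List (Finset (Fin k))) (σ : List (Request k)) : Prop where
  nonempty : ∀ S ∈ F, S.Nonempty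
  laminar : IsLaminar F
  mem : ∀ r ∈ σ, r.slots ∈ F

/-! ### The machine model

Programs work on binary trees (the data type of pure Lisp), with structured control flow including
unbounded loops. Every elementary operation is charged the size of the tree it delivers, so that
the running time bounds the size of everything computed, and running times agree with those of
Turing machines up to a polynomial. -/

/-- Binary trees. -/
inductive Data where
  | nil : Data
  | cons : Data → Data → Data

namespace Data

/-- The number of nodes. -/
def size : Data → ℕ
  | nil => 1
  | cons x y => x.size + y.size + 1

/-- The left subtree (`nil` for `nil`). -/
def hd : Data → Data
  | nil => nil
  | cons x _ => x

/-- The right subtree (`nil` for `nil`). -/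
def tl : Data → Data
  | nil => nil
  | cons _ y => y

end Data

/-- Programs. A program transforms the tree held in the single variable of the machine; `nil`
stands for false and every other tree for true. -/
inductive Prog where
  /-- leave the input as it is -/
  | id : Prog
  /-- return `nil` -/
  | nil : Prog
  /-- return the left subtree of the input -/
  | hd : Prog
  /-- return the right subtree of the input -/
  | tl : Prog
  /-- run both programs on the input and join the two results -/
  | pair : Prog → Prog → Prog
  /-- run the first program, and then the second one on its result -/
  | seq : Prog → Prog → Prog
  /-- if the first program returns true on the input, run the second one, otherwise the third -/
  | ite : Prog → Prog → Prog → Prog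
  /-- while the first program returns true on the current tree, apply the second one to it -/
  | loop : Prog → Prog → Prog

/-- `Run P x y n`: on input `x` the program `P` halts with output `y` after time `n`. -/
inductive Run : Prog → Data → Data → ℕ → Prop where
  | id (x : Data) : Run .id x x x.size
  | nil (x : Data) : Run .nil x .nil 1
  | hd (x : Data) : Run .hd x x.hd x.hd.size
  | tl (x : Data) : Run .tl x x.tl x.tl.size
  | pair {P Q : Prog} {x y z : Data} {m n : ℕ} :
      Run P x y m → Run Q x z n → Run (.pair P Q) x (.cons y z) (m + n + 1)
  | seq {P Q : Prog} {x y z : Data} {m n : ℕ} :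
      Run P x y m → Run Q y z n → Run (.seq P Q) x z (m + n + 1)
  | ite_true {B P Q : Prog} {x y a b : Data} {m n : ℕ} :
      Run B x (.cons a b) m → Run P x y n → Run (.ite B P Q) x y (m + n + 1)
  | ite_false {B P Q : Prog} {x y : Data} {m n : ℕ} :
      Run B x .nil m → Run Q x y n → Run (.ite B P Q) x y (m + n + 1)
  | loop_stop {B P : Prog} {x : Data} {m : ℕ} :
      Run B x .nil m → Run (.loop B P) x x (m + x.size)
  | loop_step {B P : Prog} {x y z a b : Data} {l m n : ℕ} :
      Run B x (.cons a b) l → Run P x y m → Run (.loop B P) y z n →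
        Run (.loop B P) x z (l + m + n + 1)

/-! ### Encodings of inputs and outputs as trees -/

/-- The tree that represents a list of trees. -/
def encList : List Data → Data
  | [] => .nil
  | x :: xs => .cons x (encList xs)

/-- Truth values. -/
def encBool : Bool → Data
  | false => .nil
  | true => .cons .nil .nil

/-- Natural numbers in unary notation (for the number of slots and for random numbers). -/
def encUnary (n : ℕ) : Data := encList (List.replicate n .nil)

/-- Pages, in binary notation. -/
def encPage (p : Page) : Data := encList (p.bits.map encBool)

/-- Sets of slots, by their characteristic vectors. -/
def encSlots {k : ℕ} (S : Finset (Fin k)) : Data :=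
  encList ((List.finRange k).map fun s => encBool (decide (s ∈ S)))

/-- Requests. -/
def encRequest {k : ℕ} (r : Request k) : Data := .cons (encPage r.page) (encSlots r.slots)

/-- The input that consists of `k`, of a family of slot sets and of a request sequence. -/
def encInput {k : ℕ} (F : List (Finset (Fin k))) (σ : List (Request k)) : Data :=
  .cons (encUnary k) (.cons (encList (F.map encSlots)) (encList (σ.map encRequest)))

/-- The content of a slot. -/
def encSlot : Option Page → Data
  | none => .nil
  | some p => .cons .nil (encPage p)

/-- Configurations, slot by slot. -/
def encConfig {k : ℕ} (C : Config k) : Data :=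
  encList ((List.finRange k).map fun s => encSlot (C s))

/-! ### Deterministic online algorithms -/

/-- A deterministic online algorithm: `A k F [σ₁, …, σ_t]` is its configuration at time `t`, which
is determined by `k`, the family `F` and the requests up to time `t`. -/
abbrev OnlineAlgorithm :=
  ∀ k : ℕ, List (Finset (Fin k)) → List (Request k) → Config k

namespace OnlineAlgorithm

/-- The configurations `C₁, …, C_T` of the algorithm on the request sequence `σ`. -/
def output (A : OnlineAlgorithm) {k : ℕ} (F : List (Finset (Fin k))) (σ : List (Request k)) :
    List (Config k) :=
  (List.range σ.length).map fun t => A k F (σ.take (t + 1))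

/-- One program computes the current configuration from what has been revealed so far, in time
polynomial in the size of what has been revealed so far. -/
def IsPolyTime (A : OnlineAlgorithm) : Prop :=
  ∃ (P : Prog) (p : Polynomial ℕ), ∀ (k : ℕ) (F : List (Finset (Fin k))) (σ : List (Request k)),
    IsInstance F σ →
      ∃ n ≤ p.eval (encInput F σ).size, Run P (encInput F σ) (encConfig (A k F σ)) n

/-- The algorithm solves all instances of Slot-Laminar Paging and is `c h k`-competitive on those
with `k` slots and height `h`. -/
def IsCompetitive (A : OnlineAlgorithm) (c : ℕ → ℕ → ℝ) : Prop :=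
  ∃ b : ℝ, ∀ (k : ℕ) (F : List (Finset (Fin k))) (σ : List (Request k)), IsInstance F σ →
    IsSolution σ (A.output F σ) ∧
      (cost (A.output F σ) : ℝ) ≤ c (height F) k * (opt σ : ℝ) + b

end OnlineAlgorithm

/-! ### Randomized online algorithms -/

/-- A supply of random numbers: `ω (m, i)` is the `i`-th number drawn from `{0, …, m}`. -/
abbrev RandomTape := ∀ q : ℕ × ℕ, Fin (q.1 + 1)

/-- All these numbers are independent, and `ω (m, i)` is uniformly distributed on `{0, …, m}`. -/
noncomputable def tapeMeasure : MeasureTheory.Measure RandomTape :=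
  MeasureTheory.Measure.infinitePi fun q : ℕ × ℕ =>
    (PMF.uniformOfFintype (Fin (q.1 + 1))).toMeasure

/-- The part of the tape that consists of the `ω (m, i)` with `m < N` and `i < N`. -/
def encTape (N : ℕ) (ω : RandomTape) : Data :=
  encList ((List.range N).map fun m =>
    encList ((List.range N).map fun i => encUnary (ω (m, i) : ℕ)))

/-- A randomized online algorithm: a deterministic one for each outcome of the random numbers. -/
abbrev RandomizedOnlineAlgorithm := RandomTape → OnlineAlgorithm

namespace RandomizedOnlineAlgorithm

/-- One program computes the current configuration from what has been revealed so far and from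
polynomially many random numbers, in time polynomial in the size of what has been revealed. -/
def IsPolyTime (A : RandomizedOnlineAlgorithm) : Prop :=
  ∃ (P : Prog) (p q : Polynomial ℕ),
    ∀ (k : ℕ) (F : List (Finset (Fin k))) (σ : List (Request k)), IsInstance F σ →
      ∀ ω : RandomTape, ∃ n ≤ p.eval (encInput F σ).size,
        Run P (.cons (encInput F σ) (encTape (q.eval (encInput F σ).size) ω))
          (encConfig (A ω k F σ)) n

/-- The algorithm solves all instances of Slot-Laminar Paging, whatever the random numbers are, and
its expected cost is `c h k`-competitive on those with `k` slots and height `h`. -/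
def IsCompetitive (A : RandomizedOnlineAlgorithm) (c : ℕ → ℕ → ℝ) : Prop :=
  ∃ b : ℝ, ∀ (k : ℕ) (F : List (Finset (Fin k))) (σ : List (Request k)), IsInstance F σ →
    (∀ ω, IsSolution σ ((A ω).output F σ)) ∧
      MeasureTheory.Integrable (fun ω => (cost ((A ω).output F σ) : ℝ)) tapeMeasure ∧
      ∫ ω, (cost ((A ω).output F σ) : ℝ) ∂tapeMeasure ≤ c (height F) k * (opt σ : ℝ) + b

end RandomizedOnlineAlgorithm

/-! ### Offline algorithms -/

/-- A (deterministic) offline algorithm computes a sequence of configurations from the whole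
instance. -/
abbrev OfflineAlgorithm :=
  ∀ k : ℕ, List (Finset (Fin k)) → List (Request k) → List (Config k)

namespace OfflineAlgorithm

/-- The algorithm runs in time polynomial in the size of the instance. -/
def IsPolyTime (A : OfflineAlgorithm) : Prop :=
  ∃ (P : Prog) (p : Polynomial ℕ), ∀ (k : ℕ) (F : List (Finset (Fin k))) (σ : List (Request k)),
    IsInstance F σ →
      ∃ n ≤ p.eval (encInput F σ).size,
        Run P (encInput F σ) (encList ((A k F σ).map encConfig)) n

/-- The algorithm is a `c h k`-approximation algorithm on the instances of Slot-Laminar Paging with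
`k` slots and height `h`; no additive constant is allowed. -/
def IsApproximation (A : OfflineAlgorithm) (c : ℕ → ℕ → ℝ) : Prop :=
  ∀ (k : ℕ) (F : List (Finset (Fin k))) (σ : List (Request k)), IsInstance F σ →
    IsSolution σ (A k F σ) ∧ (cost (A k F σ) : ℝ) ≤ c (height F) k * (opt σ : ℝ)

end OfflineAlgorithm

end SlotPaging

open SlotPaging

namespace SlotPaging

/-! ### Programs that run in polynomial time -/

/-! Each member `S` of the laminar family is treated as an instance of ordinary paging with `S.card`
slots. Its items are tokens, that is, pages together with a set of slots (`rep`): after a request to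
`p` in `R`, all supersets of `R` receive the token of `R`, since the copy of `p` that serves `R`
serves them as well. Let `h` be the height of the family.

Lower bound. From a solution of the original problem, restricted to `S`, one obtains a cache of
tokens that loads at most `h` tokens per retrieval into `S`. The proof keeps, for each page, a set
of tokens that fits into the slots holding the page (`RepInv`), with a potential `repPot` that rises
by at most `h` per added slot and pays for every token loaded. The paging lower bound `newCount S`
is therefore at most `h` times the number of retrievals into `S` (`newCount_le`). A slot lies in at
most `h` members, so these bounds add up to at most `h ^ 2 * opt` (`sum_newCount_le`).

Upper bound. For all `S` at once the algorithm maintains an array of tokens that contains the cache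
`keep` of a paging algorithm for `S`; a token held by a set and by the next larger one has the same
slot in both (`PosInv`). The arrays of the maximal sets are the configuration. A request to `v` in
`R` brings `v` to one slot of `R` in all arrays above `R`, by exchanges along the slots that `v` has
in them. If `f` of these sets lack `v`, at most `2 * f + 1` slots are involved, and none changes if
`f = 0`. This gives the constant: the cost is at most `3` times the total number of misses
(`totalCost_le`).

Paging. The layers of the offset function describe a matroid whose independent sets have at most `j`
pages in the last `j` layers. A request contracts the page, or truncates if the page is new, and
adds the page as a coloop. The cache is the greedy basis for a priority order; it is lazy because
greedy bases of contractions and truncations are contained in that of the matroid. With `m` slots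
and `L` requests to new pages, the number of misses is at most `m * L` for first come, first served
(`loose_reqLayers`), at most `L` for the order of next requests (`missCount_offOrd_le`), and at most
`harmonic m * L` in expectation for a random order, by the potential `pot` (`missProb_add_pot`,
`pot_truncLayers_le`).

Running time. `Comp` is closed under the usual operations on encoded lists, in particular under
folds whose accumulators have polynomial size, and all ingredients of the algorithms are composed of
these. -/

theorem Data.size_pos (x : Data) : 0 < x.size := by
  cases x <;> simp [Data.size]

/-- Every elementary operation is charged for the tree it delivers. This is what lets polynomial
bounds compose: a second program starts from an output of polynomial size. -/
theorem Run.size_le {P : Prog} {x y : Data} {n : ℕ} (h : Run P x y n) : y.size ≤ n := by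
  induction h with
  | id x => exact le_rfl
  | nil x => exact le_rfl
  | hd x => exact le_rfl
  | tl x => exact le_rfl
  | pair _ _ h1 h2 => simp only [Data.size]; omega
  | seq _ _ h1 h2 => omega
  | ite_true _ _ h1 h2 => omega
  | ite_false _ _ h1 h2 => omega
  | loop_stop _ h1 => omega
  | loop_step _ _ _ h1 h2 h3 => omega

theorem poly_mono (p : Polynomial ℕ) {m n : ℕ} (h : m ≤ n) : p.eval m ≤ p.eval n := by
  rw [Polynomial.eval_eq_sum_range, Polynomial.eval_eq_sum_range]
  exact Finset.sum_le_sum fun i _ => Nat.mul_le_mul_left _ (Nat.pow_le_pow_left h i)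

/-- One program computes `d x` from `e x` in polynomial time, for all `x`. -/
def Comp {X : Type*} (e d : X → Data) : Prop :=
  ∃ (P : Prog) (p : Polynomial ℕ), ∀ x, ∃ n ≤ p.eval (e x).size, Run P (e x) (d x) n

namespace Comp

variable {X Y : Type*} {e d d₁ d₂ : X → Data}

theorem size_le (h : Comp e d) :
    ∃ p : Polynomial ℕ, ∀ x, (d x).size ≤ p.eval (e x).size := by
  obtain ⟨P, p, h⟩ := h
  refine ⟨p, fun x => ?_⟩
  obtain ⟨n, hn, hr⟩ := h x
  exact hr.size_le.trans hn

theorem refl (e : X → Data) : Comp e e :=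
  ⟨.id, Polynomial.X, fun x => ⟨_, by simp, Run.id _⟩⟩

theorem nil (e : X → Data) : Comp e fun _ => .nil :=
  ⟨.nil, 1, fun x => ⟨_, by simp, Run.nil _⟩⟩

theorem trans {d' : X → Data} (h : Comp e d) (h' : Comp d d') : Comp e d' := by
  obtain ⟨P, p, hP⟩ := h
  obtain ⟨Q, q, hQ⟩ := h'
  refine ⟨.seq P Q, p + q.comp p + 1, fun x => ?_⟩
  obtain ⟨m, hm, hr⟩ := hP x
  obtain ⟨n, hn, hs⟩ := hQ x
  refine ⟨m + n + 1, ?_, hr.seq hs⟩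
  have := poly_mono q (hr.size_le.trans hm)
  simp only [Polynomial.eval_add, Polynomial.eval_comp, Polynomial.eval_one]
  omega

theorem pair (h₁ : Comp e d₁) (h₂ : Comp e d₂) : Comp e fun x => .cons (d₁ x) (d₂ x) := by
  obtain ⟨P, p, hP⟩ := h₁
  obtain ⟨Q, q, hQ⟩ := h₂
  refine ⟨.pair P Q, p + q + 1, fun x => ?_⟩
  obtain ⟨m, hm, hr⟩ := hP x
  obtain ⟨n, hn, hs⟩ := hQ x
  refine ⟨m + n + 1, ?_, hr.pair hs⟩
  simp only [Polynomial.eval_add, Polynomial.eval_one]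
  omega

theorem hd (h : Comp e d) : Comp e fun x => (d x).hd := by
  refine h.trans ⟨.hd, Polynomial.X, fun x => ⟨_, ?_, Run.hd _⟩⟩
  cases d x <;> simp [Data.hd, Data.size]
  omega

theorem tl (h : Comp e d) : Comp e fun x => (d x).tl := by
  refine h.trans ⟨.tl, Polynomial.X, fun x => ⟨_, ?_, Run.tl _⟩⟩
  cases d x <;> simp [Data.tl, Data.size]
  omega

/-- Restriction to some of the inputs. -/
theorem reindex (h : Comp e d) (f : Y → X) : Comp (fun y => e (f y)) fun y => d (f y) := by
  obtain ⟨P, p, hP⟩ := h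
  exact ⟨P, p, fun y => hP (f y)⟩

/-- What can be computed from a part of the input. -/
theorem weak (f : Y → X) (a : Y → Data) (h : Comp e d) :
    Comp (fun y => .cons (e (f y)) (a y)) fun y => d (f y) :=
  (hd (refl fun y => Data.cons (e (f y)) (a y))).trans (h.reindex f)

theorem last (e a : X → Data) : Comp (fun x => .cons (e x) (a x)) a :=
  tl (refl fun x => Data.cons (e x) (a x))

theorem cases {c : X → Data} {p : X → Prop} (hc : Comp e c) (hcp : ∀ x, c x ≠ .nil ↔ p x)
    (h₁ : Comp (X := {x // p x}) (fun y => e y.1) fun y => d y.1)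
    (h₂ : Comp (X := {x // ¬ p x}) (fun y => e y.1) fun y => d y.1) : Comp e d := by
  obtain ⟨C, c', hC⟩ := hc
  obtain ⟨P, p', hP⟩ := h₁
  obtain ⟨Q, q, hQ⟩ := h₂
  refine ⟨.ite C P Q, c' + p' + q + 1, fun x => ?_⟩
  obtain ⟨l, hl, ht⟩ := hC x
  simp only [Polynomial.eval_add, Polynomial.eval_one]
  by_cases h : p x
  · obtain ⟨m, hm, hr⟩ := hP ⟨x, h⟩
    simp only at hm
    cases hx : c x with
    | nil => exact absurd hx ((hcp x).2 h)
    | cons a b =>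
      rw [hx] at ht
      exact ⟨_, by omega, Run.ite_true ht hr⟩
  · obtain ⟨n, hn, hs⟩ := hQ ⟨x, h⟩
    simp only at hn
    have hx : c x = .nil := by
      by_contra h'
      exact h ((hcp x).1 h')
    rw [hx] at ht
    exact ⟨_, by omega, Run.ite_false ht hs⟩

theorem congr {d' : X → Data} (h : Comp e d) (hd : ∀ x, d x = d' x) : Comp e d' :=
  (funext hd : d = d') ▸ h

theorem congr_left {e' : X → Data} (h : Comp e d) (he : ∀ x, e x = e' x) : Comp e' d :=
  (funext he : e = e') ▸ h

theorem ite' {c : X → Data} {p : X → Prop} [DecidablePred p] (hc : Comp e c)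
    (hcp : ∀ x, c x ≠ .nil ↔ p x) (h₁ : Comp e d₁) (h₂ : Comp e d₂) :
    Comp e fun x => if p x then d₁ x else d₂ x := by
  refine cases hc hcp ((h₁.reindex Subtype.val).congr ?_) ((h₂.reindex Subtype.val).congr ?_)
  · rintro ⟨x, hx⟩
    simp [hx]
  · rintro ⟨x, hx⟩
    simp [hx]

theorem encBool_ne_nil (b : Bool) : encBool b ≠ .nil ↔ b = true := by
  cases b <;> simp [encBool]

theorem ite {b : X → Bool} (hc : Comp e fun x => encBool (b x))
    (h₁ : Comp e d₁) (h₂ : Comp e d₂) :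
    Comp e fun x => if b x = true then d₁ x else d₂ x :=
  ite' hc (fun x => encBool_ne_nil (b x)) h₁ h₂

theorem ite_prop {p : X → Prop} [DecidablePred p] (hc : Comp e fun x => encBool (decide (p x)))
    (h₁ : Comp e d₁) (h₂ : Comp e d₂) :
    Comp e fun x => if p x then d₁ x else d₂ x :=
  ite' hc (fun x => by simp [encBool_ne_nil]) h₁ h₂

/-- Constant outputs. -/
theorem const (e : X → Data) : ∀ c : Data, Comp e fun _ => c
  | .nil => nil e
  | .cons a b => (const e a).pair (const e b)

/-- A loop of polynomially many rounds over states of polynomial size. -/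
theorem loop {s : X → ℕ → Data} {n : X → ℕ} (r q : Polynomial ℕ)
    (hn : ∀ x, n x ≤ r.eval (e x).size)
    (hs : ∀ x, ∀ i ≤ n x, (s x i).size ≤ q.eval (e x).size)
    (h0 : Comp e fun x => s x 0)
    (hstep : Comp (X := {y : X × ℕ // y.2 < n y.1}) (fun y => .cons (e y.1.1) (s y.1.1 y.1.2))
      fun y => s y.1.1 (y.1.2 + 1))
    {c : {y : X × ℕ // y.2 ≤ n y.1} → Data}
    (hc : Comp (fun y => .cons (e y.1.1) (s y.1.1 y.1.2)) c)
    (hcn : ∀ y, c y ≠ .nil ↔ y.1.2 < n y.1.1) :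
    Comp e fun x => s x (n x) := by
  obtain ⟨P, p, hP⟩ := hstep
  obtain ⟨C, c', hC⟩ := hc
  -- Induction on the number `j` of rounds that are left. The machine holds the input next to the
  -- state, and each round copies the input, so its time is bounded in terms of the input alone.
  have key : ∀ x, ∀ j ≤ n x, ∃ t ≤ (j + 1) * (c'.eval ((e x).size + q.eval (e x).size + 1) +
      p.eval ((e x).size + q.eval (e x).size + 1) + 3 * (e x).size + 2 * q.eval (e x).size + 10),
      Run (.loop C (.pair .hd P)) (.cons (e x) (s x (n x - j))) (.cons (e x) (s x (n x))) t := by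
    intro x j
    induction j with
    | zero =>
      intro _
      rw [Nat.sub_zero]
      obtain ⟨l, hl, hr⟩ := hC ⟨(x, n x), le_rfl⟩
      have h1 : c ⟨(x, n x), le_rfl⟩ = .nil := by
        by_contra h
        exact absurd ((hcn _).1 h) (lt_irrefl _)
      rw [h1] at hr
      have h2 := hs x (n x) le_rfl
      refine ⟨_, ?_, Run.loop_stop hr⟩
      have h3 := poly_mono c' (m := (Data.cons (e x) (s x (n x))).size)
        (n := (e x).size + q.eval (e x).size + 1) (by simp only [Data.size]; omega)
      simp only [Data.size] at h3 hl ⊢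
      omega
    | succ j ih =>
      intro hj
      obtain ⟨t, ht, hrt⟩ := ih (by omega)
      have hi : n x - (j + 1) < n x := by omega
      obtain ⟨l, hl, hr⟩ := hC ⟨(x, n x - (j + 1)), hi.le⟩
      obtain ⟨m, hm, hr'⟩ := hP ⟨(x, n x - (j + 1)), hi⟩
      have h2 := hs x (n x - (j + 1)) hi.le
      have h3 := poly_mono c' (m := (Data.cons (e x) (s x (n x - (j + 1)))).size)
        (n := (e x).size + q.eval (e x).size + 1) (by simp only [Data.size]; omega)
      have h4 := poly_mono p (m := (Data.cons (e x) (s x (n x - (j + 1)))).size)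
        (n := (e x).size + q.eval (e x).size + 1) (by simp only [Data.size]; omega)
      have h1 := (hcn ⟨(x, n x - (j + 1)), hi.le⟩).2 hi
      have h5 : n x - (j + 1) + 1 = n x - j := by omega
      simp only [h5] at hr'
      have hb := Run.pair (Run.hd (.cons (e x) (s x (n x - (j + 1))))) hr'
      cases hcx : c ⟨(x, n x - (j + 1)), hi.le⟩ with
      | nil => exact absurd hcx h1
      | cons a b =>
        rw [hcx] at hr
        refine ⟨_, ?_, Run.loop_step hr hb hrt⟩
        simp only [Data.size, Data.hd] at h3 h4 hl hm ⊢
        rw [add_mul (j + 1) 1]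
        omega
  have hmain : Comp (fun x => .cons (e x) (s x 0)) fun x => .cons (e x) (s x (n x)) := by
    refine ⟨.loop C (.pair .hd P), (r + 1) * (c'.comp (Polynomial.X + q + 1) +
      p.comp (Polynomial.X + q + 1) + 3 * Polynomial.X + 2 * q + 10), fun x => ?_⟩
    obtain ⟨t, ht, hr⟩ := key x (n x) le_rfl
    rw [Nat.sub_self] at hr
    refine ⟨t, ht.trans ?_, hr⟩
    simp only [Polynomial.eval_mul, Polynomial.eval_add, Polynomial.eval_comp,
      Polynomial.eval_X, Polynomial.eval_one, Polynomial.eval_ofNat]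
    have hx : (e x).size ≤ (Data.cons (e x) (s x 0)).size := by simp only [Data.size]; omega
    have h1 := poly_mono r hx
    have h2 := poly_mono q hx
    have h3 := poly_mono c' (show (e x).size + q.eval (e x).size + 1 ≤
      (Data.cons (e x) (s x 0)).size + q.eval (Data.cons (e x) (s x 0)).size + 1 by omega)
    have h4 := poly_mono p (show (e x).size + q.eval (e x).size + 1 ≤
      (Data.cons (e x) (s x 0)).size + q.eval (Data.cons (e x) (s x 0)).size + 1 by omega)
    have := hn x
    exact Nat.mul_le_mul (by omega) (by omega)
  exact (((refl e).pair h0).trans hmain).tl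

end Comp

/-! ### Encoded lists and folds -/

theorem size_encList_le_of_forall {l : List Data} {m : ℕ} (h : ∀ x ∈ l, x.size ≤ m) :
    (encList l).size ≤ l.length * (m + 1) + 1 := by
  induction l with
  | nil => simp [encList, Data.size]
  | cons x l ih =>
    have h1 := ih fun y hy => h y (List.mem_cons_of_mem _ hy)
    have h2 := h x (List.mem_cons_self ..)
    simp only [encList, Data.size, List.length_cons, add_mul, one_mul]
    omega

theorem size_le_encList {l : List Data} {x : Data} (h : x ∈ l) :
    x.size + 1 ≤ (encList l).size := by
  induction l with
  | nil => simp at h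
  | cons y l ih =>
    have := Data.size_pos y
    have := Data.size_pos (encList l)
    rcases List.mem_cons.1 h with rfl | h
    · simp only [encList, Data.size]; omega
    · have := ih h
      simp only [encList, Data.size]; omega

theorem length_lt_encList (l : List Data) : l.length < (encList l).size := by
  induction l with
  | nil => simp [encList, Data.size]
  | cons y l ih =>
    simp only [encList, Data.size, List.length_cons]; omega

theorem size_encList_append (l l' : List Data) :
    (encList (l ++ l')).size + 1 = (encList l).size + (encList l').size := by
  induction l with
  | nil => simp [encList, Data.size]; omega
  | cons y l ih =>
    simp only [encList, Data.size, List.cons_append]; omega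

theorem encList_injective : Function.Injective encList := by
  intro l
  induction l with
  | nil => intro l' h; cases l' <;> simp_all [encList]
  | cons x l ih =>
    intro l' h
    cases l' with
    | nil => simp [encList] at h
    | cons y l' =>
      simp only [encList, Data.cons.injEq] at h
      rw [h.1, ih h.2]

theorem encList_ne_nil (l : List Data) : encList l ≠ .nil ↔ l ≠ [] := by
  cases l <;> simp [encList]

namespace Comp

variable {X Y : Type*} {e d d₁ d₂ : X → Data} {A B : X → Type*} {ea : ∀ x, A x → Data}
  {eb : ∀ x, B x → Data} {l : ∀ x, List (A x)}

/-- The loop state consists of the remaining list and the accumulator. Step and size bound are only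
needed for accumulators that arise from a prefix of the list; `slots` and `positions` bound their
accumulators in this way. -/
theorem foldl {b0 : ∀ x, B x} {step : ∀ x, B x → A x → B x} (q : Polynomial ℕ)
    (hl : Comp e fun x => encList ((l x).map (ea x))) (hb : Comp e fun x => eb x (b0 x))
    (hstep : Comp (X := {y : Σ x, B x × A x // ∃ l' : List (A y.1), l' ++ [y.2.2] <+: l y.1 ∧
        y.2.1 = l'.foldl (step y.1) (b0 y.1)})
      (fun y => .cons (.cons (e y.1.1) (eb _ y.1.2.1)) (ea _ y.1.2.2))
      fun y => eb _ (step _ y.1.2.1 y.1.2.2))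
    (hq : ∀ x, ∀ l' : List (A x), l' <+: l x → (eb x (l'.foldl (step x) (b0 x))).size ≤ q.eval (e x).size) :
    Comp e fun x => eb x ((l x).foldl (step x) (b0 x)) := by
  obtain ⟨p, hp⟩ := hl.size_le
  have hlen : ∀ x, (l x).length ≤ p.eval (e x).size := fun x => by
    have := length_lt_encList ((l x).map (ea x))
    have := hp x
    simp only [List.length_map] at *
    omega
  have := loop (e := e) (n := fun x => (l x).length)
    (s := fun x i => .cons (encList (((l x).drop i).map (ea x)))
      (eb x (((l x).take i).foldl (step x) (b0 x)))) p (p + q + 1) hlen ?_ ?_ ?_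
    (c := fun y => encList (((l y.1.1).drop y.1.2).map (ea y.1.1))) ?_ ?_
  · refine this.tl.congr fun x => ?_
    simp [Data.tl]
  · intro x i hi
    have h1 := hq x _ (List.take_prefix i (l x))
    have h2 := size_encList_append (((l x).take i).map (ea x)) (((l x).drop i).map (ea x))
    rw [← List.map_append, List.take_append_drop] at h2
    have h3 := Data.size_pos (encList (((l x).take i).map (ea x)))
    have h4 := hp x
    simp only [Data.size, Polynomial.eval_add, Polynomial.eval_one]
    omega
  · simpa using hl.pair hb
  · have hst := hstep.reindex (Y := {y : X × ℕ // y.2 < (l y.1).length})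
      (fun y => ⟨⟨y.1.1, ((l y.1.1).take y.1.2).foldl (step y.1.1) (b0 y.1.1),
        (l y.1.1)[y.1.2]'y.2⟩, (l y.1.1).take y.1.2, by
          simp only [List.take_append_getElem]
          exact List.take_prefix _ _, rfl⟩)
    have hr := Comp.refl (X := {y : X × ℕ // y.2 < (l y.1).length}) (fun y => Data.cons (e y.1.1)
      (.cons (encList (((l y.1.1).drop y.1.2).map (ea y.1.1)))
      (eb y.1.1 (((l y.1.1).take y.1.2).foldl (step y.1.1) (b0 y.1.1)))))
    refine (hr.tl.hd.tl.pair (((hr.hd.pair hr.tl.tl).pair hr.tl.hd.hd).trans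
      (hst.congr (d' := fun y => eb y.1.1 (((l y.1.1).take (y.1.2 + 1)).foldl (step y.1.1)
        (b0 y.1.1))) ?_ |>.congr_left ?_))).congr ?_
    · rintro ⟨⟨x, i⟩, hi⟩
      simp only at hi ⊢
      rw [← List.take_append_getElem hi, List.foldl_append]
      rfl
    · rintro ⟨⟨x, i⟩, hi⟩
      simp only at hi ⊢
      rw [List.drop_eq_getElem_cons hi]
      rfl
    · rintro ⟨⟨x, i⟩, hi⟩
      simp only at hi ⊢
      conv_lhs => rw [List.drop_eq_getElem_cons hi]
      rfl
  · exact (last _ _).hd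
  · rintro ⟨⟨x, i⟩, hi⟩
    simp only at hi ⊢
    rw [encList_ne_nil]
    simp

end Comp

/-- Optional values. -/
def encOpt {A : Type*} (f : A → Data) : Option A → Data
  | none => .nil
  | some a => .cons .nil (f a)

theorem size_encUnary (n : ℕ) : (encUnary n).size = 2 * n + 1 := by
  induction n with
  | zero => rfl
  | succ n ih =>
    simp only [encUnary, List.replicate_succ, encList, Data.size] at ih ⊢
    omega

theorem encOpt_ne_nil {A : Type*} (f : A → Data) (o : Option A) :
    encOpt f o ≠ .nil ↔ o ≠ none := by
  cases o <;> simp [encOpt]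

namespace Comp

variable {X Y : Type*} {e d d₁ d₂ : X → Data} {A B : X → Type*} {ea : ∀ x, A x → Data}
  {eb : ∀ x, B x → Data} {l l₁ l₂ : ∀ x, List (A x)}

/-- Additive growth keeps the accumulator polynomial over polynomially many steps; growth by a
factor would not. -/
theorem foldl_growth {b0 : ∀ x, B x} {step : ∀ x, B x → A x → B x} (q : Polynomial ℕ)
    (hl : Comp e fun x => encList ((l x).map (ea x))) (hb : Comp e fun x => eb x (b0 x))
    (hstep : Comp (X := Σ x, B x × A x)
      (fun y => .cons (.cons (e y.1) (eb _ y.2.1)) (ea _ y.2.2))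
      fun y => eb _ (step _ y.2.1 y.2.2))
    (hq : ∀ x, ∀ a ∈ l x, ∀ b, (eb x (step x b a)).size ≤ (eb x b).size + q.eval (e x).size) :
    Comp e fun x => eb x ((l x).foldl (step x) (b0 x)) := by
  obtain ⟨p, hp⟩ := hl.size_le
  obtain ⟨r, hr⟩ := hb.size_le
  refine foldl (r + p * q) hl hb (hstep.reindex Subtype.val) fun x l' hl' => ?_
  have h1 : (eb x (l'.foldl (step x) (b0 x))).size ≤
      (eb x (b0 x)).size + l'.length * q.eval (e x).size := by
    have : ∀ l' : List (A x), (∀ a ∈ l', a ∈ l x) → ∀ b, (eb x (l'.foldl (step x) b)).size ≤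
        (eb x b).size + l'.length * q.eval (e x).size := by
      intro l'
      induction l' with
      | nil => intro _ b; simp
      | cons a l' ih =>
        intro h b
        have h1 := ih (fun c hc => h c (List.mem_cons_of_mem _ hc)) (step x b a)
        have h2 := hq x a (h a (List.mem_cons_self ..)) b
        simp only [List.foldl_cons, List.length_cons, add_mul, one_mul]
        omega
    exact this l' (fun a ha => hl'.subset ha) _
  have h2 : l'.length ≤ p.eval (e x).size := by
    have := hl'.length_le
    have := length_lt_encList ((l x).map (ea x))
    have := hp x
    simp only [List.length_map] at *
    omega
  have h3 := hr x
  have h4 := Nat.mul_le_mul_right (q.eval (e x).size) h2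
  simp only [Polynomial.eval_add, Polynomial.eval_mul]
  omega

theorem reverse (hl : Comp e fun x => encList ((l x).map (ea x))) :
    Comp e fun x => encList ((l x).reverse.map (ea x)) := by
  obtain ⟨p, hp⟩ := hl.size_le
  have := foldl_growth (eb := fun x (b : List (A x)) => encList (b.map (ea x)))
    (b0 := fun _ => []) (step := fun x b a => a :: b) p hl (nil e)
    ((last _ _).pair (hd (refl _)).tl) ?_
  · refine this.congr fun x => ?_
    simp
  · intro x a ha b
    have h1 := size_le_encList (List.mem_map_of_mem (f := ea x) ha)
    have h2 := hp x
    simp only [encList, List.map_cons, Data.size]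
    omega

theorem foldr_growth {b0 : ∀ x, B x} {step : ∀ x, A x → B x → B x} (q : Polynomial ℕ)
    (hl : Comp e fun x => encList ((l x).map (ea x))) (hb : Comp e fun x => eb x (b0 x))
    (hstep : Comp (X := Σ x, B x × A x)
      (fun y => .cons (.cons (e y.1) (eb _ y.2.1)) (ea _ y.2.2))
      fun y => eb _ (step _ y.2.2 y.2.1))
    (hq : ∀ x, ∀ a ∈ l x, ∀ b, (eb x (step x a b)).size ≤ (eb x b).size + q.eval (e x).size) :
    Comp e fun x => eb x ((l x).foldr (step x) (b0 x)) := by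
  have := foldl_growth (step := fun x b a => step x a b) q hl.reverse hb hstep
    (by simpa using hq)
  simpa using this

theorem map {g : ∀ x, A x → Data} (hl : Comp e fun x => encList ((l x).map (ea x)))
    (hg : Comp (X := Σ x, A x) (fun y => .cons (e y.1) (ea _ y.2)) fun y => g y.1 y.2) :
    Comp e fun x => encList ((l x).map (g x)) := by
  obtain ⟨p, hp⟩ := hl.size_le
  obtain ⟨r, hr⟩ := hg.size_le
  have := foldr_growth (eb := fun x (b : List Data) => encList b)
    (b0 := fun _ => []) (step := fun x a b => g x a :: b) (r.comp (Polynomial.X + p + 1) + 1) hl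
    (nil e) (Comp.pair ?_ (hd (refl _)).tl) ?_
  · refine this.congr fun x => ?_
    congr 1
    induction l x with
    | nil => rfl
    | cons a t ih => simp [ih]
  · have h := hg.reindex (Y := Σ x, List Data × A x) fun y => ⟨y.1, y.2.2⟩
    exact ((hd (refl _)).hd.pair (last _ _)).trans h
  · intro x a ha b
    have h1 := size_le_encList (List.mem_map_of_mem (f := ea x) ha)
    have h2 := hp x
    have h3 := hr ⟨x, a⟩
    have h4 := poly_mono r (m := (Data.cons (e x) (ea x a)).size)
      (n := (e x).size + p.eval (e x).size + 1) (by simp only [Data.size]; omega)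
    simp only [encList, Data.size, Polynomial.eval_add, Polynomial.eval_comp, Polynomial.eval_X,
      Polynomial.eval_one] at *
    omega

theorem filter {p : ∀ x, A x → Bool} (hl : Comp e fun x => encList ((l x).map (ea x)))
    (hp : Comp (X := Σ x, A x) (fun y => .cons (e y.1) (ea _ y.2)) fun y => encBool (p y.1 y.2)) :
    Comp e fun x => encList (((l x).filter (p x)).map (ea x)) := by
  obtain ⟨q, hq⟩ := hl.size_le
  have := foldr_growth (eb := fun x (b : List (A x)) => encList (b.map (ea x)))
    (b0 := fun _ => []) (step := fun x a b => if p x a = true then a :: b else b) q hl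
    (nil e) ?_ ?_
  · refine this.congr fun x => ?_
    congr 2
    induction l x with
    | nil => rfl
    | cons a t ih => simp [ih, List.filter_cons]
  · have h := hp.reindex (Y := Σ x, List (A x) × A x) fun y => ⟨y.1, y.2.2⟩
    have h' : Comp (fun y : Σ x, List (A x) × A x => Data.cons (.cons (e y.1)
        (encList (y.2.1.map (ea y.1)))) (ea y.1 y.2.2)) fun y => encBool (p y.1 y.2.2) :=
      ((hd (refl _)).hd.pair (last _ _)).trans h
    refine (ite h' ((last _ _).pair (hd (refl _)).tl) (hd (refl _)).tl).congr ?_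
    intro y
    split_ifs <;> rfl
  · intro x a ha b
    have h1 := size_le_encList (List.mem_map_of_mem (f := ea x) ha)
    have h2 := hq x
    split_ifs
    · simp only [encList, List.map_cons, Data.size]
      omega
    · omega

theorem find? {p : ∀ x, A x → Bool} (hl : Comp e fun x => encList ((l x).map (ea x)))
    (hp : Comp (X := Σ x, A x) (fun y => .cons (e y.1) (ea _ y.2)) fun y => encBool (p y.1 y.2)) :
    Comp e fun x => encOpt (ea x) ((l x).find? (p x)) := by
  have h := filter hl hp
  have := ite' (p := fun x => (l x).filter (p x) ≠ []) h
    (fun x => by rw [encList_ne_nil]; simp) ((nil e).pair h.hd) (nil e)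
  refine this.congr fun x => ?_
  rw [← List.head?_filter]
  cases (l x).filter (p x) <;> simp [encOpt, encList, Data.hd]

theorem any {p : ∀ x, A x → Bool} (hl : Comp e fun x => encList ((l x).map (ea x)))
    (hp : Comp (X := Σ x, A x) (fun y => .cons (e y.1) (ea _ y.2)) fun y => encBool (p y.1 y.2)) :
    Comp e fun x => encBool ((l x).any (p x)) := by
  have := ite' (p := fun x => (l x).filter (p x) ≠ []) (filter hl hp)
    (fun x => by rw [encList_ne_nil]; simp) (const e (encBool true)) (const e (encBool false))
  refine this.congr fun x => ?_
  have h : (l x).filter (p x) ≠ [] ↔ (l x).any (p x) = true := by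
    rw [List.any_eq_true, ne_eq, List.filter_eq_nil_iff]
    push Not
    rfl
  rw [← apply_ite encBool]
  congr 1
  simp only [h]
  cases (l x).any (p x) <;> rfl

theorem not {b : X → Bool} (h : Comp e fun x => encBool (b x)) :
    Comp e fun x => encBool (!b x) :=
  (ite h (const e (encBool false)) (const e (encBool true))).congr fun x => by
    cases b x <;> rfl

theorem and {b c : X → Bool} (h : Comp e fun x => encBool (b x))
    (h' : Comp e fun x => encBool (c x)) : Comp e fun x => encBool (b x && c x) :=
  (ite h h' (const e (encBool false))).congr fun x => by cases b x <;> rfl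

theorem all {p : ∀ x, A x → Bool} (hl : Comp e fun x => encList ((l x).map (ea x)))
    (hp : Comp (X := Σ x, A x) (fun y => .cons (e y.1) (ea _ y.2)) fun y => encBool (p y.1 y.2)) :
    Comp e fun x => encBool ((l x).all (p x)) :=
  (any hl hp.not).not.congr fun x => by rw [List.all_eq_not_any_not]

theorem append (h₁ : Comp e fun x => encList ((l₁ x).map (ea x)))
    (h₂ : Comp e fun x => encList ((l₂ x).map (ea x))) :
    Comp e fun x => encList ((l₁ x ++ l₂ x).map (ea x)) := by
  obtain ⟨p, hp⟩ := h₁.size_le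
  have := foldr_growth (eb := fun x (b : List (A x)) => encList (b.map (ea x)))
    (b0 := l₂) (step := fun x a b => a :: b) p h₁ h₂
    ((last _ _).pair (hd (refl _)).tl) ?_
  · refine this.congr fun x => ?_
    simp
  · intro x a ha b
    have h1 := size_le_encList (List.mem_map_of_mem (f := ea x) ha)
    have h2 := hp x
    simp only [encList, List.map_cons, Data.size]
    omega

/-- Definition by cases for an optional value. -/
theorem option {o : ∀ x, Option (A x)} {g : ∀ x, A x → Data}
    (ho : Comp e fun x => encOpt (ea x) (o x)) (hn : Comp e d)
    (hs : Comp (X := Σ x, A x) (fun y => .cons (e y.1) (ea _ y.2)) fun y => g y.1 y.2) :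
    Comp e fun x => (o x).elim (d x) (g x) := by
  refine cases (p := fun x => o x ≠ none) ho (fun x => encOpt_ne_nil _ _) ?_ ?_
  · have h := hs.reindex (Y := {x // o x ≠ none}) fun y =>
      ⟨y.1, (o y.1).get (Option.isSome_iff_ne_none.2 y.2)⟩
    have h2 := ((refl e).pair ho.tl).reindex (Y := {x // o x ≠ none}) Subtype.val
    refine (h2.trans (h.congr_left ?_)).congr ?_
    · rintro ⟨x, hx⟩
      obtain ⟨a, ha⟩ := Option.ne_none_iff_exists'.1 hx
      simp [ha, encOpt, Data.tl]
    · rintro ⟨x, hx⟩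
      obtain ⟨a, ha⟩ := Option.ne_none_iff_exists'.1 hx
      simp [ha]
  · refine (hn.reindex Subtype.val).congr ?_
    rintro ⟨x, hx⟩
    simp only [ne_eq, not_not] at hx
    simp [hx]

theorem tail_iterate {n : X → ℕ} (hn : Comp e fun x => encUnary (n x)) (h : Comp e d) :
    Comp e fun x => Data.tl^[n x] (d x) := by
  have hs : ∀ (x : Data), x.tl.size ≤ x.size := by
    rintro (_ | _) <;> simp [Data.tl, Data.size]; omega
  have := foldl_growth (A := fun _ => Unit) (B := fun _ => Data) (l := fun x => List.replicate (n x) ())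
    (ea := fun _ _ => .nil) (eb := fun _ b => b) (b0 := d) (step := fun _ b _ => b.tl) 0
    (hn.congr fun x => by rw [encUnary, List.map_replicate]) h (hd (refl _)).tl.tl
    (fun x a _ b => by simpa using hs b)
  refine this.congr fun x => ?_
  generalize d x = b
  induction n x generalizing b with
  | zero => rfl
  | succ n ih => rw [List.replicate_succ, List.foldl_cons, ih, Function.iterate_succ_apply]

theorem tail_iterate_encList (n : ℕ) (l : List Data) :
    Data.tl^[n] (encList l) = encList (l.drop n) := by
  induction n generalizing l with
  | zero => rfl
  | succ n ih =>
    rw [Function.iterate_succ_apply]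
    cases l with
    | nil => simpa [encList, Data.tl] using ih []
    | cons a l => simpa [encList, Data.tl] using ih l

/-- Access to an array that is indexed by the slots. -/
theorem get {k : X → ℕ} {s : ∀ x, Fin (k x)} {g : ∀ x, Fin (k x) → Data}
    (hg : Comp e fun x => encList ((List.finRange (k x)).map (g x)))
    (hs : Comp e fun x => encUnary (s x)) : Comp e fun x => g x (s x) := by
  refine (tail_iterate hs hg).hd.congr fun x => ?_
  rw [tail_iterate_encList, List.drop_eq_getElem_cons (by simp)]
  simp [encList, Data.hd]

/-- The list of all slots. -/
theorem slots {k : X → ℕ} (hk : Comp e fun x => encUnary (k x)) :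
    Comp e fun x => encList ((List.finRange (k x)).map fun s : Fin _ => encUnary (s : ℕ)) := by
  obtain ⟨p, hp⟩ := hk.size_le
  -- Without arithmetic, the numbers below `n` are built by putting `0` in front and adding one to
  -- all entries, which is `Data.cons .nil` in unary.
  have key : ∀ n, (List.replicate n ()).foldl
      (fun (b : List Data) _ => encUnary 0 :: b.map (Data.cons .nil)) [] =
      (List.finRange n).map fun s : Fin _ => encUnary (s : ℕ) := by
    intro n
    induction n with
    | zero => rfl
    | succ n ih =>
      rw [List.replicate_succ', List.foldl_append, ih, List.finRange_succ]
      simp only [List.foldl_cons, List.foldl_nil, List.map_cons, List.map_map]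
      rfl
  have := foldl (A := fun _ => Unit) (B := fun _ => List Data)
    (l := fun x => List.replicate (k x) ())
    (ea := fun _ _ => .nil) (eb := fun _ b => encList b) (b0 := fun _ => [])
    (step := fun _ b _ => encUnary 0 :: b.map (Data.cons .nil)) (p * (p + 1) + 1)
    (hk.congr fun x => by rw [encUnary, List.map_replicate]) (nil e)
    ((const _ _).pair ((map (A := fun _ => Data) (ea := fun _ a => a)
      (l := fun y : {y : Σ _ : X, List Data × Unit // _} => y.1.2.1) (g := fun _ a => .cons .nil a) ?_ ?_))) ?_
  · refine this.congr fun x => ?_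
    rw [key]
  · simp only [List.map_id']
    exact (hd (refl _)).tl
  · exact (nil _).pair (last _ _)
  · intro x l' hl'
    obtain ⟨m, hm, rfl⟩ : ∃ m ≤ k x, l' = List.replicate m () := by
      refine ⟨l'.length, by simpa using hl'.length_le, ?_⟩
      exact List.eq_replicate_iff.2 ⟨rfl, fun _ _ => rfl⟩
    rw [key]
    have h1 := hp x
    rw [size_encUnary] at h1
    have h2 := size_encList_le_of_forall (l := (List.finRange m).map fun s : Fin _ => encUnary (s : ℕ))
      (m := p.eval (e x).size) (by
        intro y hy
        obtain ⟨s, -, rfl⟩ := List.mem_map.1 hy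
        rw [size_encUnary]
        have := s.2
        omega)
    refine h2.trans ?_
    simp only [List.length_map, List.length_finRange, Polynomial.eval_add, Polynomial.eval_mul,
      Polynomial.eval_one]
    have := Nat.mul_le_mul_right (p.eval (e x).size + 1) (show m ≤ p.eval (e x).size by omega)
    omega

end Comp

/-! ### Equality of trees -/

open Classical in
/-- One round of the comparison of trees. The state consists of a truth value and a list of pairs
of trees that have still to be compared. -/
noncomputable def cmpStep (z : Data) : Data :=
  if z.tl.hd.hd ≠ .nil then
    if z.tl.hd.tl ≠ .nil then
      .cons z.hd (.cons (.cons z.tl.hd.hd.hd z.tl.hd.tl.hd)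
        (.cons (.cons z.tl.hd.hd.tl z.tl.hd.tl.tl) z.tl.tl))
    else .cons .nil .nil
  else if z.tl.hd.tl ≠ .nil then .cons .nil .nil else .cons z.hd z.tl.tl

/-- The state that consists of the given truth value and list of pairs. -/
def cmpState (ok : Bool) (st : List (Data × Data)) : Data :=
  .cons (encBool ok) (encList (st.map fun p => .cons p.1 p.2))

theorem size_cmpState (ok : Bool) (st : List (Data × Data)) :
    (cmpState ok st).size ≤ 2 * (st.map fun p => p.1.size + p.2.size).sum + 5 := by
  have h1 : (encBool ok).size ≤ 3 := by cases ok <;> simp [encBool, Data.size]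
  have h2 : (encList (st.map fun p => .cons p.1 p.2)).size ≤
      2 * (st.map fun p => p.1.size + p.2.size).sum + 1 := by
    induction st with
    | nil => simp [encList, Data.size]
    | cons p st ih =>
      have := Data.size_pos p.1
      have := Data.size_pos p.2
      simp only [List.map_cons, encList, Data.size, List.sum_cons]
      omega
  simp only [cmpState, Data.size]
  omega

/-- Every round lowers the total size of the pending pairs: two leaves are dropped, two inner nodes
are replaced by two pairs of subtrees, and a mismatch empties the list and makes the truth value
false. The list stays nonempty up to the last round, so it serves as the loop test in `Comp.eq`. -/
theorem cmpStep_iterate (m : ℕ) : ∀ (st : List (Data × Data)) (ok : Bool),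
    (st.map fun p => p.1.size + p.2.size).sum ≤ m → ∃ n ≤ m,
      (∃ b : Bool, (b = true ↔ ok = true ∧ ∀ p ∈ st, p.1 = p.2) ∧
        cmpStep^[n] (cmpState ok st) = cmpState b []) ∧
      (∀ i ≤ n, (cmpStep^[i] (cmpState ok st)).size ≤ 2 * m + 5) ∧
      ∀ i < n, (cmpStep^[i] (cmpState ok st)).tl ≠ .nil := by
  induction m with
  | zero =>
    intro st ok h
    cases st with
    | nil => exact ⟨0, le_rfl, ⟨ok, by simp, rfl⟩, by
        intro i hi
        obtain rfl : i = 0 := by omega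
        exact (size_cmpState ok []).trans (by simp), by simp⟩
    | cons p st =>
      have := Data.size_pos p.1
      simp only [List.map_cons, List.sum_cons] at h
      omega
  | succ m ih =>
    intro st ok h
    cases st with
    | nil => exact ⟨0, by omega, ⟨ok, by simp, rfl⟩, by
        intro i hi
        obtain rfl : i = 0 := by omega
        exact (size_cmpState ok []).trans (by simp), by simp⟩
    | cons p st =>
      have hsz := (size_cmpState ok (p :: st)).trans
        (show _ ≤ 2 * (m + 1) + 5 by omega)
      have htl : (cmpState ok (p :: st)).tl ≠ .nil := by simp [cmpState, Data.tl, encList]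
      suffices H : ∃ st' ok', cmpStep (cmpState ok (p :: st)) = cmpState ok' st' ∧
          (st'.map fun p => p.1.size + p.2.size).sum ≤ m ∧
          ((ok' = true ∧ ∀ p ∈ st', p.1 = p.2) ↔ (ok = true ∧ ∀ q ∈ p :: st, q.1 = q.2)) by
        obtain ⟨st', ok', h1, h2, h3⟩ := H
        obtain ⟨n, hn, ⟨b, hb, hb'⟩, hs, ht⟩ := ih st' ok' h2
        refine ⟨n + 1, by omega, ⟨b, hb.trans h3, ?_⟩, ?_, ?_⟩
        · rw [Function.iterate_succ_apply, h1, hb']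
        · rintro (_ | i) hi
          · exact hsz
          · rw [Function.iterate_succ_apply, h1]
            exact (hs i (by omega)).trans (by omega)
        · rintro (_ | i) hi
          · exact htl
          · rw [Function.iterate_succ_apply, h1]
            exact ht i (by omega)
      obtain ⟨a, b⟩ := p
      simp only [List.map_cons, List.sum_cons] at h
      cases a with
      | nil =>
        cases b with
        | nil =>
          refine ⟨st, ok, by simp [cmpStep, cmpState, encList, Data.hd, Data.tl], ?_, by simp⟩
          simp only [Data.size] at h
          omega
        | cons b₁ b₂ =>
          exact ⟨[], false, by simp [cmpStep, cmpState, encList, encBool, Data.hd, Data.tl],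
            by simp, by simp⟩
      | cons a₁ a₂ =>
        cases b with
        | nil =>
          exact ⟨[], false, by simp [cmpStep, cmpState, encList, encBool, Data.hd, Data.tl],
            by simp, by simp⟩
        | cons b₁ b₂ =>
          refine ⟨(a₁, b₁) :: (a₂, b₂) :: st, ok,
            by simp [cmpStep, cmpState, encList, Data.hd, Data.tl], ?_, by simp [and_assoc]⟩
          simp only [Data.size] at h
          simp only [List.map_cons, List.sum_cons]
          omega

namespace Comp

variable {X Y : Type*} {e d d₁ d₂ : X → Data}

theorem cmpStep (h : Comp e d) : Comp e fun x => cmpStep (d x) := by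
  classical
  refine ite' h.tl.hd.hd (fun x => Iff.rfl) (ite' h.tl.hd.tl (fun x => Iff.rfl) ?_ ?_)
    (ite' h.tl.hd.tl (fun x => Iff.rfl) ?_ ?_)
  · exact h.hd.pair ((h.tl.hd.hd.hd.pair h.tl.hd.tl.hd).pair
      ((h.tl.hd.hd.tl.pair h.tl.hd.tl.tl).pair h.tl.tl))
  · exact const e _
  · exact const e _
  · exact h.hd.pair h.tl.tl

/-- Equality can be decided. -/
theorem eq {p : X → Prop} [DecidablePred p] (h₁ : Comp e d₁) (h₂ : Comp e d₂)
    (hp : ∀ x, d₁ x = d₂ x ↔ p x) : Comp e fun x => encBool (decide (p x)) := by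
  obtain ⟨p₁, hp₁⟩ := h₁.size_le
  obtain ⟨p₂, hp₂⟩ := h₂.size_le
  choose n hn b hs ht using fun x =>
    cmpStep_iterate ((d₁ x).size + (d₂ x).size) [(d₁ x, d₂ x)] true (by simp)
  choose b hb hb' using b
  have := loop (e := e) (n := n) (s := fun x i => SlotPaging.cmpStep^[i]
    (cmpState true [(d₁ x, d₂ x)])) (p₁ + p₂) (2 * (p₁ + p₂) + 5) ?_ ?_ ?_ ?_
    (c := fun y => (SlotPaging.cmpStep^[y.1.2] (cmpState true [(d₁ y.1.1, d₂ y.1.1)])).tl) ?_ ?_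
  · refine this.hd.congr fun x => ?_
    rw [hb']
    simp only [cmpState, Data.hd]
    congr 1
    rw [Bool.eq_iff_iff, hb]
    simp [hp]
  · intro x
    have := hn x
    have := hp₁ x
    have := hp₂ x
    simp only [Polynomial.eval_add]
    omega
  · intro x i hi
    have := hs x i hi
    have := hp₁ x
    have := hp₂ x
    simp only [Polynomial.eval_add, Polynomial.eval_mul, Polynomial.eval_ofNat]
    omega
  · exact (const e _).pair ((h₁.pair h₂).pair (nil e))
  · simp only [Function.iterate_succ_apply']
    exact (last _ _).cmpStep
  · exact (last _ _).tl
  · rintro ⟨⟨x, i⟩, hi⟩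
    simp only at hi ⊢
    constructor
    · intro h
      rcases hi.lt_or_eq with h' | rfl
      · exact h'
      · rw [hb'] at h
        simp [cmpState, encList, Data.tl] at h
    · exact ht x i

end Comp

/-! ### Layers

The offset function of paging with `m` slots is represented by a list of `m` layers, the top one
first: a set `C` of pages can be in the cache at the least possible cost iff each final segment of
`j` layers contains at most `j` pages of `C`, and `C` is contained in the union of the layers. -/

section Layers

set_option linter.unusedSectionVars false

variable {V : Type*} [DecidableEq V]

/-- Add a layer to the topmost layer of a list, if there is one. -/
def pushLayer (A : List V) : List (List V) → List (List V)
  | [] => []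
  | B :: T => (A ++ B) :: T

/-- Remove one layer, by merging the two topmost layers. -/
def truncLayers : List (List V) → List (List V)
  | [] => []
  | A :: T => pushLayer A T

/-- The layers after a page has been chosen, without that page. -/
def contract (z : V) : List (List V) → List (List V)
  | [] => []
  | A :: T => if z ∈ A then pushLayer (A.filter (· ≠ z)) T else A :: contract z T

/-- The layers after a request. -/
def reqLayers (v : V) (T : List (List V)) : List (List V) :=
  [v] :: if v ∈ T.flatten then contract v T else truncLayers T

/-- Greedy choice of pages in the order of the given list. -/
def basis : List (List V) → List V → List V
  | _, [] => []
  | T, z :: O => if z ∈ T.flatten then z :: basis (contract z T) O else basis T O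

theorem length_pushLayer (A : List V) (T : List (List V)) :
    (pushLayer A T).length = T.length := by
  cases T <;> simp [pushLayer]

theorem length_truncLayers (T : List (List V)) : (truncLayers T).length = T.length - 1 := by
  cases T <;> simp [truncLayers, length_pushLayer]

theorem length_contract {z : V} {T : List (List V)} (h : z ∈ T.flatten) :
    (contract z T).length + 1 = T.length := by
  induction T with
  | nil => simp at h
  | cons A T ih =>
    rw [contract]
    split_ifs with hA
    · simp [length_pushLayer]
    · have : z ∈ T.flatten := by simpa [hA] using h
      simp [ih this]

theorem length_reqLayers (v : V) {T : List (List V)} (h : T ≠ []) :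
    (reqLayers v T).length = T.length := by
  have : 0 < T.length := List.length_pos_iff.2 h
  rw [reqLayers, List.length_cons]
  split_ifs with hv
  · exact length_contract hv
  · rw [length_truncLayers]
    omega

theorem contract_eq_self {z : V} {T : List (List V)} (h : z ∉ T.flatten) : contract z T = T := by
  induction T with
  | nil => rfl
  | cons A T ih =>
    simp only [List.flatten_cons, List.mem_append, not_or] at h
    rw [contract, if_neg h.1, ih h.2]

theorem flatten_pushLayer_sublist (A : List V) (T : List (List V)) :
    (pushLayer A T).flatten.Sublist (A ++ T.flatten) := by
  cases T <;> simp [pushLayer]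

theorem flatten_truncLayers_sublist (T : List (List V)) :
    (truncLayers T).flatten.Sublist T.flatten := by
  cases T with
  | nil => exact List.Sublist.refl _
  | cons A T => exact flatten_pushLayer_sublist A T

theorem flatten_contract_sublist (z : V) (T : List (List V)) :
    (contract z T).flatten.Sublist T.flatten := by
  induction T with
  | nil => exact List.Sublist.refl _
  | cons A T ih =>
    rw [contract]
    split_ifs
    · refine (flatten_pushLayer_sublist _ T).trans ?_
      exact List.Sublist.append (List.filter_sublist ..) (List.Sublist.refl _)
    · exact List.Sublist.append (List.Sublist.refl _) ih

theorem notMem_contract {z : V} {T : List (List V)} (h : T.flatten.Nodup) :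
    z ∉ (contract z T).flatten := by
  induction T with
  | nil => simp [contract]
  | cons A T ih =>
    rw [List.flatten_cons, List.nodup_append] at h
    rw [contract]
    split_ifs with hA
    · intro hz
      have := (flatten_pushLayer_sublist _ T).subset hz
      simp only [List.mem_append, List.mem_filter, ne_eq, decide_not, Bool.not_eq_true',
        decide_eq_false_iff_not, not_true_eq_false, and_false, false_or] at this
      exact h.2.2 z hA z this rfl
    · simp [hA, ih h.2.1]

theorem nodup_reqLayers (v : V) {T : List (List V)} (h : T.flatten.Nodup) :
    (reqLayers v T).flatten.Nodup := by
  rw [reqLayers, List.flatten_cons, List.singleton_append, List.nodup_cons]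
  split_ifs with hv
  · exact ⟨notMem_contract h, h.sublist (flatten_contract_sublist v T)⟩
  · exact ⟨fun h' => hv ((flatten_truncLayers_sublist T).subset h'),
      h.sublist (flatten_truncLayers_sublist T)⟩

theorem mem_reqLayers {v x : V} {T : List (List V)} (h : x ∈ (reqLayers v T).flatten) :
    x = v ∨ x ∈ T.flatten := by
  rw [reqLayers, List.flatten_cons, List.singleton_append, List.mem_cons] at h
  refine h.imp_right fun h => ?_
  split_ifs at h with hv
  · exact (flatten_contract_sublist v T).subset h
  · exact (flatten_truncLayers_sublist T).subset h

theorem filter_eq_self_of_notMem {p : V} {A : List V} (h : p ∉ A) : A.filter (· ≠ p) = A := by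
  rw [List.filter_eq_self]
  intro a ha
  simp only [ne_eq, decide_not, Bool.not_eq_true', decide_eq_false_iff_not]
  rintro rfl
  exact h ha

/-- As `pushLayer A T` is `truncLayers (A :: T)`, this is the computation behind
`contract_truncLayers` and behind the cases of `contract_comm` in which a page leaves the top layer.
-/
theorem contract_pushLayer {p : V} {A : List V} {T : List (List V)}
    (h : (A ++ T.flatten).Nodup) (hT : T ≠ []) :
    contract p (pushLayer A T) =
      if p ∈ A then pushLayer (A.filter (· ≠ p)) (truncLayers T) else
        contract p (A :: T) |> truncLayers := by
  cases T with
  | nil => exact absurd rfl hT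
  | cons B T =>
    rw [List.flatten_cons, ← List.append_assoc, List.nodup_append, List.nodup_append] at h
    obtain ⟨⟨_, _, hAB⟩, _, hABT⟩ := h
    rw [pushLayer, contract]
    by_cases hA : p ∈ A
    · have hB : p ∉ B := fun hB => hAB p hA p hB rfl
      rw [if_pos (List.mem_append_left _ hA), if_pos hA, truncLayers, List.filter_append,
        filter_eq_self_of_notMem hB]
      cases T <;> simp [pushLayer]
    · rw [if_neg hA, contract, if_neg hA, contract]
      by_cases hB : p ∈ B
      · rw [if_pos (List.mem_append_right _ hB), if_pos hB, truncLayers, List.filter_append,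
          filter_eq_self_of_notMem hA]
        cases T <;> simp [pushLayer]
      · rw [if_neg (by simp [hA, hB]), if_neg hB]
        rfl

theorem contract_truncLayers {p : V} {T : List (List V)} (h : T.flatten.Nodup)
    (hp : p ∈ (truncLayers T).flatten) :
    contract p (truncLayers T) = truncLayers (contract p T) := by
  match T with
  | [] => rfl
  | [A] => simp [truncLayers, pushLayer] at hp
  | A :: B :: T =>
    rw [truncLayers, contract_pushLayer (by simpa using h) (by simp)]
    split_ifs with hA
    · rw [contract, if_pos hA]
      simp only [truncLayers, pushLayer]
      cases T <;> simp [pushLayer]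
    · rfl

/-- Contraction by two jointly independent pages does not depend on the order. If both lie in one
layer, the first contraction moves the other page down into the next layer, where the second one
acts. -/
theorem contract_comm {p z : V} {T : List (List V)} (h : T.flatten.Nodup)
    (hz : z ∈ (contract p T).flatten) (hp : p ∈ (contract z T).flatten) :
    contract p (contract z T) = contract z (contract p T) := by
  induction T with
  | nil => rfl
  | cons A T ih =>
    have h' := h
    rw [List.flatten_cons, List.nodup_append] at h'
    rw [contract] at hz hp
    by_cases hpA : p ∈ A
    · by_cases hzA : z ∈ A
      · have hne : ∀ q : V, ((A.filter (· ≠ q)) ++ T.flatten).Nodup := fun q =>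
          h.sublist (List.Sublist.append (List.filter_sublist ..) (List.Sublist.refl _))
        have hT : T ≠ [] := by
          rintro rfl
          simp [hpA, pushLayer] at hz
        have hpz : p ≠ z := by
          rintro rfl
          rw [if_pos hpA] at hz
          have := (flatten_pushLayer_sublist _ T).subset hz
          simp only [List.mem_append, List.mem_filter, ne_eq, decide_not, Bool.not_eq_true',
            decide_eq_false_iff_not, not_true_eq_false, and_false, false_or] at this
          exact h'.2.2 p hpA p this rfl
        rw [contract, if_pos hzA, contract, if_pos hpA, contract_pushLayer (hne z) hT,
          contract_pushLayer (hne p) hT, if_pos (by simp [hpA, hpz]),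
          if_pos (by simp [hzA, hpz.symm]), List.filter_filter, List.filter_filter]
        simp only [Bool.and_comm]
      · rw [if_pos hpA] at hz
        have hT : T ≠ [] := by
          rintro rfl
          simp [pushLayer] at hz
        have hn : ((A.filter (· ≠ p)) ++ T.flatten).Nodup :=
          h.sublist (List.Sublist.append (List.filter_sublist ..) (List.Sublist.refl _))
        rw [contract, if_neg hzA, contract, if_pos hpA, contract, if_pos hpA,
          contract_pushLayer hn hT, if_neg (by simp [hzA]), contract, if_neg (by simp [hzA])]
        rfl
    · by_cases hzA : z ∈ A
      · rw [if_pos hzA] at hp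
        have hT : T ≠ [] := by
          rintro rfl
          simp [pushLayer] at hp
        have hn : ((A.filter (· ≠ z)) ++ T.flatten).Nodup :=
          h.sublist (List.Sublist.append (List.filter_sublist ..) (List.Sublist.refl _))
        rw [contract, if_pos hzA, contract, if_neg hpA, contract, if_pos hzA,
          contract_pushLayer hn hT, if_neg (by simp [hpA]), contract, if_neg (by simp [hpA])]
        rfl
      · rw [if_neg hpA, List.flatten_cons, List.mem_append, or_iff_right hzA] at hz
        rw [if_neg hzA, List.flatten_cons, List.mem_append, or_iff_right hpA] at hp
        rw [contract, if_neg hzA, contract, if_neg hpA, contract, if_neg hpA, contract,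
          if_neg hzA, ih h'.2.1 hz hp]

/-- Pages that exclude each other have the same effect. -/
theorem contract_eq_contract {p z : V} {T : List (List V)} (hp : p ∈ T.flatten)
    (hz : z ∈ T.flatten) (hpz : z ≠ p) (h : z ∉ (contract p T).flatten) :
    contract z T = contract p T := by
  induction T with
  | nil => rfl
  | cons A T ih =>
    rw [contract] at h
    split_ifs at h with hA
    · have hT : T = [] ∧ z ∈ A := by
        cases T with
        | nil => simpa using hz
        | cons B T =>
          simp only [pushLayer, List.flatten_cons, List.mem_append, List.mem_filter, not_or] at h hz
          have hzA : z ∉ A := fun hzA => h.1.1 ⟨hzA, by simpa using hpz⟩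
          exact absurd hz (by simp [hzA, h.1.2, h.2])
      obtain ⟨rfl, hzA⟩ := hT
      rw [contract, if_pos hzA, contract, if_pos hA]
      rfl
    · simp only [List.flatten_cons, List.mem_append, not_or] at h hz hp
      rw [contract, if_neg h.1, contract, if_neg hA,
        ih (hp.resolve_left hA) (hz.resolve_left h.1) h.2]

/-- Joint independence is symmetric: otherwise `p` and `z` would be parallel, the two contractions
would agree by `contract_eq_contract`, and `z` would survive its own contraction. -/
theorem mem_contract_comm {p z : V} {T : List (List V)} (hT : T.flatten.Nodup)
    (hp : p ∈ T.flatten) (hz : z ∈ (contract p T).flatten) : p ∈ (contract z T).flatten := by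
  by_contra h
  have hz' := (flatten_contract_sublist p T).subset hz
  have hpz : p ≠ z := by
    rintro rfl
    exact notMem_contract hT hz
  rw [contract_eq_contract hz' hp hpz h] at hz
  exact notMem_contract hT hz

theorem nodup_contract {z : V} {T : List (List V)} (h : T.flatten.Nodup) :
    (contract z T).flatten.Nodup :=
  h.sublist (flatten_contract_sublist z T)

theorem basis_subset_flatten (T : List (List V)) (O : List V) : basis T O ⊆ T.flatten := by
  induction O generalizing T with
  | nil => simp [basis]
  | cons z O ih =>
    rw [basis]
    split_ifs with h
    · exact List.cons_subset.2 ⟨h, List.Subset.trans (ih _) (flatten_contract_sublist z T).subset⟩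
    · exact ih T

theorem length_basis_le (T : List (List V)) (O : List V) : (basis T O).length ≤ T.length := by
  induction O generalizing T with
  | nil => simp [basis]
  | cons z O ih =>
    rw [basis]
    split_ifs with h
    · have := ih (contract z T)
      have := length_contract h
      rw [List.length_cons]
      omega
    · exact ih T

/-- If the greedy choice takes a page parallel to `p`, the contracted and the uncontracted choice
agree from then on; if it takes another page, the two contractions commute and the induction goes
on. -/
theorem basis_contract_subset {p : V} {T : List (List V)} (hT : T.flatten.Nodup) (O : List V) :
    basis (contract p T) O ⊆ basis T O := by
  by_cases hp : p ∈ T.flatten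
  swap
  · rw [contract_eq_self hp]
    exact List.Subset.refl _
  induction O generalizing T with
  | nil => simp [basis]
  | cons z O ih =>
    by_cases hz : z ∈ T.flatten
    · rw [basis, basis, if_pos hz]
      by_cases hpz : z = p
      · subst hpz
        rw [if_neg (notMem_contract hT)]
        exact List.subset_cons_self _ _
      split_ifs with h
      · have hp' := mem_contract_comm hT hp h
        rw [← contract_comm hT h hp']
        exact List.cons_subset_cons _ (ih (nodup_contract hT) hp')
      · rw [contract_eq_contract hp hz hpz h]
        exact List.subset_cons_self _ _
    · rw [basis, basis, if_neg hz,
        if_neg fun h => hz ((flatten_contract_sublist p T).subset h)]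
      exact ih hT hp

theorem mem_truncLayers {z : V} {T : List (List V)} (hz : z ∈ T.flatten) (hT : 2 ≤ T.length) :
    z ∈ (truncLayers T).flatten := by
  match T with
  | [] => simp at hT
  | [A] => simp at hT
  | A :: B :: T => simpa [truncLayers, pushLayer] using hz

theorem truncLayers_of_length {T : List (List V)} (hT : T.length < 2) : truncLayers T = [] := by
  match T with
  | [] => rfl
  | [A] => rfl
  | A :: B :: T => simp at hT

/-- Both greedy choices agree until the truncated matroid has no layer left. -/
theorem basis_truncLayers_subset {T : List (List V)} (hT : T.flatten.Nodup) (O : List V) :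
    basis (truncLayers T) O ⊆ basis T O := by
  induction O generalizing T with
  | nil => simp [basis]
  | cons z O ih =>
    rw [basis, basis]
    split_ifs with h h' h'
    · rw [contract_truncLayers hT h]
      exact List.cons_subset_cons _ (ih (nodup_contract hT))
    · exact absurd ((flatten_truncLayers_sublist T).subset h) h'
    · have : truncLayers T = [] := by
        refine truncLayers_of_length ?_
        by_contra h2
        exact h (mem_truncLayers h' (by omega))
      rw [this]
      intro x hx
      simpa using basis_subset_flatten _ _ hx
    · exact ih hT

/-- The order of pages that do not occur does not matter. -/
theorem basis_append_of_notMem {v : V} {T : List (List V)} (hv : v ∉ T.flatten) (O O' : List V) :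
    basis T (O ++ v :: O') = basis T (O ++ O') := by
  induction O generalizing T with
  | nil => simp [basis, hv]
  | cons z O ih =>
    rw [List.cons_append, List.cons_append, basis, basis, ih hv,
      ih fun h => hv ((flatten_contract_sublist z T).subset h)]

theorem pushLayer_nil (T : List (List V)) : pushLayer [] T = T := by
  cases T <;> rfl

/-- A topmost layer with a single page imposes no restriction, so this page is a coloop. It belongs
to the basis for every order that contains it, and it does not influence the choice of the others.
-/
theorem mem_basis_of_singleton {v : V} {T : List (List V)} (hT : T.flatten.Nodup)
    (hv : v ∉ T.flatten) {O : List V} (hO : v ∈ O) : v ∈ basis ([v] :: T) O := by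
  induction O generalizing T with
  | nil => simp at hO
  | cons z O ih =>
    by_cases hz : z = v
    · subst hz
      rw [basis, if_pos (by simp)]
      exact List.mem_cons_self ..
    · have hO' : v ∈ O := (List.mem_cons.1 hO).resolve_left (Ne.symm hz)
      rw [basis]
      split_ifs
      · rw [contract, if_neg (by simpa using hz)]
        exact List.mem_cons_of_mem _ (ih (nodup_contract hT)
          (fun h => hv ((flatten_contract_sublist z T).subset h)) hO')
      · exact ih hT hv hO'

theorem basis_singleton_subset {v : V} {T : List (List V)} (hT : T.flatten.Nodup)
    (hv : v ∉ T.flatten) (O : List V) : basis ([v] :: T) O ⊆ v :: basis T O := by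
  induction O generalizing T with
  | nil => simp [basis]
  | cons z O ih =>
    by_cases hz : z = v
    · subst hz
      rw [basis, if_pos (by simp), contract, if_pos (by simp), basis, if_neg hv]
      simp [pushLayer_nil]
    · rw [basis, basis]
      have : z ∈ ([v] :: T).flatten ↔ z ∈ T.flatten := by simp [hz]
      simp only [this]
      split_ifs with h
      · rw [contract, if_neg (by simpa using hz)]
        have := ih (nodup_contract (z := z) hT)
          fun h => hv ((flatten_contract_sublist z T).subset h)
        intro x hx
        rcases List.mem_cons.1 hx with rfl | hx
        · simp
        · rcases List.mem_cons.1 (this hx) with rfl | hx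
          · simp
          · simp [hx]
      · exact ih hT hv

theorem notMem_reqLayers_tail {v : V} {T : List (List V)} (hT : T.flatten.Nodup) :
    v ∉ (if v ∈ T.flatten then contract v T else truncLayers T).flatten := by
  split_ifs with h
  · exact notMem_contract hT
  · exact fun h' => h ((flatten_truncLayers_sublist T).subset h')

theorem nodup_reqLayers_tail {v : V} {T : List (List V)} (hT : T.flatten.Nodup) :
    (if v ∈ T.flatten then contract v T else truncLayers T).flatten.Nodup := by
  split_ifs with h
  · exact nodup_contract hT
  · exact hT.sublist (flatten_truncLayers_sublist T)

theorem mem_basis_reqLayers {v : V} {T : List (List V)} (hT : T.flatten.Nodup) {O : List V}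
    (hO : v ∈ O) : v ∈ basis (reqLayers v T) O :=
  mem_basis_of_singleton (nodup_reqLayers_tail hT) (notMem_reqLayers_tail hT) hO

/-- The reason why the cache is lazy: only the requested page can enter. The hypothesis `h` lets the
order change too, as long as only the place of `v` is concerned. -/
theorem basis_reqLayers_subset (v : V) {T : List (List V)} (hT : T.flatten.Nodup) {O O' : List V}
    (h : ∀ T' : List (List V), T'.flatten ⊆ T.flatten → v ∉ T'.flatten →
      basis T' O' = basis T' O) :
    basis (reqLayers v T) O' ⊆ v :: basis T O := by
  refine List.Subset.trans
    (basis_singleton_subset (nodup_reqLayers_tail hT) (notMem_reqLayers_tail hT) O') ?_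
  refine List.cons_subset_cons _ ?_
  rw [h _ ?_ (notMem_reqLayers_tail hT)]
  · split_ifs with hv
    · exact basis_contract_subset hT O
    · exact basis_truncLayers_subset hT O
  · split_ifs with hv
    · exact (flatten_contract_sublist v T).subset
    · exact (flatten_truncLayers_sublist T).subset

end Layers

/-! ### The lower bound for paging, and the potential of the deterministic algorithm -/

section Layers

set_option linter.unusedSectionVars false

variable {V : Type*} [DecidableEq V]

/-- A cut through the contracted layers comes from a cut of the old ones either above the layer of
`v`, with one more layer below the cut, or below that layer, with `v` added to the pages above the
cut. -/
theorem contract_split {v : V} {T P U : List (List V)} (hv : v ∈ T.flatten)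
    (h : contract v T = P ++ U) :
    (∃ U₀, T = P ++ U₀ ∧ U₀.length = U.length + 1 ∧ v ∉ P.flatten) ∨
      ∃ P₀, T = P₀ ++ U ∧ ∀ x, x ∈ P₀.flatten ↔ x = v ∨ x ∈ P.flatten := by
  induction T generalizing P with
  | nil => simp at hv
  | cons A T ih =>
    have hlen := length_contract hv
    rw [contract] at h hlen
    cases P with
    | nil =>
      refine Or.inl ⟨A :: T, rfl, ?_, by simp⟩
      rw [h] at hlen
      exact hlen.symm
    | cons B P =>
      split_ifs at h with hA
      · cases T with
        | nil => simp [pushLayer] at h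
        | cons C T =>
          simp only [pushLayer, List.cons_append, List.cons.injEq] at h
          obtain ⟨rfl, rfl⟩ := h
          refine Or.inr ⟨A :: C :: P, rfl, fun x => ?_⟩
          by_cases hx : x = v
          · subst hx
            simp [hA]
          · simp [hx]
      · simp only [List.cons_append, List.cons.injEq] at h
        obtain ⟨rfl, h⟩ := h
        have hv' : v ∈ T.flatten := by simpa [hA] using hv
        rcases ih hv' h with ⟨U₀, rfl, h1, h2⟩ | ⟨P₀, rfl, h1⟩
        · exact Or.inl ⟨U₀, rfl, h1, by simpa [hA] using h2⟩
        · refine Or.inr ⟨A :: P₀, rfl, fun x => ?_⟩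
          rw [List.flatten_cons, List.mem_append, h1, List.flatten_cons, List.mem_append]
          tauto

theorem truncLayers_split {T P U : List (List V)} (h : truncLayers T = P ++ U) :
    P = [] ∨ ∃ P₀, T = P₀ ++ U ∧ ∀ x, x ∈ P₀.flatten ↔ x ∈ P.flatten := by
  match T, P with
  | _, [] => exact Or.inl rfl
  | [], B :: P => simp [truncLayers] at h
  | [A], B :: P => simp [truncLayers, pushLayer] at h
  | A :: C :: T, B :: P =>
    simp only [truncLayers, pushLayer, List.cons_append, List.cons.injEq] at h
    obtain ⟨rfl, rfl⟩ := h
    exact Or.inr ⟨A :: C :: P, rfl, fun x => by simp⟩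

/-- The lower bound on the cost `c` of a solution of which the cache is `D` at present, where `L`
is the number of requests to pages that were in no layer. -/
def LayerBound (D : Finset V) (T : List (List V)) (L c : ℕ) : Prop :=
  ∀ P U, T = P ++ U → (D.filter fun x => x ∉ P.flatten).card + L ≤ c + U.length

theorem layerBound_init (m : ℕ) : LayerBound (∅ : Finset V) (List.replicate m []) 0 0 := by
  intro P U _
  simp

theorem LayerBound.le {D : Finset V} {T : List (List V)} {L c : ℕ} (h : LayerBound D T L c) :
    L ≤ c := by
  have := h T [] (by simp)
  simp only [List.length_nil] at this
  omega

theorem LayerBound.mono {D D' : Finset V} {T : List (List V)} {L c : ℕ} (h : LayerBound D T L c) :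
    LayerBound D' T L (c + (D' \ D).card) := by
  intro P U hT
  have h1 := h P U hT
  have h2 : (D'.filter fun x => x ∉ P.flatten).card ≤
      (D.filter fun x => x ∉ P.flatten).card + (D' \ D).card := by
    refine (Finset.card_le_card ?_).trans (Finset.card_union_le _ _)
    intro x hx
    by_cases hD : x ∈ D <;> simp_all
  omega

/-- The new layer `[v]` takes `v`, which is in `D`, out of the count below it. This makes up for the
layer lost by contraction or for the increase of `L`. For `P = []` the bound is `D.card ≤ T.length`
together with the bound on `L`; for a new page, the old bound for the cut below all layers gives `L
+ 1 ≤ c`. -/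
theorem LayerBound.step {D : Finset V} {T : List (List V)} {L c : ℕ} (h : LayerBound D T L c)
    {v : V} (hv : v ∈ D) (hD : D.card ≤ T.length) (hne : T ≠ []) :
    LayerBound D (reqLayers v T) (L + if v ∈ T.flatten then 0 else 1) c := by
  have hpos : 0 < T.length := List.length_pos_iff.2 hne
  have hle := h.le
  have hlt : L + (if v ∈ T.flatten then 0 else 1) ≤ c := by
    split_ifs with hvT
    · simpa using hle
    · have h1 := h T [] (by simp)
      have h2 : 0 < (D.filter fun x => x ∉ T.flatten).card :=
        Finset.card_pos.2 ⟨v, Finset.mem_filter.2 ⟨hv, hvT⟩⟩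
      simp only [List.length_nil] at h1
      omega
  intro P U hPU
  cases P with
  | nil =>
    have h1 : U.length = T.length := by
      rw [← length_reqLayers v hne, hPU]
      rfl
    have h2 := Finset.card_filter_le D fun x => x ∉ ([] : List (List V)).flatten
    omega
  | cons B P =>
    rw [reqLayers, List.cons_append, List.cons.injEq] at hPU
    obtain ⟨rfl, hPU⟩ := hPU
    have key : v ∉ P.flatten → (D.filter fun x => x ∉ ([v] :: P).flatten).card + 1 =
        (D.filter fun x => x ∉ P.flatten).card := by
      intro hvP
      have : (D.filter fun x => x ∉ ([v] :: P).flatten) =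
          (D.filter fun x => x ∉ P.flatten).erase v := by
        ext x
        simp only [Finset.mem_filter, Finset.mem_erase, List.flatten_cons, List.mem_append,
          List.mem_singleton]
        tauto
      rw [this]
      exact Finset.card_erase_add_one (Finset.mem_filter.2 ⟨hv, hvP⟩)
    split_ifs at hPU hlt ⊢ with hvT
    · rcases contract_split hvT hPU with ⟨U₀, hT, h1, h2⟩ | ⟨P₀, hT, h1⟩
      · have h3 := h P U₀ hT
        have h4 := key h2
        omega
      · have h3 := h P₀ U hT
        have h4 : (D.filter fun x => x ∉ ([v] :: P).flatten) = D.filter fun x => x ∉ P₀.flatten := by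
          ext x
          simp [h1]
        rw [h4]
        omega
    · rcases truncLayers_split hPU with rfl | ⟨P₀, hT, h1⟩
      · have h2 : U.length = T.length - 1 := by
          rw [← length_truncLayers, hPU]
          rfl
        have h3 := key (by simp)
        have h4 := Finset.card_filter_le D fun x => x ∉ ([] : List (List V)).flatten
        omega
      · have h3 := h P₀ U hT
        have h4 : (D.filter fun x => x ∉ P.flatten) = D.filter fun x => x ∉ P₀.flatten := by
          ext x
          simp only [h1]
        have h5 := key (fun h => hvT (by
          rw [hT, List.flatten_append]
          exact List.mem_append_left _ ((h1 v).2 h)))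
        rw [h4] at h5
        omega

/-- The number of layers below the topmost singletons. -/
def loose : List (List V) → ℕ
  | [] => 0
  | A :: T => if A.length = 1 then loose T else T.length + 1

theorem loose_le (T : List (List V)) : loose T ≤ T.length := by
  induction T with
  | nil => simp [loose]
  | cons A T ih =>
    rw [loose, List.length_cons]
    split_ifs <;> omega

theorem basis_subset_singleton {v : V} {T : List (List V)} (hT : T.flatten.Nodup)
    (hv : v ∉ T.flatten) (O : List V) : basis T O ⊆ basis ([v] :: T) O := by
  induction O generalizing T with
  | nil => simp [basis]
  | cons z O ih =>
    by_cases hz : z = v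
    · subst hz
      rw [basis, if_neg hv, basis, if_pos (by simp), contract, if_pos (by simp), show (List.filter (fun x => decide (x ≠ z)) [z]) = [] by simp, pushLayer_nil]
      exact List.subset_cons_self _ _
    · rw [basis, basis]
      have : z ∈ ([v] :: T).flatten ↔ z ∈ T.flatten := by simp [hz]
      simp only [this]
      split_ifs with h
      · rw [contract, if_neg (by simpa using hz)]
        exact List.cons_subset_cons _ (ih (nodup_contract (z := z) hT)
          fun h => hv ((flatten_contract_sublist z T).subset h))
      · exact ih hT hv

/-- A request to a page of a layer does not make more layers loose, and it makes fewer layers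
loose if the page is missing in the cache. -/
theorem loose_contract {v : V} {T : List (List V)} (hT : T.flatten.Nodup) (hv : v ∈ T.flatten)
    {O : List V} (hO : v ∈ O) :
    loose (contract v T) + (if v ∈ basis T O then 0 else 1) ≤ loose T := by
  induction T with
  | nil => simp at hv
  | cons A T ih =>
    have hlen := length_contract hv
    have hite : (if v ∈ basis (A :: T) O then 0 else 1) ≤ 1 := by split_ifs <;> omega
    have hle := loose_le (contract v (A :: T))
    by_cases h1 : A.length = 1
    · obtain ⟨a, rfl⟩ := List.length_eq_one_iff.1 h1
      simp only [List.flatten_cons, List.singleton_append, List.nodup_cons] at hT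
      by_cases hva : v = a
      · subst hva
        rw [if_pos (mem_basis_of_singleton hT.2 hT.1 hO), contract, if_pos (by simp), loose,
          if_pos h1]
        simp [pushLayer_nil]
      · have hv' : v ∈ T.flatten := by simpa [hva] using hv
        have h2 := ih hT.2 hv'
        rw [contract, if_neg (by simpa using hva), loose, loose, if_pos h1, if_pos h1]
        refine le_trans (Nat.add_le_add_left ?_ _) h2
        split_ifs with h3 h4 h4
        · exact le_rfl
        · omega
        · exact absurd (basis_subset_singleton hT.2 hT.1 O h4) h3
        · exact le_rfl
    -- Here all layers are loose and the contraction removes one of them, which pays for a possible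
    -- miss.
    · rw [loose.eq_2, if_neg h1]
      simp only [List.length_cons] at hlen
      omega

/-- A new page is missed and may make all layers but the topmost loose; `T.length` pays for both. -/
theorem loose_reqLayers {v : V} {T : List (List V)} (hT : T.flatten.Nodup) (hne : T ≠ [])
    {O : List V} (hO : ∀ x ∈ T.flatten, x ∈ O) :
    loose (reqLayers v T) + (if v ∈ basis T O then 0 else 1) ≤
      loose T + T.length * (if v ∈ T.flatten then 0 else 1) := by
  have hpos : 0 < T.length := List.length_pos_iff.2 hne
  rw [reqLayers, loose, if_pos (List.length_singleton ..)]
  by_cases h1 : v ∈ T.flatten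
  · simpa [h1] using loose_contract hT h1 (hO v h1)
  · have h2 : v ∉ basis T O := fun h2 => h1 (basis_subset_flatten _ _ h2)
    have := loose_le (truncLayers T)
    rw [length_truncLayers] at this
    simp only [h1, h2, if_false]
    omega

end Layers

/-! ### Random priorities: probability of a miss and potential -/

section RandomOrder

set_option linter.unusedSectionVars false

variable {V : Type*} [DecidableEq V]

/-- The number of pages in a cache that is filled with pages of the layers. -/
def layerRank : List (List V) → ℕ
  | [] => 0
  | A :: T => min (T.length + 1) (layerRank T + A.length)

/-- The probability that `p` is missing in the basis for a random order; the first argument is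
the number of layers. -/
noncomputable def missProb : ℕ → V → List (List V) → ℝ
  | 0, _, _ => 1
  | n + 1, p, T => if p ∈ T.flatten then
      (∑ z ∈ T.flatten.toFinset.erase p, missProb n p (contract z T)) / T.flatten.toFinset.card
    else 1

/-- The potential of a list of layers with respect to random orders; the first argument is
the number of layers. -/
noncomputable def pot : ℕ → List (List V) → ℝ
  | 0, _ => 0
  | n + 1, T => ((T.flatten.toFinset.card - layerRank T : ℝ) +
      ∑ z ∈ T.flatten.toFinset, pot n (contract z T)) / T.flatten.toFinset.card

theorem layerRank_le_length (T : List (List V)) : layerRank T ≤ T.length := by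
  cases T <;> simp [layerRank]

theorem layerRank_le_card {T : List (List V)} (hT : T.flatten.Nodup) :
    layerRank T ≤ T.flatten.toFinset.card := by
  rw [List.toFinset_card_of_nodup hT]
  clear hT
  induction T with
  | nil => simp [layerRank]
  | cons A T ih =>
    rw [layerRank, List.flatten_cons, List.length_append]
    omega

theorem layerRank_contract {z : V} {T : List (List V)} (hT : T.flatten.Nodup)
    (hz : z ∈ T.flatten) : layerRank (contract z T) + 1 = layerRank T := by
  induction T with
  | nil => simp at hz
  | cons A T ih =>
    have hT' := hT
    rw [List.flatten_cons, List.nodup_append] at hT'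
    rw [contract]
    split_ifs with hA
    · have h1 : (A.filter (· ≠ z)).length + 1 = A.length := by
        have := List.length_erase_add_one hA
        rw [hT'.1.erase_eq_filter] at this
        rwa [List.filter_congr fun x _ => (by rw [bne, beq_eq_decide]; simp : decide (x ≠ z) = (x != z))]
      cases T with
      | nil =>
        simp only [pushLayer, layerRank, List.length_nil]
        omega
      | cons B T =>
        simp only [pushLayer, layerRank, List.length_cons, List.length_append]
        omega
    · have hz' : z ∈ T.flatten := by simpa [hA] using hz
      have h1 := ih hT'.2.1 hz'
      have h2 := length_contract hz'
      rw [layerRank, layerRank]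
      omega

/-- Truncation takes away one unit of capacity, which matters only if the rank exhausts the
capacity. -/
theorem layerRank_le_truncLayers (T : List (List V)) :
    layerRank T ≤ layerRank (truncLayers T) + if layerRank T = T.length then 1 else 0 := by
  match T with
  | [] => simp [layerRank]
  | [A] =>
    simp only [truncLayers, pushLayer, layerRank, List.length_nil, List.length_singleton, min_def]
    split_ifs <;> omega
  | A :: B :: T =>
    simp only [truncLayers, pushLayer, layerRank, List.length_append, List.length_cons, min_def]
    split_ifs <;> omega

/-- This form of the recursion also holds without pages, where the rank vanishes as well; it avoids
the division. -/
theorem card_mul_pot (n : ℕ) {T : List (List V)} (hT : T.flatten.Nodup) :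
    T.flatten.toFinset.card * pot (n + 1) T = (T.flatten.toFinset.card - layerRank T : ℝ) +
      ∑ z ∈ T.flatten.toFinset, pot n (contract z T) := by
  rw [pot]
  by_cases h : T.flatten.toFinset.card = 0
  · have h1 : layerRank T = 0 := by
      have h2 : T.flatten = [] := List.toFinset_eq_empty_iff _ |>.1 (Finset.card_eq_zero.1 h)
      have h3 := layerRank_le_card hT
      omega
    rw [Finset.card_eq_zero.1 h]
    simp [h1]
  · field_simp

theorem card_pos_of_mem {p : V} {T : List (List V)} (hp : p ∈ T.flatten) :
    (0 : ℝ) < T.flatten.toFinset.card := by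
  exact_mod_cast Finset.card_pos.2 ⟨p, List.mem_toFinset.2 hp⟩

theorem missProb_of_notMem {n : ℕ} {p : V} {T : List (List V)} (hp : p ∉ T.flatten) :
    missProb n p T = 1 := by
  cases n with
  | zero => rfl
  | succ n => rw [missProb, if_neg hp]

theorem card_mul_missProb {n : ℕ} {p : V} {T : List (List V)} (hp : p ∈ T.flatten) :
    T.flatten.toFinset.card * missProb (n + 1) p T =
      ∑ z ∈ T.flatten.toFinset.erase p, missProb n p (contract z T) := by
  rw [missProb, if_pos hp]
  have := (card_pos_of_mem hp).ne'
  field_simp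

/-- The pages of a contraction are those that do not exclude the page that has been chosen. -/
theorem toFinset_contract {p : V} {T : List (List V)} (hT : T.flatten.Nodup)
    (hp : p ∈ T.flatten) : (contract p T).flatten.toFinset =
      (T.flatten.toFinset.erase p).filter fun z => p ∈ (contract z T).flatten := by
  ext z
  simp only [List.mem_toFinset, Finset.mem_filter, Finset.mem_erase]
  constructor
  · intro h
    refine ⟨⟨?_, (flatten_contract_sublist p T).subset h⟩, mem_contract_comm hT hp h⟩
    rintro rfl
    exact notMem_contract hT h
  · rintro ⟨⟨_, hz⟩, h⟩
    exact mem_contract_comm hT hz h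

/-- Averaged over `p`, this is the definition of `pot`, because a basis leaves out `card -
layerRank` pages; the point is that it holds for every single `p`. The pages `z ≠ p` that may come
first in the order are split: if `z` and `p` are jointly independent, the induction hypothesis
applies to `contract z T` and the contractions commute; if not, `z` and `p` are parallel, so `p` is
missed and both have the same contraction. -/
theorem missProb_add_pot {n : ℕ} {p : V} {T : List (List V)} (hT : T.flatten.Nodup)
    (hn : T.length = n + 1) (hp : p ∈ T.flatten) :
    missProb (n + 1) p T + pot n (contract p T) = pot (n + 1) T := by
  induction n generalizing T with
  | zero =>
    obtain ⟨A, rfl⟩ := List.length_eq_one_iff.1 hn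
    have hpos := card_pos_of_mem hp
    have h1 := card_mul_missProb (n := 0) hp
    have h2 := card_mul_pot 0 hT
    have h3 : layerRank [A] = 1 := by
      have := List.length_pos_of_mem (show p ∈ A by simpa using hp)
      simp only [layerRank, List.length_nil]
      omega
    simp only [missProb, pot, Finset.sum_const, nsmul_eq_mul, mul_one,
      Finset.card_erase_of_mem (List.mem_toFinset.2 hp), h3] at h1 h2 ⊢
    rw [Nat.cast_sub (by exact_mod_cast hpos)] at h1 ⊢
    simp only [hp, if_true, add_zero] at h1 h2 ⊢
    refine mul_left_cancel₀ hpos.ne' ?_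
    rw [h1, h2, mul_zero, add_zero]
  | succ n ih =>
    have hpos := card_pos_of_mem hp
    set F := T.flatten.toFinset with hF
    have hpF : p ∈ F := List.mem_toFinset.2 hp
    have hlen := length_contract hp
    have h1 := card_mul_missProb (n := n + 1) hp
    have h2 := card_mul_pot (n + 1) hT
    have h3 := card_mul_pot n (nodup_contract (z := p) hT)
    have hrk := layerRank_contract hT hp
    rw [← hF] at h1 h2
    rw [toFinset_contract hT hp, ← hF] at h3
    rw [← Finset.add_sum_erase _ _ hpF, ← Finset.sum_filter_add_sum_filter_not (F.erase p)
      fun z => p ∈ (contract z T).flatten] at h2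
    rw [← Finset.sum_filter_add_sum_filter_not (F.erase p)
      fun z => p ∈ (contract z T).flatten] at h1
    have hcard := Finset.card_filter_add_card_filter_not (s := F.erase p)
      fun z => p ∈ (contract z T).flatten
    rw [Finset.card_erase_of_mem hpF] at hcard
    have hcard' := congrArg (Nat.cast (R := ℝ)) hcard
    rw [Nat.cast_sub (Finset.card_pos.2 ⟨p, hpF⟩)] at hcard'
    push_cast at hcard'
    set F₁ := (F.erase p).filter fun z => p ∈ (contract z T).flatten with hF₁
    set F₂ := (F.erase p).filter fun z => ¬ p ∈ (contract z T).flatten with hF₂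
    have e1 : ∑ z ∈ F₁, missProb (n + 1) p (contract z T) =
        ∑ z ∈ F₁, (pot (n + 1) (contract z T) - pot n (contract z (contract p T))) := by
      refine Finset.sum_congr rfl fun z hz => ?_
      simp only [hF₁, Finset.mem_filter, Finset.mem_erase, hF, List.mem_toFinset] at hz
      have hl := length_contract hz.1.2
      rw [← ih (nodup_contract hT) (by omega) hz.2,
        ← contract_comm hT (mem_contract_comm hT hz.1.2 hz.2) hz.2]
      ring
    have e2 : ∑ z ∈ F₂, missProb (n + 1) p (contract z T) = F₂.card := by
      rw [Finset.sum_congr rfl fun z hz => ?_, Finset.sum_const, nsmul_eq_mul, mul_one]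
      simp only [hF₂, Finset.mem_filter] at hz
      exact missProb_of_notMem hz.2
    have e3 : ∑ z ∈ F₂, pot (n + 1) (contract z T) = F₂.card * pot (n + 1) (contract p T) := by
      rw [Finset.sum_congr rfl fun z hz => ?_, Finset.sum_const, nsmul_eq_mul]
      simp only [hF₂, Finset.mem_filter, Finset.mem_erase, hF, List.mem_toFinset] at hz
      rw [contract_eq_contract hz.1.2 hp (Ne.symm hz.1.1) hz.2]
    rw [e1, e2, Finset.sum_sub_distrib] at h1
    rw [e3] at h2
    have hrk' := congrArg (Nat.cast (R := ℝ)) hrk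
    push_cast at hrk'
    refine mul_left_cancel₀ hpos.ne' ?_
    rw [mul_add, h1, h2]
    linear_combination h3 + (1 - pot (n + 1) (contract p T)) * hcard' - hrk'

theorem pot_of_flatten_eq_nil {n : ℕ} {T : List (List V)} (h : T.flatten = []) : pot n T = 0 := by
  cases n with
  | zero => rfl
  | succ n => simp [pot, h]

theorem pot_nonneg {n : ℕ} {T : List (List V)} (hT : T.flatten.Nodup) : 0 ≤ pot n T := by
  induction n generalizing T with
  | zero => exact le_rfl
  | succ n ih =>
    rw [pot]
    have : (layerRank T : ℝ) ≤ T.flatten.toFinset.card := by exact_mod_cast layerRank_le_card hT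
    have := Finset.sum_nonneg fun z (_ : z ∈ T.flatten.toFinset) => ih (nodup_contract (z := z) hT)
    exact div_nonneg (by linarith) (Nat.cast_nonneg _)

/-- Each level of the recursion for `pot` loses at most `1 / m`, with `m` the number of layers:
truncation lowers the rank by at most one, and only if the rank is `m`; then there are at least `m`
pages over which the loss is averaged. These terms sum up to the harmonic number. -/
theorem pot_truncLayers_le {n : ℕ} {T : List (List V)} (hT : T.flatten.Nodup)
    (hn : T.length = n + 1) :
    pot n (truncLayers T) + 1 ≤ pot (n + 1) T + ((harmonic (n + 1) : ℚ) : ℝ) := by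
  induction n generalizing T with
  | zero => simpa [pot] using pot_nonneg (n := 1) hT
  | succ n ih =>
    have hmem : ∀ z, z ∈ (truncLayers T).flatten ↔ z ∈ T.flatten := fun z =>
      ⟨fun h => (flatten_truncLayers_sublist T).subset h, fun h => mem_truncLayers h (by omega)⟩
    by_cases h0 : T.flatten = []
    · have h1 : (truncLayers T).flatten = [] := by
        rw [List.eq_nil_iff_forall_not_mem]
        intro z
        rw [hmem, h0]
        simp
      rw [pot_of_flatten_eq_nil h0, pot_of_flatten_eq_nil h1, harmonic_succ]
      have : (0 : ℝ) ≤ ((harmonic (n + 1) : ℚ) : ℝ) - 1 := by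
        -- The inequality `1 ≤ harmonic (n + 1)` is read off from the induction hypothesis for empty
        -- layers.
        have h2 := ih (T := List.replicate (n + 1) []) (by simp) (by simp)
        rw [pot_of_flatten_eq_nil (T := List.replicate (n + 1) []) (by simp)] at h2
        have h3 : (0 : ℝ) ≤ pot n (truncLayers (List.replicate (n + 1) ([] : List V))) :=
          pot_nonneg (List.Nodup.sublist (flatten_truncLayers_sublist _) (by simp))
        linarith
      have h4 : (0 : ℝ) ≤ (((n + 1 + 1 : ℕ) : ℚ)⁻¹ : ℚ) := by positivity
      push_cast at h4 ⊢
      linarith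
    · obtain ⟨p, hp⟩ := List.exists_mem_of_ne_nil _ h0
      have hpos := card_pos_of_mem hp
      have hF : (truncLayers T).flatten.toFinset = T.flatten.toFinset := by
        ext z
        simp [hmem]
      have h1 := card_mul_pot n (hT.sublist (flatten_truncLayers_sublist T))
      have h2 := card_mul_pot (n + 1) hT
      rw [hF] at h1
      have h3 : ∑ z ∈ T.flatten.toFinset, (pot n (contract z (truncLayers T)) + 1) ≤
          ∑ z ∈ T.flatten.toFinset,
            (pot (n + 1) (contract z T) + ((harmonic (n + 1) : ℚ) : ℝ)) := by
        refine Finset.sum_le_sum fun z hz => ?_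
        rw [List.mem_toFinset] at hz
        have hl := length_contract hz
        rw [contract_truncLayers hT ((hmem z).2 hz)]
        exact ih (nodup_contract hT) (by omega)
      simp only [Finset.sum_add_distrib, Finset.sum_const, nsmul_eq_mul, mul_one] at h3
      have h4 : (layerRank T : ℝ) ≤ layerRank (truncLayers T) +
          T.flatten.toFinset.card * ((n + 1 + 1 : ℕ) : ℝ)⁻¹ := by
        have h5 := layerRank_le_truncLayers T
        split_ifs at h5 with h6
        · have h7 := layerRank_le_card hT
          have h8 : (1 : ℝ) ≤ T.flatten.toFinset.card * ((n + 1 + 1 : ℕ) : ℝ)⁻¹ := by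
            rw [← div_eq_mul_inv, le_div_iff₀ (by positivity), one_mul]
            exact_mod_cast hn ▸ h6 ▸ h7
          have h9 : (layerRank T : ℝ) ≤ layerRank (truncLayers T) + 1 := by exact_mod_cast h5
          linarith
        · have h7 : (0 : ℝ) ≤ T.flatten.toFinset.card * ((n + 1 + 1 : ℕ) : ℝ)⁻¹ := by positivity
          have h9 : (layerRank T : ℝ) ≤ layerRank (truncLayers T) := by exact_mod_cast h5
          linarith
      refine le_of_mul_le_mul_left ?_ hpos
      rw [harmonic_succ (n + 1), mul_add, mul_add, h1, h2]
      push_cast at h3 h4 ⊢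
      rw [mul_add]
      linarith

/-- The page `v` is a coloop, hence never missed, and does not contribute to the potential. -/
theorem pot_singleton {n : ℕ} {v : V} {U : List (List V)} (hU : U.flatten.Nodup)
    (hn : U.length = n) (hv : v ∉ U.flatten) : pot (n + 1) ([v] :: U) = pot n U := by
  induction n generalizing U with
  | zero =>
    obtain rfl := List.length_eq_zero_iff.1 hn
    simp [pot, layerRank]
  | succ n ih =>
    have hF : ([v] :: U).flatten.toFinset = insert v U.flatten.toFinset := by simp
    have hvF : v ∉ U.flatten.toFinset := by simpa using hv
    have h1 := card_mul_pot (T := [v] :: U) (n + 1) (List.nodup_cons.2 ⟨hv, hU⟩)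
    have h2 := card_mul_pot n hU
    have hrk : layerRank ([v] :: U) = layerRank U + 1 := by
      have := layerRank_le_length U
      simp only [layerRank, List.length_singleton]
      omega
    rw [hF, Finset.sum_insert hvF, Finset.card_insert_of_notMem hvF, hrk] at h1
    have h3 : ∑ z ∈ U.flatten.toFinset, pot (n + 1) (contract z ([v] :: U)) =
        ∑ z ∈ U.flatten.toFinset, pot n (contract z U) := by
      refine Finset.sum_congr rfl fun z hz => ?_
      have hzv : z ≠ v := by
        rintro rfl
        exact hvF hz
      rw [List.mem_toFinset] at hz
      have hl := length_contract hz
      rw [contract, if_neg (by simpa using hzv)]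
      exact ih (nodup_contract hU) (by omega)
        fun h => hv ((flatten_contract_sublist z U).subset h)
    have h4 : contract v ([v] :: U) = U := by
      rw [contract, if_pos (by simp)]
      simp [pushLayer_nil]
    rw [h3, h4] at h1
    push_cast at h1
    have hpos : (0 : ℝ) < (U.flatten.toFinset.card : ℝ) + 1 := by positivity
    refine mul_left_cancel₀ hpos.ne' ?_
    linear_combination h1 - h2

/-- The amortized cost of a request. The potential pays exactly for a request to a page of the
layers; a new page is a certain miss, and the truncation makes it cost a harmonic number. -/
theorem missProb_add_pot_reqLayers_le {n : ℕ} {v : V} {T : List (List V)} (hT : T.flatten.Nodup)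
    (hn : T.length = n + 1) :
    missProb (n + 1) v T + pot (n + 1) (reqLayers v T) ≤ pot (n + 1) T +
      ((harmonic (n + 1) : ℚ) : ℝ) * if v ∈ T.flatten then 0 else 1 := by
  have h1 := notMem_reqLayers_tail (v := v) hT
  have h2 := nodup_reqLayers_tail (v := v) hT
  rw [reqLayers, pot_singleton h2 ?_ h1]
  · split_ifs with h
    · rw [missProb_add_pot hT hn h]
      simp
    · rw [missProb_of_notMem h]
      have := pot_truncLayers_le hT hn
      linarith
  · split_ifs with h
    · have := length_contract h
      omega
    · rw [length_truncLayers]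
      omega

/-! ### Random insertion -/

/-- The mean of `f` over the orders that are produced by random insertion. -/
noncomputable def insMean : List V → (List V → ℝ) → ℝ
  | [], f => f []
  | x :: l, f => (∑ i ∈ Finset.range (l.length + 1), insMean l fun O => f (O.insertIdx i x)) /
      (l.length + 1)

theorem insMean_zero (l : List V) : insMean l (fun _ => 0) = 0 := by
  induction l with
  | nil => rfl
  | cons x l ih => simp [insMean, ih]

theorem insMean_const (l : List V) (c : ℝ) : insMean l (fun _ => c) = c := by
  induction l with
  | nil => rfl
  | cons x l ih =>
    simp only [insMean, ih, Finset.sum_const, Finset.card_range, nsmul_eq_mul]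
    push_cast
    have : (l.length : ℝ) + 1 ≠ 0 := by positivity
    field_simp

/-- Each element is equally likely to be the first one. -/
theorem length_mul_insMean {l : List V} (hl : l.Nodup) (hne : l ≠ []) (f : List V → ℝ) :
    l.length * insMean l f = ∑ z ∈ l.toFinset, insMean (l.erase z) fun O => f (z :: O) := by
  induction l generalizing f with
  | nil => exact absurd rfl hne
  | cons x l ih =>
    rw [List.nodup_cons] at hl
    have hx : x ∉ l.toFinset := by simpa using hl.1
    rw [insMean, Finset.sum_range_succ', List.toFinset_cons, Finset.sum_insert hx,
      List.erase_cons_head]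
    have h0 : ((x :: l).length : ℝ) ≠ 0 := by simp only [List.length_cons]; positivity
    have h1 : ((x :: l).length : ℝ) = l.length + 1 := by simp
    rw [h1] at h0 ⊢
    rw [mul_div_cancel₀ _ h0]
    rw [add_comm]
    congr 1
    by_cases hl0 : l = []
    · subst hl0
      simp
    have hlen : (0 : ℝ) < l.length := by exact_mod_cast List.length_pos_iff.2 hl0
    refine mul_left_cancel₀ hlen.ne' ?_
    rw [Finset.mul_sum, Finset.sum_congr rfl fun i _ => ih hl.2 hl0 _, Finset.sum_comm,
      Finset.mul_sum]
    refine Finset.sum_congr rfl fun z hz => ?_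
    have hzl : z ∈ l := List.mem_toFinset.1 hz
    have hxz : x ≠ z := by
      rintro rfl
      exact hx hz
    have h2 := List.length_erase_add_one hzl
    have h3 : ((l.erase z).length : ℝ) + 1 = l.length := by exact_mod_cast h2
    rw [List.erase_cons_tail (by simpa using hxz), insMean, h2, h3, mul_div_cancel₀ _ hlen.ne']
    rfl

/-- Condition on the first element of the order. If it is outside the layers it has no effect, if it
is `v` there is no miss, and any other page of the layers leads to its contraction, which is the
recursion of `missProb`. -/
theorem insMean_notMem_basis {l : List V} (hl : l.Nodup) {n : ℕ} {v : V} {T : List (List V)}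
    (hT : T.flatten.Nodup) (hn : T.length = n) (hTl : T.flatten ⊆ l) :
    insMean l (fun O => if v ∈ basis T O then 0 else 1) = missProb n v T := by
  induction hm : l.length generalizing l n T with
  | zero =>
    obtain rfl := List.length_eq_zero_iff.1 hm
    have : v ∉ T.flatten := fun h => by simpa using hTl h
    rw [missProb_of_notMem this]
    simp [insMean, basis]
  | succ m ih =>
    by_cases hv : v ∈ T.flatten
    swap
    · rw [missProb_of_notMem hv]
      have : ∀ O, v ∉ basis T O := fun O h => hv (basis_subset_flatten _ _ h)
      simp only [this, if_false]
      exact insMean_const l 1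
    have hne : l ≠ [] := by
      rintro rfl
      simp at hm
    have hlen : (0 : ℝ) < l.length := by exact_mod_cast List.length_pos_iff.2 hne
    refine mul_left_cancel₀ hlen.ne' ?_
    rw [length_mul_insMean hl hne]
    obtain ⟨n, rfl⟩ : ∃ n', n = n' + 1 := ⟨n - 1, by have := length_contract hv; omega⟩
    have hsub : T.flatten.toFinset ⊆ l.toFinset := fun z hz =>
      List.mem_toFinset.2 (hTl (List.mem_toFinset.1 hz))
    have hmain := card_mul_missProb (n := n) hv
    rw [← Finset.sum_sdiff hsub]
    have e1 : ∑ z ∈ l.toFinset \ T.flatten.toFinset, insMean (l.erase z)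
        (fun O => if v ∈ basis T (z :: O) then (0 : ℝ) else 1) =
        (l.length - T.flatten.toFinset.card) * missProb (n + 1) v T := by
      rw [Finset.sum_congr rfl fun z hz => ?_, Finset.sum_const, nsmul_eq_mul,
        Finset.card_sdiff_of_subset hsub, Nat.cast_sub (Finset.card_le_card hsub),
        List.toFinset_card_of_nodup hl]
      simp only [Finset.mem_sdiff, List.mem_toFinset] at hz
      have hb : ∀ O, basis T (z :: O) = basis T O := fun O => by rw [basis, if_neg hz.2]
      simp only [hb]
      refine ih (hl.erase z) hT hn (fun x hx => ?_) (by rw [List.length_erase_of_mem hz.1, hm]; rfl)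
      refine (List.mem_erase_of_ne ?_).2 (hTl hx)
      rintro rfl
      exact hz.2 hx
    have e2 : ∑ z ∈ T.flatten.toFinset, insMean (l.erase z)
        (fun O => if v ∈ basis T (z :: O) then (0 : ℝ) else 1) =
        ∑ z ∈ T.flatten.toFinset.erase v, missProb n v (contract z T) := by
      rw [← Finset.add_sum_erase _ _ (List.mem_toFinset.2 hv)]
      have hb : ∀ O, v ∈ basis T (v :: O) := fun O => by
        rw [basis, if_pos hv]
        exact List.mem_cons_self ..
      simp only [hb, if_true, insMean_zero, zero_add]
      refine Finset.sum_congr rfl fun z hz => ?_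
      simp only [Finset.mem_erase, List.mem_toFinset] at hz
      have hb : ∀ O, v ∈ basis T (z :: O) ↔ v ∈ basis (contract z T) O := fun O => by
        rw [basis, if_pos hz.2, List.mem_cons]
        exact or_iff_right (Ne.symm hz.1)
      simp only [hb]
      have hl' := length_contract hz.2
      refine ih (hl.erase z) (nodup_contract hT) (by omega) (fun x hx => ?_)
        (by rw [List.length_erase_of_mem (hTl hz.2), hm]; rfl)
      refine (List.mem_erase_of_ne ?_).2 (hTl ((flatten_contract_sublist z T).subset hx))
      rintro rfl
      exact notMem_contract hT hx
    rw [e1, e2, ← hmain]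
    ring

end RandomOrder

/-! ### Random insertion by means of the tape -/

section RandomTape

open MeasureTheory ProbabilityTheory

instance : IsProbabilityMeasure tapeMeasure := by
  unfold tapeMeasure
  infer_instance

/-- The coordinates of the tape that random insertion into lists shorter than `n` uses. -/
def insCoords (n : ℕ) : Finset (ℕ × ℕ) := (Finset.range n).image fun m => (m, 0)

theorem mem_insCoords {n : ℕ} {q : ℕ × ℕ} : q ∈ insCoords n ↔ q.1 < n ∧ q.2 = 0 := by
  obtain ⟨m, i⟩ := q
  simp only [insCoords, Finset.mem_image, Finset.mem_range, Prod.mk.injEq]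
  constructor
  · rintro ⟨a, h, rfl, rfl⟩
    exact ⟨h, rfl⟩
  · rintro ⟨h, rfl⟩
    exact ⟨m, h, rfl, rfl⟩

/-- A function of finitely many coordinates, each with finitely many values, is measurable and
bounded. -/
theorem integrable_of_dependsOn {f : RandomTape → ℝ} {s : Finset (ℕ × ℕ)}
    (hf : DependsOn f (s : Set (ℕ × ℕ))) : Integrable f tapeMeasure := by
  obtain ⟨g, rfl⟩ := dependsOn_iff_exists_comp.1 hf
  have hm : Measurable (g ∘ (s : Set (ℕ × ℕ)).domRestrict (π := fun q => Fin (q.1 + 1))) :=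
    (measurable_of_finite (α := ∀ q : (s : Set (ℕ × ℕ)), Fin (q.1.1 + 1)) g).comp
      (measurable_pi_lambda _ fun q => measurable_pi_apply (q : ℕ × ℕ))
  obtain ⟨C, hC⟩ := (Set.finite_range g).isBounded.exists_norm_le
  refine Integrable.of_bound hm.aestronglyMeasurable C (Filter.Eventually.of_forall fun ω => ?_)
  exact hC _ ⟨_, rfl⟩

variable {V : Type*}

/-- The order that is produced by random insertion. -/
def randOrd (ω : RandomTape) : List V → List V
  | [] => []
  | x :: l => (randOrd ω l).insertIdx (ω (l.length, 0)) x

theorem dependsOn_randOrd (l : List V) :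
    DependsOn (fun ω => randOrd ω l) (insCoords l.length : Set (ℕ × ℕ)) := by
  induction l with
  | nil => exact fun _ _ _ => rfl
  | cons x l ih =>
    intro ω ω' h
    have h1 := h (l.length, 0) (by simp [mem_insCoords])
    have h2 : randOrd ω l = randOrd ω' l := ih fun q hq => h q (by
      have := mem_insCoords.1 (Finset.mem_coe.1 hq)
      exact Finset.mem_coe.2 (mem_insCoords.2 ⟨by simpa using this.1.trans (Nat.lt_succ_self _), this.2⟩))
    simp only [randOrd, h1, h2]

theorem length_randOrd (ω : RandomTape) (l : List V) : (randOrd ω l).length = l.length := by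
  induction l with
  | nil => rfl
  | cons x l ih =>
    rw [randOrd, List.length_insertIdx, ih, if_pos, List.length_cons]
    exact Nat.le_of_lt_succ (ω (l.length, 0)).2

/-- The coordinate `(n, 0)` is uniform on `n + 1` values and independent of the coordinates in
`insCoords n`, whose first components are smaller. -/
theorem integral_mul_of_dependsOn {n : ℕ} {f : RandomTape → ℝ}
    (hf : DependsOn f (insCoords n : Set (ℕ × ℕ))) (i : Fin (n + 1)) :
    ∫ ω, (if ω (n, 0) = i then f ω else 0) ∂tapeMeasure = (∫ ω, f ω ∂tapeMeasure) / (n + 1) := by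
  have hind : iIndepFun (fun (q : ℕ × ℕ) (ω : RandomTape) => ω q) tapeMeasure :=
    iIndepFun_infinitePi (X := fun _ x => x) fun _ => measurable_id
  have hind' := hind.indepFun_finset {(n, 0)} (insCoords n)
    (by simp [mem_insCoords]) (fun q => measurable_pi_apply q)
  obtain ⟨g, rfl⟩ := dependsOn_iff_exists_comp.1 hf
  let φ : (∀ q : ({(n, 0)} : Finset (ℕ × ℕ)), Fin (q.1.1 + 1)) → ℝ :=
    fun x => if x ⟨(n, 0), by simp⟩ = i then 1 else 0
  have h1 := hind'.comp (φ := φ) (ψ := g) (measurable_of_finite _) (measurable_of_finite _)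
  have h2 := h1.integral_fun_mul_eq_mul_integral
    (integrable_of_dependsOn (s := {(n, 0)}) (fun ω ω' h => by
      have := h (n, 0) (by simp)
      simp [φ, this])).aestronglyMeasurable
    (integrable_of_dependsOn (s := insCoords n) hf).aestronglyMeasurable
  have h3 : ∀ ω : RandomTape, (if ω (n, 0) = i then
      (g ∘ (insCoords n : Set (ℕ × ℕ)).domRestrict) ω else 0) =
      (φ ∘ fun a (i : ({(n, 0)} : Finset (ℕ × ℕ))) => a i) ω *
        (g ∘ fun a (i : insCoords n) => a i) ω := by
    intro ω
    simp only [φ, Function.comp_apply, ite_mul, one_mul, zero_mul]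
    rfl
  have h4 : ∫ ω : RandomTape, (φ ∘ fun a (i : ({(n, 0)} : Finset (ℕ × ℕ))) => a i) ω ∂tapeMeasure =
      1 / (n + 1) := by
    have h5 : (tapeMeasure.map fun ω : RandomTape => ω (n, 0)) =
        (PMF.uniformOfFintype (Fin (n + 1))).toMeasure := Measure.infinitePi_map_eval _ (n, 0)
    have h6 := integral_map (μ := tapeMeasure) (φ := fun ω : RandomTape => ω (n, 0))
      (measurable_pi_apply _).aemeasurable (f := fun x : Fin (n + 1) => if x = i then (1 : ℝ) else 0)
      (measurable_of_finite _).aestronglyMeasurable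
    rw [h5, PMF.integral_eq_sum] at h6
    simp only [PMF.uniformOfFintype_apply, Fintype.card_fin, smul_eq_mul, mul_ite, mul_one,
      mul_zero, Finset.sum_ite_eq', Finset.mem_univ, if_true] at h6
    rw [ENNReal.toReal_inv, ENNReal.toReal_natCast] at h6
    push_cast at h6
    rw [one_div, h6]
    rfl
  rw [integral_congr_ae (Filter.Eventually.of_forall h3), h2, h4]
  rw [div_mul_eq_mul_div, one_mul]
  rfl

/-- Row `m` of the tape is used only for the insertion into a list of length `m`, so the position is
uniform and independent of the order built so far, as in the recursion of `insMean`. -/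
theorem integral_randOrd (l : List V) (f : List V → ℝ) :
    ∫ ω, f (randOrd ω l) ∂tapeMeasure = insMean l f := by
  induction l generalizing f with
  | nil => simp [randOrd, insMean]
  | cons x l ih =>
    have hd : ∀ i : ℕ, DependsOn (fun ω => f ((randOrd ω l).insertIdx i x))
        (insCoords l.length : Set (ℕ × ℕ)) := fun i ω ω' h => by
      have := dependsOn_randOrd l h
      simp only at this
      simp only [this]
    have h1 : ∀ ω : RandomTape, f (randOrd ω (x :: l)) = ∑ i : Fin (l.length + 1),
        if ω (l.length, 0) = i then f ((randOrd ω l).insertIdx i x) else 0 := by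
      intro ω
      simp [randOrd]
    have h2 : ∀ i : Fin (l.length + 1), Integrable (fun ω : RandomTape =>
        if ω (l.length, 0) = i then f ((randOrd ω l).insertIdx i x) else 0) tapeMeasure := by
      intro i
      refine integrable_of_dependsOn (s := insCoords (l.length + 1)) fun ω ω' h => ?_
      have h3 := h (l.length, 0) (by simp [mem_insCoords])
      have h4 := hd i (x := ω) (y := ω') fun q hq => h q (by
        have := mem_insCoords.1 (Finset.mem_coe.1 hq)
        exact Finset.mem_coe.2 (mem_insCoords.2 ⟨this.1.trans (Nat.lt_succ_self _), this.2⟩))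
      simp only at h4
      simp only [h3, h4]
    simp only [h1]
    rw [integral_finsetSum _ fun i _ => h2 i, insMean, Finset.sum_range, Finset.sum_div]
    refine Finset.sum_congr rfl fun i _ => ?_
    rw [integral_mul_of_dependsOn (hd i), ih fun O => f (O.insertIdx i x)]

end RandomTape

/-! ### Representatives: from slots that hold a page to tokens of that page -/

section Representatives

variable {k : ℕ} {F : List (Finset (Fin k))} {S : Finset (Fin k)}

/-- Functions that choose a nonempty subset of every member of a family, where the sets with the
same choice are convex with respect to inclusion. -/
structure IsRep (F : List (Finset (Fin k))) (r : Finset (Fin k) → Finset (Fin k)) : Prop where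
  subset : ∀ R ∈ F, r R ⊆ R
  nonempty : ∀ R ∈ F, (r R).Nonempty
  convex : ∀ Q ∈ F, ∀ R ∈ F, ∀ Q' ∈ F, Q ⊆ R → R ⊆ Q' → r Q = r Q' → r R = r Q

theorem isRep_id (hF : ∀ R ∈ F, R.Nonempty) : IsRep F fun R => R :=
  ⟨fun R _ => Finset.Subset.refl R, hF, fun _ _ _ _ _ _ h h' e =>
    Finset.Subset.antisymm (e ▸ h') h⟩

theorem IsRep.nested {r : Finset (Fin k) → Finset (Fin k)} (hr : IsRep F r) (hF : IsLaminar F)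
    {Q R : Finset (Fin k)} (hQ : Q ∈ F) (hR : R ∈ F) (h : r Q = r R) : Q ⊆ R ∨ R ⊆ Q := by
  rcases hF Q hQ R hR with hd | hd
  · obtain ⟨x, hx⟩ := hr.nonempty Q hQ
    exact absurd (hr.subset R hR (h ▸ hx)) (Finset.disjoint_left.1 hd (hr.subset Q hQ hx))
  · exact hd

/-- The choice of the supersets of `R` is changed to that of `R`. -/
def repStep (r : Finset (Fin k) → Finset (Fin k)) (R : Finset (Fin k)) :
    Finset (Fin k) → Finset (Fin k) := fun Q => if R ⊆ Q then r R else r Q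

/-- Convexity is in doubt only if the upper set contains `R` and the lower one does not. Then the
lower one has the choice of `R`, and a set in between either contains `R` or lies between the lower
one and `R`. -/
theorem IsRep.repStep {r : Finset (Fin k) → Finset (Fin k)} (hr : IsRep F r) (hF : IsLaminar F)
    {R : Finset (Fin k)} (hR : R ∈ F) : IsRep F (repStep r R) := by
  refine ⟨fun Q hQ => ?_, fun Q hQ => ?_, fun Q hQ Q₁ hQ₁ Q₂ hQ₂ h h' e => ?_⟩
  · rw [SlotPaging.repStep]
    split_ifs with h
    · exact (hr.subset R hR).trans h
    · exact hr.subset Q hQ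
  · rw [SlotPaging.repStep]
    split_ifs with h
    · exact hr.nonempty R hR
    · exact hr.nonempty Q hQ
  · simp only [SlotPaging.repStep] at e ⊢
    by_cases h0 : R ⊆ Q
    · rw [if_pos h0, if_pos (h0.trans h)]
    rw [if_neg h0] at e ⊢
    by_cases h2 : R ⊆ Q₂
    · rw [if_pos h2] at e
      split_ifs with h1
      · exact e.symm
      · rcases hF Q₁ hQ₁ R hR with hd | hd | hd
        · obtain ⟨x, hx⟩ := hr.nonempty Q hQ
          exact absurd (hr.subset R hR (e ▸ hx))
            (Finset.disjoint_left.1 hd (h (hr.subset Q hQ hx)))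
        · exact hr.convex Q hQ Q₁ hQ₁ R hR h hd e
        · exact absurd hd h1
    · rw [if_neg h2] at e
      rw [if_neg fun h1 => h2 (h1.trans h')]
      exact hr.convex Q hQ Q₁ hQ₁ Q₂ hQ₂ h h' e

/-- The subsets of `Y` in the family that meet `X`. -/
def liveSets (F : List (Finset (Fin k))) (X Y : Finset (Fin k)) : Finset (Finset (Fin k)) :=
  F.toFinset.filter fun R => R ⊆ Y ∧ (R ∩ X).Nonempty

/-- The choices of these sets. -/
def liveReps (F : List (Finset (Fin k))) (r : Finset (Fin k) → Finset (Fin k))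
    (X Y : Finset (Fin k)) : Finset (Finset (Fin k)) := (liveSets F X Y).image r

theorem mem_liveSets {X Y R : Finset (Fin k)} :
    R ∈ liveSets F X Y ↔ R ∈ F ∧ R ⊆ Y ∧ (R ∩ X).Nonempty := by
  simp [liveSets]

theorem mem_liveReps {r : Finset (Fin k) → Finset (Fin k)} {X Y e : Finset (Fin k)} :
    e ∈ liveReps F r X Y ↔ ∃ R ∈ F, R ⊆ Y ∧ (R ∩ X).Nonempty ∧ r R = e := by
  simp only [liveReps, Finset.mem_image, mem_liveSets]
  constructor
  · rintro ⟨R, ⟨h1, h2, h3⟩, h4⟩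
    exact ⟨R, h1, h2, h3, h4⟩
  · rintro ⟨R, h1, h2, h3, h4⟩
    exact ⟨R, ⟨h1, h2, h3⟩, h4⟩

theorem liveReps_mono {r : Finset (Fin k) → Finset (Fin k)} {X X' Y Y' : Finset (Fin k)}
    (hX : X ⊆ X') (hY : Y ⊆ Y') : liveReps F r X Y ⊆ liveReps F r X' Y' := by
  intro e he
  obtain ⟨R, h1, h2, h3, h4⟩ := mem_liveReps.1 he
  exact mem_liveReps.2 ⟨R, h1, h2.trans hY, h3.mono (Finset.inter_subset_inter_left hX), h4⟩

/-- `X` is the set of slots that hold a page, and `D` the set of choices that represents it. -/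
def RepInv (F : List (Finset (Fin k))) (S : Finset (Fin k)) (r : Finset (Fin k) → Finset (Fin k))
    (X : Finset (Fin k)) (D : Finset (Finset (Fin k))) : Prop :=
  D ⊆ liveReps F r X S ∧ ∀ R ∈ F, R ⊆ S → (R ∩ X).Nonempty →
    (D ∩ liveReps F r X R).card + (if r R ∈ D then 0 else 1) ≤ (X ∩ R).card

/-- The potential of `X` and `D`. -/
def repPot (F : List (Finset (Fin k))) (S : Finset (Fin k)) (r : Finset (Fin k) → Finset (Fin k))
    (X : Finset (Fin k)) (D : Finset (Finset (Fin k))) : ℕ :=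
  (liveReps F r X S \ D).card + (X.card - 1)

theorem repInv_empty (r : Finset (Fin k) → Finset (Fin k)) : RepInv F S r ∅ ∅ :=
  ⟨Finset.empty_subset _, fun R _ _ h => by simp at h⟩

theorem repPot_empty (r : Finset (Fin k) → Finset (Fin k)) : repPot F S r ∅ ∅ = 0 := by
  have : liveReps F r ∅ S = ∅ := by
    ext e
    simp [mem_liveReps]
  simp [repPot, this]

/-- The maximal live subsets of `Y` are disjoint, and every choice counted on the left is made
within one of them; the condition of `RepInv` is summed over these sets. -/
theorem RepInv.card_inter_le {r : Finset (Fin k) → Finset (Fin k)} {X : Finset (Fin k)}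
    {D : Finset (Finset (Fin k))} (h : RepInv F S r X D) (hF : IsLaminar F) {Y : Finset (Fin k)}
    (hY : Y ⊆ S) : (D ∩ liveReps F r X Y).card ≤ (X ∩ Y).card := by
  classical
  let M := (liveSets F X Y).filter fun Q => Maximal (· ∈ liveSets F X Y) Q
  have hM : ∀ Q ∈ M, Q ∈ F ∧ Q ⊆ Y ∧ (Q ∩ X).Nonempty := fun Q hQ =>
    mem_liveSets.1 (Finset.mem_filter.1 hQ).1
  have h1 : D ∩ liveReps F r X Y ⊆ M.biUnion fun Q => D ∩ liveReps F r X Q := by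
    intro e he
    obtain ⟨heD, he⟩ := Finset.mem_inter.1 he
    obtain ⟨R, hR, hRY, hRX, rfl⟩ := mem_liveReps.1 he
    obtain ⟨Q, hRQ, hQ⟩ := Finset.exists_le_maximal _ (mem_liveSets.2 ⟨hR, hRY, hRX⟩)
    exact Finset.mem_biUnion.2 ⟨Q, Finset.mem_filter.2 ⟨hQ.1, hQ⟩,
      Finset.mem_inter.2 ⟨heD, mem_liveReps.2 ⟨R, hR, hRQ, hRX, rfl⟩⟩⟩
  have h2 : (M.biUnion fun Q => X ∩ Q).card = ∑ Q ∈ M, (X ∩ Q).card := by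
    refine Finset.card_biUnion fun Q hQ Q' hQ' hne => ?_
    refine Finset.disjoint_of_subset_left Finset.inter_subset_right
      (Finset.disjoint_of_subset_right Finset.inter_subset_right ?_)
    have m1 := (Finset.mem_filter.1 hQ).2
    have m2 := (Finset.mem_filter.1 hQ').2
    rcases hF Q (hM Q hQ).1 Q' (hM Q' hQ').1 with hd | hd | hd
    · exact hd
    · exact absurd (Finset.Subset.antisymm hd (m1.2 m2.1 hd)) hne
    · exact absurd (Finset.Subset.antisymm (m2.2 m1.1 hd) hd) hne
  calc (D ∩ liveReps F r X Y).card ≤ ∑ Q ∈ M, (D ∩ liveReps F r X Q).card :=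
        (Finset.card_le_card h1).trans Finset.card_biUnion_le
    _ ≤ ∑ Q ∈ M, (X ∩ Q).card := by
        refine Finset.sum_le_sum fun Q hQ => ?_
        obtain ⟨q1, q2, q3⟩ := hM Q hQ
        exact (Nat.le_add_right _ _).trans (h.2 Q q1 (q2.trans hY) q3)
    _ = (M.biUnion fun Q => X ∩ Q).card := h2.symm
    _ ≤ (X ∩ Y).card := Finset.card_le_card <| Finset.biUnion_subset.2 fun Q hQ =>
        Finset.inter_subset_inter_left (hM Q hQ).2.1

theorem RepInv.card_le {r : Finset (Fin k) → Finset (Fin k)} {X : Finset (Fin k)}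
    {D : Finset (Finset (Fin k))} (h : RepInv F S r X D) (hF : IsLaminar F) :
    D.card ≤ X.card := by
  have := h.card_inter_le hF (Finset.Subset.refl S)
  rw [Finset.inter_eq_left.2 h.1] at this
  exact this.trans (Finset.card_le_card Finset.inter_subset_left)

/-! ### Removal of a slot -/

/-- Apart from choices that are no longer live, at most one choice `e` has to be given up. The sets
at which the condition fails contain `s`, so they form a chain. Take `e` within the smallest of them
but different from its choice: by convexity `e` is the choice of none of them, and dropping `e`
repairs them all. The term `X.card - 1` of the potential pays for `e`. -/
theorem RepInv.eraseSlot {r : Finset (Fin k) → Finset (Fin k)} {X : Finset (Fin k)}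
    {D : Finset (Finset (Fin k))} (h : RepInv F S r X D) (hF : IsLaminar F) (hr : IsRep F r)
    {s : Fin k} (hs : s ∈ X) :
    ∃ D' ⊆ D, RepInv F S r (X.erase s) D' ∧ repPot F S r (X.erase s) D' ≤ repPot F S r X D := by
  classical
  set X' := X.erase s with hX'
  have hXX : X' ⊆ X := Finset.erase_subset s X
  set D₀ := D ∩ liveReps F r X' S with hD₀
  have hD₀D : D₀ ⊆ D := Finset.inter_subset_left
  have hlive : ∀ R, (R ∩ X').Nonempty → (R ∩ X).Nonempty := fun R h =>
    h.mono (Finset.inter_subset_inter_left hXX)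
  have hmem : ∀ R ∈ F, R ⊆ S → (R ∩ X').Nonempty → (r R ∈ D₀ ↔ r R ∈ D) := fun R h1 h2 h3 =>
    ⟨fun h => hD₀D h, fun h => Finset.mem_inter.2 ⟨h, mem_liveReps.2 ⟨R, h1, h2, h3, rfl⟩⟩⟩
  have hcard : ∀ R, (X' ∩ R).card + (if s ∈ R then 1 else 0) = (X ∩ R).card := by
    intro R
    split_ifs with hR
    · rw [hX', Finset.erase_inter]
      exact Finset.card_erase_add_one (Finset.mem_inter.2 ⟨hs, hR⟩)
    · rw [hX', Finset.erase_inter, Finset.erase_eq_of_notMem (by simp [hR]), add_zero]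
  have hle : ∀ R ∈ F, R ⊆ S → (R ∩ X').Nonempty →
      (D₀ ∩ liveReps F r X' R).card + (if r R ∈ D₀ then 0 else 1) ≤ (X ∩ R).card := by
    intro R h1 h2 h3
    refine le_trans (Nat.add_le_add (Finset.card_le_card ?_) (le_of_eq ?_)) (h.2 R h1 h2 (hlive R h3))
    · exact Finset.inter_subset_inter hD₀D (liveReps_mono hXX (Finset.Subset.refl R))
    · simp only [hmem R h1 h2 h3]
  have hsdiff : (liveReps F r X' S \ D₀).card ≤ (liveReps F r X S \ D).card := by
    refine Finset.card_le_card fun e he => ?_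
    rw [Finset.mem_sdiff] at he ⊢
    exact ⟨liveReps_mono hXX (Finset.Subset.refl S) he.1, fun h' =>
      he.2 (Finset.mem_inter.2 ⟨h', he.1⟩)⟩
  have hXc : X'.card + 1 = X.card := Finset.card_erase_add_one hs
  let bad := (liveSets F X' S).filter fun Q =>
    (X' ∩ Q).card < (D₀ ∩ liveReps F r X' Q).card + (if r Q ∈ D₀ then 0 else 1)
  rcases bad.eq_empty_or_nonempty with hbad | hbad
  · refine ⟨D₀, hD₀D, ⟨Finset.inter_subset_right, fun R h1 h2 h3 => ?_⟩, ?_⟩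
    · by_contra hlt
      have : R ∈ bad := Finset.mem_filter.2 ⟨mem_liveSets.2 ⟨h1, h2, h3⟩, not_le.1 hlt⟩
      simp [hbad] at this
    · rw [repPot, repPot]
      omega
  obtain ⟨Q, hQmin⟩ := Finset.exists_minimal hbad
  have hQb := hQmin.1
  obtain ⟨hQl, hQlt⟩ := Finset.mem_filter.1 hQb
  obtain ⟨hQF, hQS, hQX⟩ := mem_liveSets.1 hQl
  have hQc := hcard Q
  have hQle := hle Q hQF hQS hQX
  have hsQ : s ∈ Q := by
    by_contra hsQ
    rw [if_neg hsQ] at hQc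
    omega
  rw [if_pos hsQ] at hQc
  have hXQ : 1 ≤ (X' ∩ Q).card := by
    rw [Finset.inter_comm]
    exact Finset.card_pos.2 hQX
  -- The set `Q` still meets `X'`, so there is room for one choice; a violation requires a choice
  -- other than `r Q`.
  obtain ⟨e, he, heQ⟩ : ∃ e ∈ D₀ ∩ liveReps F r X' Q, e ≠ r Q := by
    by_cases hrQ : r Q ∈ D₀
    · rw [if_pos hrQ] at hQlt
      exact Finset.exists_mem_ne (by omega) _
    · rw [if_neg hrQ] at hQlt
      obtain ⟨e, he⟩ := Finset.card_pos.1 (show 0 < (D₀ ∩ liveReps F r X' Q).card by omega)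
      refine ⟨e, he, ?_⟩
      rintro rfl
      exact hrQ (Finset.mem_inter.1 he).1
  obtain ⟨heD, heW⟩ := Finset.mem_inter.1 he
  have hstep : ∀ R ∈ F, R ⊆ S → (R ∩ X').Nonempty →
      (D₀.erase e ∩ liveReps F r X' R).card + (if r R ∈ D₀.erase e then 0 else 1) ≤
        (D₀ ∩ liveReps F r X' R).card + (if r R ∈ D₀ then 0 else 1) := by
    intro R h1 h2 h3
    rw [Finset.erase_inter]
    by_cases hR : r R = e
    · have hR' : e ∈ D₀ ∩ liveReps F r X' R :=
        Finset.mem_inter.2 ⟨heD, mem_liveReps.2 ⟨R, h1, Finset.Subset.refl R, h3, hR⟩⟩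
      have := Finset.card_erase_add_one hR'
      split_ifs <;> omega
    · have := Finset.card_le_card (Finset.erase_subset e (D₀ ∩ liveReps F r X' R))
      have h4 : r R ∈ D₀.erase e ↔ r R ∈ D₀ := by simp [hR]
      simp only [h4]
      omega
  refine ⟨D₀.erase e, (Finset.erase_subset _ _).trans hD₀D,
    ⟨(Finset.erase_subset _ _).trans Finset.inter_subset_right, fun R h1 h2 h3 => ?_⟩, ?_⟩
  · by_cases hRbad : R ∈ bad
    · have hRs : s ∈ R := by
        have := (Finset.mem_filter.1 hRbad).2
        by_contra hsR
        have h5 := hcard R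
        have h6 := hle R h1 h2 h3
        rw [if_neg hsR] at h5
        omega
      have hQR : Q ⊆ R := by
        rcases hF Q hQF R h1 with hd | hd | hd
        · exact absurd hRs (Finset.disjoint_left.1 hd hsQ)
        · exact hd
        · exact hQmin.2 hRbad hd
      have hRe : r R ≠ e := by
        intro hRe
        obtain ⟨Q₁, q1, q2, q3, q4⟩ := mem_liveReps.1 heW
        exact heQ ((hr.convex Q₁ q1 Q hQF R h1 q2 hQR (q4.trans hRe.symm)).trans q4).symm
      have h4 : r R ∈ D₀.erase e ↔ r R ∈ D₀ := by simp [hRe]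
      have h5 : e ∈ D₀ ∩ liveReps F r X' R :=
        Finset.mem_inter.2 ⟨heD, liveReps_mono (Finset.Subset.refl _) hQR heW⟩
      have h6 := Finset.card_erase_add_one h5
      have h7 := hle R h1 h2 h3
      have h8 := hcard R
      rw [if_pos hRs] at h8
      rw [Finset.erase_inter]
      simp only [h4]
      omega
    · refine (hstep R h1 h2 h3).trans (not_lt.1 fun hlt => ?_)
      exact hRbad (Finset.mem_filter.2 ⟨mem_liveSets.2 ⟨h1, h2, h3⟩, hlt⟩)
  · have h4 : (liveReps F r X' S \ D₀.erase e).card ≤ (liveReps F r X' S \ D₀).card + 1 := by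
      refine (Finset.card_le_card ?_).trans (Finset.card_insert_le e _)
      intro x hx
      rw [Finset.mem_sdiff, Finset.mem_erase, not_and] at hx
      rw [Finset.mem_insert, Finset.mem_sdiff]
      by_cases hxe : x = e
      · exact Or.inl hxe
      · exact Or.inr ⟨hx.1, hx.2 hxe⟩
    have h5 : (X' ∩ Q).card ≤ X'.card := Finset.card_le_card Finset.inter_subset_left
    rw [repPot, repPot]
    omega

/-! ### Addition of a slot -/

/-- Cardinality is injective on a chain, so the sorted cardinalities yield a strictly monotone
enumeration. The supremum in `height` is over a set bounded by `k + 1`, the number of possible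
cardinalities. -/
theorem card_le_height (hc : List (Finset (Fin k))) {Q : Finset (Finset (Fin k))}
    (hQ : ∀ R ∈ Q, R ∈ hc) (hch : ∀ R ∈ Q, ∀ R' ∈ Q, R ⊆ R' ∨ R' ⊆ R) :
    Q.card ≤ height hc := by
  have hchain : IsChain (· ≤ ·) (Q : Set (Finset (Fin k))) := fun R hR R' hR' _ => hch R hR R' hR'
  have hinj : Set.InjOn Finset.card (Q : Set (Finset (Fin k))) := by
    intro R hR R' hR' h
    rcases hch R hR R' hR' with h' | h'
    · exact Finset.eq_of_subset_of_card_le h' h.ge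
    · exact (Finset.eq_of_subset_of_card_le h' h.le).symm
  refine le_csSup ⟨k + 1, ?_⟩ ?_
  · rintro n ⟨R, hR, -⟩
    have hi : Function.Injective fun i => (⟨(R i).card, Nat.lt_succ_of_le
        ((Finset.card_le_univ (R i)).trans (Fintype.card_fin k).le)⟩ : Fin (k + 1)) := by
      have : StrictMono fun i => (R i).card := fun i j hij => Finset.card_lt_card (hR hij)
      intro i j hij
      exact this.injective (Fin.mk.inj_iff.1 hij)
    simpa using Fintype.card_le_of_injective _ hi
  · have hcard : (Q.image Finset.card).card = Q.card := Finset.card_image_of_injOn hinj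
    let f := (Q.image Finset.card).orderEmbOfFin hcard
    have hf : ∀ i, ∃ R ∈ Q, R.card = f i := fun i => by
      exact Finset.mem_image.1 (Finset.orderEmbOfFin_mem (Q.image Finset.card) hcard i)
    choose R hRQ hRf using hf
    refine ⟨R, fun i j hij => ?_, fun i => hQ _ (hRQ i)⟩
    have hlt : (R i).card < (R j).card := by
      rw [hRf, hRf]
      exact f.strictMono hij
    rcases hch _ (hRQ i) _ (hRQ j) with h' | h'
    · exact Finset.ssubset_iff_subset_ne.2 ⟨h', fun h => by rw [h] at hlt; exact lt_irrefl _ hlt⟩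
    · exact absurd (Finset.card_le_card h') (not_le.2 hlt)

/-- The sets that become live contain `s` and form a chain, so there are at most `height F` new
choices. If `X` is nonempty, the term `X.card - 1` grows by one, but then `S` was live already and
is not in this chain; if `X` is empty, truncated subtraction keeps the term at `0`. -/
theorem RepInv.insertSlot {r : Finset (Fin k) → Finset (Fin k)} {X : Finset (Fin k)}
    {D : Finset (Finset (Fin k))} (h : RepInv F S r X D) (hF : IsLaminar F) (hr : IsRep F r)
    (hS : S ∈ F) (hXS : X ⊆ S) {s : Fin k} (hs : s ∉ X) (hsS : s ∈ S) :
    RepInv F S r (insert s X) D ∧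
      repPot F S r (insert s X) D ≤ repPot F S r X D + height F := by
  classical
  set X' := insert s X with hX'
  have hXX : X ⊆ X' := Finset.subset_insert s X
  have hnew : ∀ Q, s ∉ Q → (Q ∩ X').Nonempty → (Q ∩ X).Nonempty := by
    intro Q hQ hne
    rwa [hX', Finset.inter_insert_of_notMem hQ] at hne
  refine ⟨⟨h.1.trans (liveReps_mono hXX (Finset.Subset.refl S)), fun Q h1 h2 h3 => ?_⟩, ?_⟩
  · by_cases hsQ : s ∈ Q
    · have hc : (X' ∩ Q).card = (X ∩ Q).card + 1 := by
        rw [hX', Finset.insert_inter_of_mem hsQ, Finset.card_insert_of_notMem (by simp [hs])]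
      -- Only the choice of `Q` itself can be counted anew. A choice in `D` was live before, through
      -- some `Q₂`; if `Q₂` is not within `Q`, then `Q` lies between two sets with this choice and
      -- has it, too.
      have hsub : D ∩ liveReps F r X' Q ⊆ (D ∩ liveReps F r X Q) ∪ (D ∩ {r Q}) := by
        intro e he
        obtain ⟨heD, heW⟩ := Finset.mem_inter.1 he
        obtain ⟨Q₁, q1, q2, q3, rfl⟩ := mem_liveReps.1 heW
        obtain ⟨Q₂, p1, p2, p3, p4⟩ := mem_liveReps.1 (h.1 heD)
        rw [Finset.mem_union, Finset.mem_inter, Finset.mem_inter, Finset.mem_singleton]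
        rcases hr.nested hF q1 p1 p4.symm with hn | hn
        · by_cases hQ₂ : Q₂ ⊆ Q
          · exact Or.inl ⟨heD, mem_liveReps.2 ⟨Q₂, p1, hQ₂, p3, p4⟩⟩
          · have hQQ₂ : Q ⊆ Q₂ := by
              rcases hF Q h1 Q₂ p1 with hd | hd | hd
              · obtain ⟨x, hx⟩ := hr.nonempty Q₁ q1
                exact absurd (hn (hr.subset Q₁ q1 hx))
                  (Finset.disjoint_left.1 hd (q2 (hr.subset Q₁ q1 hx)))
              · exact hd
              · exact absurd hd hQ₂
            exact Or.inr ⟨heD, (hr.convex Q₁ q1 Q h1 Q₂ p1 q2 hQQ₂ p4.symm).symm⟩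
        · refine Or.inl ⟨heD, mem_liveReps.2 ⟨Q₁, q1, q2, ?_, rfl⟩⟩
          exact p3.mono (Finset.inter_subset_inter_right hn)
      have hle := (Finset.card_le_card hsub).trans (Finset.card_union_le _ _)
      have h4 := h.card_inter_le hF h2
      rw [hc]
      split_ifs with hrQ
      · have : (D ∩ {r Q}).card ≤ 1 :=
          (Finset.card_le_card Finset.inter_subset_right).trans (Finset.card_singleton _).le
        omega
      · rw [Finset.inter_singleton_of_notMem hrQ, Finset.card_empty] at hle
        omega
    · have h4 := h.2 Q h1 h2 (hnew Q hsQ h3)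
      have h5 : liveReps F r X' Q = liveReps F r X Q := by
        refine Finset.Subset.antisymm (fun e he => ?_) (liveReps_mono hXX (Finset.Subset.refl Q))
        obtain ⟨Q₁, q1, q2, q3, q4⟩ := mem_liveReps.1 he
        exact mem_liveReps.2 ⟨Q₁, q1, q2, hnew Q₁ (fun h => hsQ (q2 h)) q3, q4⟩
      rw [h5]
      exact h4.trans (Finset.card_le_card (Finset.inter_subset_inter_right hXX))
  · let N := F.toFinset.filter fun Q => Q ⊆ S ∧ s ∈ Q ∧ ¬ (Q ∩ X).Nonempty
    have hN : ∀ Q ∈ N, Q ∈ F ∧ Q ⊆ S ∧ s ∈ Q ∧ ¬ (Q ∩ X).Nonempty := fun Q hQ => by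
      simpa [N] using hQ
    have h4 : liveReps F r X' S \ D ⊆ (liveReps F r X S \ D) ∪ N.image r := by
      intro e he
      obtain ⟨heW, heD⟩ := Finset.mem_sdiff.1 he
      obtain ⟨Q, q1, q2, q3, q4⟩ := mem_liveReps.1 heW
      rw [Finset.mem_union, Finset.mem_sdiff]
      by_cases hQ : (Q ∩ X).Nonempty
      · exact Or.inl ⟨mem_liveReps.2 ⟨Q, q1, q2, hQ, q4⟩, heD⟩
      · have hsQ : s ∈ Q := by
          by_contra hsQ
          exact hQ (hnew Q hsQ q3)
        exact Or.inr (Finset.mem_image.2 ⟨Q, by simp [N, q1, q2, hsQ, Finset.not_nonempty_iff_eq_empty.1 hQ], q4⟩)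
    have h5 := (Finset.card_le_card h4).trans ((Finset.card_union_le _ _).trans
      (Nat.add_le_add_left Finset.card_image_le _))
    have hXc : X'.card = X.card + 1 := Finset.card_insert_of_notMem hs
    have hchain : ∀ Q ∈ F, ∀ Q' ∈ F, s ∈ Q → s ∈ Q' → Q ⊆ Q' ∨ Q' ⊆ Q := by
      intro Q hQ Q' hQ' h1 h2
      exact (hF Q hQ Q' hQ').resolve_left fun hd => Finset.disjoint_left.1 hd h1 h2
    have h6 : N.card + (X'.card - 1) ≤ (X.card - 1) + height F := by
      rcases X.eq_empty_or_nonempty with hX | hX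
      · have := card_le_height F (Q := N) (fun Q hQ => (hN Q hQ).1) fun Q hQ Q' hQ' =>
          hchain Q (hN Q hQ).1 Q' (hN Q' hQ').1 (hN Q hQ).2.2.1 (hN Q' hQ').2.2.1
        rw [hXc, hX, Finset.card_empty]
        omega
      · have hSN : S ∉ N := fun hSN => (hN S hSN).2.2.2 (by
          rwa [Finset.inter_eq_right.2 hXS])
        have hmem : ∀ Q ∈ insert S N, Q ∈ F ∧ s ∈ Q := by
          intro Q hQ
          rcases Finset.mem_insert.1 hQ with rfl | hQ
          · exact ⟨hS, hsS⟩
          · exact ⟨(hN Q hQ).1, (hN Q hQ).2.2.1⟩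
        have := card_le_height F (Q := insert S N) (fun Q hQ => (hmem Q hQ).1) fun Q hQ Q' hQ' =>
          hchain Q (hmem Q hQ).1 Q' (hmem Q' hQ').1 (hmem Q hQ).2 (hmem Q' hQ').2
        rw [Finset.card_insert_of_notMem hSN] at this
        have := Finset.card_pos.2 hX
        omega
    rw [repPot, repPot]
    omega

/-! ### Requests -/

/-- The choice of `R` joins `D`. If it was missing, the condition for `R` has a slack of one, which
makes room for it in every superset `Q` of `R`, the choices within `Q \ R` being bounded by
`card_inter_le`. It no longer counts as a live choice outside `D`, and this drop of the potential
pays for it. -/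
theorem RepInv.request {r : Finset (Fin k) → Finset (Fin k)} {X : Finset (Fin k)}
    {D : Finset (Finset (Fin k))} (h : RepInv F S r X D) (hF : IsLaminar F) (hr : IsRep F r)
    {R : Finset (Fin k)} (hR : R ∈ F) (hRS : R ⊆ S) (hRX : (R ∩ X).Nonempty) :
    ∃ D', RepInv F S (repStep r R) X D' ∧ r R ∈ D' ∧
      (D' \ D).card + repPot F S (repStep r R) X D' ≤ repPot F S r X D := by
  classical
  set r' := repStep r R with hr'
  have hpos : ∀ Q, R ⊆ Q → r' Q = r R := fun Q hQ => if_pos hQ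
  have hneg : ∀ Q, ¬ R ⊆ Q → r' Q = r Q := fun Q hQ => if_neg hQ
  have hsub : ∀ Q, liveReps F r' X Q ⊆ liveReps F r X Q := by
    intro Q e he
    obtain ⟨Q₁, q1, q2, q3, rfl⟩ := mem_liveReps.1 he
    by_cases hQ₁ : R ⊆ Q₁
    · exact mem_liveReps.2 ⟨R, hR, hQ₁.trans q2, hRX, (hpos Q₁ hQ₁).symm⟩
    · exact mem_liveReps.2 ⟨Q₁, q1, q2, q3, (hneg Q₁ hQ₁).symm⟩
  have hwW : r R ∈ liveReps F r' X S :=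
    mem_liveReps.2 ⟨R, hR, hRS, hRX, hpos R (Finset.Subset.refl R)⟩
  have hwW' : r R ∈ liveReps F r X S := hsub S hwW
  set D' := insert (r R) D ∩ liveReps F r' X S with hD'
  have hwD' : r R ∈ D' := Finset.mem_inter.2 ⟨Finset.mem_insert_self _ _, hwW⟩
  have hD'D : D' ⊆ insert (r R) D := Finset.inter_subset_left
  refine ⟨D', ⟨Finset.inter_subset_right, fun Q h1 h2 h3 => ?_⟩, hwD', ?_⟩
  · by_cases hRQ : R ⊆ Q
    · rw [hpos Q hRQ, if_pos hwD', add_zero]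
      by_cases hwD : r R ∈ D
      · rw [Finset.insert_eq_of_mem hwD] at hD'D
        exact (Finset.card_le_card (Finset.inter_subset_inter hD'D (hsub Q))).trans
          (h.card_inter_le hF h2)
      · have h4 : D' ∩ liveReps F r' X Q ⊆
            insert (r R) ((D ∩ liveReps F r X R) ∪ (D ∩ liveReps F r X (Q \ R))) := by
          intro e he
          obtain ⟨he1, he2⟩ := Finset.mem_inter.1 he
          rw [Finset.mem_insert, Finset.mem_union, Finset.mem_inter, Finset.mem_inter]
          by_cases hew : e = r R
          · exact Or.inl hew
          have heD := (Finset.mem_insert.1 (hD'D he1)).resolve_left hew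
          obtain ⟨Q₁, q1, q2, q3, rfl⟩ := mem_liveReps.1 he2
          have hRQ₁ : ¬ R ⊆ Q₁ := fun hc => hew (hpos Q₁ hc)
          rw [hneg Q₁ hRQ₁] at heD ⊢
          rcases hF Q₁ q1 R hR with hd | hd | hd
          · exact Or.inr (Or.inr ⟨heD, mem_liveReps.2 ⟨Q₁, q1,
              Finset.subset_sdiff.2 ⟨q2, hd⟩, q3, rfl⟩⟩)
          · exact Or.inr (Or.inl ⟨heD, mem_liveReps.2 ⟨Q₁, q1, hd, q3, rfl⟩⟩)
          · exact absurd hd hRQ₁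
        have h5 := (Finset.card_le_card h4).trans ((Finset.card_insert_le _ _).trans
          (Nat.add_le_add_right (Finset.card_union_le _ _) 1))
        have h6 := h.2 R hR hRS hRX
        have h7 := h.card_inter_le hF (Y := Q \ R) (Finset.sdiff_subset.trans h2)
        rw [if_neg hwD] at h6
        have h8 : (X ∩ R).card + (X ∩ (Q \ R)).card = (X ∩ Q).card := by
          rw [← Finset.card_union_of_disjoint, ← Finset.inter_union_distrib_left,
            Finset.union_sdiff_of_subset hRQ]
          exact Finset.disjoint_of_subset_left Finset.inter_subset_right
            (Finset.disjoint_of_subset_right Finset.inter_subset_right Finset.disjoint_sdiff)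
        omega
    · have h4 := h.2 Q h1 h2 h3
      have h5 : liveReps F r' X Q = liveReps F r X Q := by
        refine Finset.Subset.antisymm (hsub Q) fun e he => ?_
        obtain ⟨Q₁, q1, q2, q3, q4⟩ := mem_liveReps.1 he
        exact mem_liveReps.2 ⟨Q₁, q1, q2, q3, (hneg Q₁ fun hc => hRQ (hc.trans q2)).trans q4⟩
      rw [h5, hneg Q hRQ]
      have hrQ : r Q ∈ D' ↔ r Q = r R ∨ r Q ∈ D := by
        rw [hD', Finset.mem_inter, Finset.mem_insert]
        exact and_iff_left (mem_liveReps.2 ⟨Q, h1, h2, h3, hneg Q hRQ⟩)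
      by_cases hwD : r R ∈ D
      · rw [Finset.insert_eq_of_mem hwD] at hD'D
        have h6 := Finset.card_le_card
          (Finset.inter_subset_inter_right hD'D (u := liveReps F r X Q))
        have h7 : r Q ∈ D' ↔ r Q ∈ D := by
          rw [hrQ]
          refine or_iff_right_of_imp fun h => ?_
          rwa [h]
        simp only [h7]
        omega
      · by_cases hwQ : r R ∈ liveReps F r X Q
        · obtain ⟨Q₁, q1, q2, q3, q4⟩ := mem_liveReps.1 hwQ
          have hQR : Q ⊆ R := by
            rcases hF Q h1 R hR with hd | hd | hd
            · obtain ⟨x, hx⟩ := hr.nonempty Q₁ q1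
              exact absurd (hr.subset R hR (q4 ▸ hx))
                (Finset.disjoint_left.1 hd (q2 (hr.subset Q₁ q1 hx)))
            · exact hd
            · exact absurd hd hRQ
          have hrw : r Q = r R := (hr.convex Q₁ q1 Q h1 R hR q2 hQR q4).trans q4
          rw [hrw, if_neg hwD] at h4
          rw [hrw, if_pos hwD', add_zero]
          refine le_trans ?_ h4
          refine (Finset.card_le_card ?_).trans (Finset.card_insert_le (r R) _)
          intro e he
          obtain ⟨he1, he2⟩ := Finset.mem_inter.1 he
          rw [Finset.mem_insert, Finset.mem_inter]
          exact (Finset.mem_insert.1 (hD'D he1)).imp_right fun h => ⟨h, he2⟩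
        · have h6 : D' ∩ liveReps F r X Q ⊆ D ∩ liveReps F r X Q := by
            intro e he
            obtain ⟨he1, he2⟩ := Finset.mem_inter.1 he
            refine Finset.mem_inter.2 ⟨(Finset.mem_insert.1 (hD'D he1)).resolve_left ?_, he2⟩
            rintro rfl
            exact hwQ he2
          have h7 := Finset.card_le_card h6
          have h8 : r Q ∈ D → r Q ∈ D' := fun h => hrQ.2 (Or.inr h)
          split_ifs at h4 ⊢ with h9 h10 h10
          · omega
          · omega
          · exact absurd (h8 h10) h9
          · omega
  · rw [repPot, repPot]
    have h4 : (liveReps F r' X S \ D') ⊆ (liveReps F r X S \ D).erase (r R) := by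
      intro e he
      obtain ⟨he1, he2⟩ := Finset.mem_sdiff.1 he
      rw [Finset.mem_erase, Finset.mem_sdiff]
      refine ⟨?_, hsub S he1, fun heD => he2
        (Finset.mem_inter.2 ⟨Finset.mem_insert_of_mem heD, he1⟩)⟩
      rintro rfl
      exact he2 hwD'
    have h5 := Finset.card_le_card h4
    by_cases hwD : r R ∈ D
    · rw [Finset.insert_eq_of_mem hwD] at hD'D
      have h6 := Finset.card_le_card (Finset.erase_subset (r R) (liveReps F r X S \ D))
      rw [Finset.sdiff_eq_empty_iff_subset.2 hD'D, Finset.card_empty]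
      omega
    · have h6 := Finset.card_erase_add_one (Finset.mem_sdiff.2 ⟨hwW', hwD⟩)
      have h7 : (D' \ D).card ≤ 1 := by
        refine (Finset.card_le_card (t := {r R}) ?_).trans (Finset.card_singleton _).le
        intro e he
        obtain ⟨he1, he2⟩ := Finset.mem_sdiff.1 he
        exact Finset.mem_singleton.2 ((Finset.mem_insert.1 (hD'D he1)).resolve_right he2)
      omega

end Representatives

theorem LayerBound.subset {V : Type*} [DecidableEq V] {D D' : Finset V} {T : List (List V)}
    {L c : ℕ} (h : LayerBound D T L c) (hD : D' ⊆ D) : LayerBound D' T L c := fun P U hT =>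
  le_trans (Nat.add_le_add_right (Finset.card_le_card (Finset.filter_subset_filter _ hD)) _)
    (h P U hT)

/-! ### The lower bound on the optimum -/

section LevelBound

variable {k : ℕ} {F : List (Finset (Fin k))} {S : Finset (Fin k)}

theorem RepInv.sdiff {r : Finset (Fin k) → Finset (Fin k)} {X : Finset (Fin k)}
    {D : Finset (Finset (Fin k))} (h : RepInv F S r X D) (hF : IsLaminar F) (hr : IsRep F r)
    (Z : Finset (Fin k)) (hZ : Z ⊆ X) :
    ∃ D' ⊆ D, RepInv F S r (X \ Z) D' ∧ repPot F S r (X \ Z) D' ≤ repPot F S r X D := by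
  classical
  induction Z using Finset.induction_on with
  | empty => exact ⟨D, Finset.Subset.refl D, by simpa using h, by simp⟩
  | insert s Z hs ih =>
    rw [Finset.insert_subset_iff] at hZ
    obtain ⟨D₁, h1, h2, h3⟩ := ih hZ.2
    obtain ⟨D₂, h4, h5, h6⟩ := h2.eraseSlot hF hr (Finset.mem_sdiff.2 ⟨hZ.1, hs⟩)
    rw [← Finset.sdiff_insert] at h5 h6
    exact ⟨D₂, h4.trans h1, h5, h6.trans h3⟩

theorem RepInv.union {r : Finset (Fin k) → Finset (Fin k)} {X : Finset (Fin k)}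
    {D : Finset (Finset (Fin k))} (h : RepInv F S r X D) (hF : IsLaminar F) (hr : IsRep F r)
    (hS : S ∈ F) (hXS : X ⊆ S) (Z : Finset (Fin k)) (hZ : Disjoint Z X) (hZS : Z ⊆ S) :
    RepInv F S r (Z ∪ X) D ∧
      repPot F S r (Z ∪ X) D ≤ repPot F S r X D + height F * Z.card := by
  classical
  induction Z using Finset.induction_on with
  | empty => exact ⟨by simpa using h, by simp⟩
  | insert s Z hs ih =>
    rw [Finset.insert_subset_iff] at hZS
    rw [Finset.disjoint_insert_left] at hZ
    obtain ⟨h1, h2⟩ := ih hZ.2 hZS.2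
    obtain ⟨h3, h4⟩ := h1.insertSlot hF hr hS (Finset.union_subset hZS.2 hXS)
      (s := s) (by simp [hs, hZ.1]) hZS.1
    rw [← Finset.insert_union] at h3 h4
    refine ⟨h3, ?_⟩
    rw [Finset.card_insert_of_notMem hs, mul_add, mul_one]
    omega

/-- Removals do not raise the potential and come first; each slot that is added then costs `height
F`. -/
theorem RepInv.change {r : Finset (Fin k) → Finset (Fin k)} {X X' : Finset (Fin k)}
    {D : Finset (Finset (Fin k))} (h : RepInv F S r X D) (hF : IsLaminar F) (hr : IsRep F r)
    (hS : S ∈ F) (hXS : X ⊆ S) (hXS' : X' ⊆ S) :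
    ∃ D' ⊆ D, RepInv F S r X' D' ∧
      repPot F S r X' D' ≤ repPot F S r X D + height F * (X' \ X).card := by
  classical
  obtain ⟨D₁, h1, h2, h3⟩ := h.sdiff hF hr (X \ X') Finset.sdiff_subset
  obtain ⟨h4, h5⟩ := h2.union hF hr hS (Finset.sdiff_subset.trans hXS) (X' \ X)
    (Finset.disjoint_of_subset_right Finset.sdiff_subset Finset.sdiff_disjoint)
    (Finset.sdiff_subset.trans hXS')
  have : X' \ X ∪ X \ (X \ X') = X' := by
    ext x
    simp only [Finset.mem_union, Finset.mem_sdiff]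
    tauto
  rw [this] at h4 h5
  exact ⟨D₁, h1, h4, by omega⟩

/-- A page together with a set of slots. -/
abbrev Tok (k : ℕ) := Page × Finset (Fin k)

/-- A request of the past: its token and its set of slots. -/
abbrev Entry (k : ℕ) := Tok k × Finset (Fin k)

/-- The set that represents the set `R` of slots for the page `p`, after the given requests, of
which the most recent one comes first. -/
def rep (pre : List (Entry k)) (p : Page) (R : Finset (Fin k)) : Finset (Fin k) :=
  (pre.find? fun e => decide (e.1.1 = p) && decide (e.2 ⊆ R)).elim R fun e => e.1.2

/-- The entry for a new request. -/
def entry (pre : List (Entry k)) (r : Request k) : Entry k :=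
  ((r.page, rep pre r.page r.slots), r.slots)

/-- The entries for a sequence of requests, the most recent one first. -/
def entries (σ : List (Request k)) : List (Entry k) :=
  σ.foldl (fun pre r => entry pre r :: pre) []

/-- The layers for the cache that consists of the slots of `S`. -/
def layers (S : Finset (Fin k)) (pre : List (Entry k)) : List (List (Tok k)) :=
  pre.foldr (fun e T => if e.2 ⊆ S then reqLayers e.1 T else T) (List.replicate S.card [])

/-- The number of requests to tokens that are in no layer. -/
def newCount (S : Finset (Fin k)) : List (Entry k) → ℕ
  | [] => 0
  | e :: pre => newCount S pre + if e.2 ⊆ S ∧ e.1 ∉ (layers S pre).flatten then 1 else 0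

theorem layers_cons (S : Finset (Fin k)) (e : Entry k) (pre : List (Entry k)) :
    layers S (e :: pre) = if e.2 ⊆ S then reqLayers e.1 (layers S pre) else layers S pre := rfl

theorem length_layers (hS : S.Nonempty) (pre : List (Entry k)) :
    (layers S pre).length = S.card := by
  induction pre with
  | nil => simp [layers]
  | cons e pre ih =>
    rw [layers_cons]
    split_ifs with h
    · rw [length_reqLayers, ih]
      rw [← List.length_pos_iff, ih]
      exact Finset.card_pos.2 hS
    · exact ih

theorem layers_ne_nil (hS : S.Nonempty) (pre : List (Entry k)) : layers S pre ≠ [] := by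
  rw [← List.length_pos_iff, length_layers hS]
  exact Finset.card_pos.2 hS

theorem nodup_layers (S : Finset (Fin k)) (pre : List (Entry k)) :
    (layers S pre).flatten.Nodup := by
  induction pre with
  | nil => simp [layers]
  | cons e pre ih =>
    rw [layers_cons]
    split_ifs with h
    · exact nodup_reqLayers e.1 ih
    · exact ih

theorem mem_layers {S : Finset (Fin k)} {pre : List (Entry k)} {v : Tok k}
    (hv : v ∈ (layers S pre).flatten) : ∃ e ∈ pre, e.1 = v ∧ e.2 ⊆ S := by
  induction pre with
  | nil => simp [layers] at hv
  | cons e pre ih =>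
    rw [layers_cons] at hv
    have : v = e.1 ∧ e.2 ⊆ S ∨ v ∈ (layers S pre).flatten := by
      split_ifs at hv with h
      · exact (mem_reqLayers hv).imp_left fun h' => ⟨h', h⟩
      · exact Or.inr hv
    rcases this with ⟨rfl, h⟩ | h
    · exact ⟨e, List.mem_cons_self .., rfl, h⟩
    · obtain ⟨e', h1, h2⟩ := ih h
      exact ⟨e', List.mem_cons_of_mem _ h1, h2⟩

theorem rep_cons (e : Entry k) (pre : List (Entry k)) (p : Page) (R : Finset (Fin k)) :
    rep (e :: pre) p R = if e.1.1 = p ∧ e.2 ⊆ R then e.1.2 else rep pre p R := by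
  rw [rep, List.find?_cons]
  by_cases h : e.1.1 = p ∧ e.2 ⊆ R
  · simp [h]
  · rw [if_neg h]
    have : (decide (e.1.1 = p) && decide (e.2 ⊆ R)) = false := by
      rw [← Bool.decide_and]
      exact decide_eq_false h
    rw [this]
    rfl

theorem entries_append (σ : List (Request k)) (r : Request k) :
    entries (σ ++ [r]) = entry (entries σ) r :: entries σ := by
  simp [entries]

/-- The entries of the past, for requests of which the sets are in the family. -/
inductive IsHistory (F : List (Finset (Fin k))) : List (Entry k) → Prop
  | nil : IsHistory F []
  | cons {pre : List (Entry k)} {r : Request k} :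
      IsHistory F pre → r.slots ∈ F → IsHistory F (entry pre r :: pre)

theorem isHistory_entries (σ : List (Request k)) (h : ∀ r ∈ σ, r.slots ∈ F) :
    IsHistory F (entries σ) := by
  induction σ using List.reverseRecOn with
  | nil => exact .nil
  | append_singleton σ r ih =>
    rw [entries_append]
    exact .cons (ih fun r' hr' => h r' (by simp [hr'])) (h r (by simp))

theorem rep_entry_same (pre : List (Entry k)) (r : Request k) :
    rep (entry pre r :: pre) r.page = repStep (rep pre r.page) r.slots := by
  funext R
  rw [rep_cons, repStep]
  simp [entry]

theorem rep_entry_ne (pre : List (Entry k)) (r : Request k) {p : Page} (hp : p ≠ r.page) :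
    rep (entry pre r :: pre) p = rep pre p := by
  funext R
  rw [rep_cons, if_neg]
  rintro ⟨h, -⟩
  exact hp h.symm

theorem IsHistory.isRep {pre : List (Entry k)} (h : IsHistory F pre) (hF : IsLaminar F)
    (hne : ∀ R ∈ F, R.Nonempty) (p : Page) : IsRep F (rep pre p) := by
  induction h with
  | nil => exact isRep_id hne
  | @cons pre r h hr ih =>
    by_cases hp : p = r.page
    · subst hp
      rw [rep_entry_same]
      exact ih.repStep hF hr
    · rw [rep_entry_ne pre r hp]
      exact ih

/-- The number of retrievals into slots of `S`. -/
def levelRetrievals (S : Finset (Fin k)) (C C' : Config k) : ℕ :=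
  (S.filter fun s => C' s ≠ none ∧ C' s ≠ C s).card

/-- The slots of `S` that hold the page `p`. -/
def holders (S : Finset (Fin k)) (C : Config k) (p : Page) : Finset (Fin k) :=
  S.filter fun s => C s = some p

/-- A slot holds only one page, so the slots counted for different pages are distinct. -/
theorem sum_card_holders_sdiff_le (P : Finset Page) (C C' : Config k) :
    ∑ p ∈ P, (holders S C' p \ holders S C p).card ≤ levelRetrievals S C C' := by
  classical
  rw [← Finset.card_biUnion]
  · refine Finset.card_le_card fun s hs => ?_
    obtain ⟨p, -, hs⟩ := Finset.mem_biUnion.1 hs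
    simp only [holders, Finset.mem_sdiff, Finset.mem_filter, not_and] at hs
    obtain ⟨⟨h1, h2⟩, h3⟩ := hs
    refine Finset.mem_filter.2 ⟨h1, by simp [h2], fun h => h3 h1 (h ▸ h2)⟩
  · intro p _ q _ hpq
    rw [Function.onFun, Finset.disjoint_left]
    intro s h1 h2
    simp only [holders, Finset.mem_sdiff, Finset.mem_filter] at h1 h2
    exact hpq (Option.some.inj (h1.1.2.symm.trans h2.1.2))

theorem sum_card_holders_le (P : Finset Page) (C : Config k) :
    ∑ p ∈ P, (holders S C p).card ≤ S.card := by
  classical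
  rw [← Finset.card_biUnion]
  · refine Finset.card_le_card (Finset.biUnion_subset.2 fun p _ => Finset.filter_subset _ _)
  · intro p _ q _ hpq
    rw [Function.onFun, Finset.disjoint_left]
    intro s h1 h2
    simp only [holders, Finset.mem_filter] at h1 h2
    exact hpq (Option.some.inj (h1.2.symm.trans h2.2))

/-- The tokens that belong to a choice of sets for each page. -/
def tokens (P : Finset Page) (D : Page → Finset (Finset (Fin k))) : Finset (Tok k) :=
  P.biUnion fun p => (D p).image fun w => (p, w)

theorem mem_tokens {P : Finset Page} {D : Page → Finset (Finset (Fin k))} {v : Tok k} :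
    v ∈ tokens P D ↔ v.1 ∈ P ∧ v.2 ∈ D v.1 := by
  obtain ⟨p, w⟩ := v
  simp [tokens]

theorem card_tokens_le (P : Finset Page) (D : Page → Finset (Finset (Fin k))) :
    (tokens P D).card ≤ ∑ p ∈ P, (D p).card :=
  Finset.card_biUnion_le.trans (Finset.sum_le_sum fun _ _ => Finset.card_image_le)

theorem card_tokens_sdiff_le (P : Finset Page) (D D' : Page → Finset (Finset (Fin k))) :
    (tokens P D' \ tokens P D).card ≤ ∑ p ∈ P, (D' p \ D p).card := by
  refine (Finset.card_le_card ?_).trans (card_tokens_le P fun p => D' p \ D p)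
  intro v hv
  rw [Finset.mem_sdiff, mem_tokens, mem_tokens] at hv
  rw [mem_tokens, Finset.mem_sdiff]
  exact ⟨hv.1.1, hv.1.2, fun h => hv.2 ⟨hv.1.1, h⟩⟩

/-- The relation between a solution, of which `C` is the present configuration and `a` the number
of retrievals into slots of `S`, and the layers for `S`. -/
def LevelInv (F : List (Finset (Fin k))) (S : Finset (Fin k)) (P : Finset Page)
    (pre : List (Entry k)) (C : Config k) (a : ℕ) : Prop :=
  ∃ (D : Page → Finset (Finset (Fin k))) (c : ℕ),
    (∀ p, RepInv F S (rep pre p) (holders S C p) (D p)) ∧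
    LayerBound (tokens P D) (layers S pre) (newCount S pre) c ∧
    c + ∑ p ∈ P, repPot F S (rep pre p) (holders S C p) (D p) ≤ height F * a

theorem levelInv_nil (P : Finset Page) : LevelInv F S P [] (fun _ => none) 0 := by
  have h : ∀ p, holders S (fun _ => none) p = ∅ := fun p => by simp [holders]
  refine ⟨fun _ => ∅, 0, fun p => ?_, ?_, ?_⟩
  · rw [h]
    exact repInv_empty _
  · have : tokens P (fun _ => (∅ : Finset (Finset (Fin k)))) = ∅ := by
      ext v
      simp [mem_tokens]
    rw [this]
    exact layerBound_init S.card
  · simp [h, repPot_empty]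

theorem RepInv.congr {r r' : Finset (Fin k) → Finset (Fin k)} (hr : ∀ Q ⊆ S, r' Q = r Q)
    {X : Finset (Fin k)} {D : Finset (Finset (Fin k))} (h : RepInv F S r X D) :
    RepInv F S r' X D ∧ repPot F S r' X D = repPot F S r X D := by
  have h1 : ∀ Y ⊆ S, liveReps F r' X Y = liveReps F r X Y := by
    intro Y hY
    refine Finset.image_congr fun R hR => hr R ?_
    exact (mem_liveSets.1 hR).2.1.trans hY
  refine ⟨⟨?_, fun R h2 h3 h4 => ?_⟩, ?_⟩
  · rw [h1 S (Finset.Subset.refl S)]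
    exact h.1
  · rw [h1 R h3, hr R h3]
    exact h.2 R h2 h3 h4
  · rw [repPot, repPot, h1 S (Finset.Subset.refl S)]

/-- The new configuration is taken into account by `RepInv.change` before the request is made by
`RepInv.request`. The simulated cache is `tokens P D`; its cost `c` rises by the tokens that enter,
and the potential pays for them. A request not within `S` does not affect the choices of the subsets
of `S`. -/
theorem LevelInv.step {P : Finset Page} {pre : List (Entry k)} {C C' : Config k} {a : ℕ}
    (h : LevelInv F S P pre C a) (hF : IsLaminar F) (hne : ∀ R ∈ F, R.Nonempty)
    (hpre : IsHistory F pre) (hS : S ∈ F) {r : Request k} (hr : r.slots ∈ F) (hP : r.page ∈ P)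
    (hC : C'.Satisfies r) :
    LevelInv F S P (entry pre r :: pre) C' (a + levelRetrievals S C C') := by
  classical
  obtain ⟨D, c, hD, hL, hc⟩ := h
  have hX : ∀ (C : Config k) p, holders S C p ⊆ S := fun C p => Finset.filter_subset _ _
  choose D₁ h1 h2 h3 using fun p => (hD p).change hF (hpre.isRep hF hne p) hS (hX C p) (hX C' p)
  have hsum : ∑ p ∈ P, repPot F S (rep pre p) (holders S C' p) (D₁ p) ≤
      ∑ p ∈ P, repPot F S (rep pre p) (holders S C p) (D p) +
        height F * levelRetrievals S C C' := by
    refine (Finset.sum_le_sum fun p _ => h3 p).trans ?_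
    rw [Finset.sum_add_distrib, ← Finset.mul_sum]
    exact Nat.add_le_add_left (Nat.mul_le_mul_left _ (sum_card_holders_sdiff_le P C C')) _
  by_cases hRS : r.slots ⊆ S
  · have hRX : (r.slots ∩ holders S C' r.page).Nonempty := by
      obtain ⟨s, hs, hsC⟩ := hC
      exact ⟨s, Finset.mem_inter.2 ⟨hs, Finset.mem_filter.2 ⟨hRS hs, hsC⟩⟩⟩
    obtain ⟨D₂, h4, h5, h6⟩ := (h2 r.page).request hF (hpre.isRep hF hne r.page) hr hRS hRX
    let D' := Function.update D₁ r.page D₂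
    have hself : D' r.page = D₂ := Function.update_self ..
    have hother : ∀ p, p ≠ r.page → D' p = D₁ p := fun p hp => Function.update_of_ne hp ..
    have hinv : ∀ p, RepInv F S (rep (entry pre r :: pre) p) (holders S C' p) (D' p) := by
      intro p
      by_cases hp : p = r.page
      · subst hp
        rw [rep_entry_same, hself]
        exact h4
      · rw [rep_entry_ne pre r hp, hother p hp]
        exact h2 p
    refine ⟨D', c + (tokens P D' \ tokens P D).card, hinv, ?_, ?_⟩
    · have hcard : (tokens P D').card ≤ (layers S pre).length := by
        rw [length_layers (hne S hS)]
        exact (card_tokens_le P D').trans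
          ((Finset.sum_le_sum fun p _ => (hinv p).card_le hF).trans (sum_card_holders_le P C'))
      have hmem : (entry pre r).1 ∈ tokens P D' := by
        rw [mem_tokens]
        refine ⟨hP, ?_⟩
        simp only [entry, hself]
        exact h5
      have := (hL.mono (D' := tokens P D')).step hmem hcard (layers_ne_nil (hne S hS) pre)
      rw [layers_cons, if_pos (show (entry pre r).2 ⊆ S from hRS), newCount]
      convert this using 2
      by_cases hv : (entry pre r).1 ∈ (layers S pre).flatten
      · simp [hv]
      · simp [hv, show (entry pre r).2 ⊆ S from hRS]
    · have h7 : ∑ p ∈ P, (D' p \ D p).card +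
          ∑ p ∈ P, repPot F S (rep (entry pre r :: pre) p) (holders S C' p) (D' p) ≤
          ∑ p ∈ P, repPot F S (rep pre p) (holders S C' p) (D₁ p) := by
        rw [← Finset.sum_add_distrib]
        refine Finset.sum_le_sum fun p _ => ?_
        by_cases hp : p = r.page
        · subst hp
          rw [rep_entry_same, hself]
          refine le_trans (Nat.add_le_add_right (Finset.card_le_card ?_) _) h6
          exact Finset.sdiff_subset_sdiff (Finset.Subset.refl _) (h1 _)
        · rw [rep_entry_ne pre r hp, hother p hp, Finset.sdiff_eq_empty_iff_subset.2 (h1 p)]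
          simp
      have h8 := card_tokens_sdiff_le P D D'
      rw [mul_add]
      omega
  · have hrep : ∀ p, ∀ Q ⊆ S, rep (entry pre r :: pre) p Q = rep pre p Q := by
      intro p Q hQ
      rw [rep_cons, if_neg]
      rintro ⟨-, h⟩
      exact hRS (h.trans hQ)
    have hinv := fun p => (h2 p).congr (hrep p)
    refine ⟨D₁, c, fun p => (hinv p).1, ?_, ?_⟩
    · rw [layers_cons, if_neg (show ¬ (entry pre r).2 ⊆ S from hRS), newCount,
        if_neg (fun h => hRS h.1), add_zero]
      refine hL.subset fun v hv => ?_
      rw [mem_tokens] at hv ⊢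
      exact ⟨hv.1, h1 _ hv.2⟩
    · rw [Finset.sum_congr rfl fun p _ => (hinv p).2, mul_add]
      omega

/-- The total number of retrievals into slots of `S`. -/
def levelCostFrom (S : Finset (Fin k)) : Config k → List (Config k) → ℕ
  | _, [] => 0
  | C, C' :: Cs => levelRetrievals S C C' + levelCostFrom S C' Cs

theorem LevelInv.solution {P : Finset Page} {pre : List (Entry k)} {C : Config k} {a : ℕ}
    (h : LevelInv F S P pre C a) (hF : IsLaminar F) (hne : ∀ R ∈ F, R.Nonempty)
    (hpre : IsHistory F pre) (hS : S ∈ F) {σ : List (Request k)} {Cs : List (Config k)}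
    (hσ : IsSolution σ Cs) (hm : ∀ r ∈ σ, r.slots ∈ F) (hP : ∀ r ∈ σ, r.page ∈ P) :
    ∃ C', LevelInv F S P (σ.foldl (fun pre r => entry pre r :: pre) pre) C'
      (a + levelCostFrom S C Cs) := by
  induction hσ generalizing pre C a with
  | nil => exact ⟨C, h⟩
  | @cons r C' σ Cs hC _ ih =>
    have h1 := h.step hF hne hpre hS (hm r (by simp)) (hP r (by simp)) hC
    have h2 := ih h1 (.cons hpre (hm r (by simp))) (fun r' hr' => hm r' (by simp [hr']))
      fun r' hr' => hP r' (by simp [hr'])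
    rw [add_assoc] at h2
    exact h2

theorem newCount_le (hF : IsLaminar F) (hne : ∀ R ∈ F, R.Nonempty) (hS : S ∈ F)
    {σ : List (Request k)} {Cs : List (Config k)} (hσ : IsSolution σ Cs)
    (hm : ∀ r ∈ σ, r.slots ∈ F) :
    newCount S (entries σ) ≤ height F * levelCostFrom S (fun _ => none) Cs := by
  obtain ⟨C', D, c, -, h1, h2⟩ := (levelInv_nil (σ.map (·.page)).toFinset).solution hF hne .nil hS
    hσ hm fun r hr => by
      rw [List.mem_toFinset]
      exact List.mem_map_of_mem hr
  have := h1.le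
  rw [zero_add] at h2
  exact this.trans ((Nat.le_add_right _ _).trans h2)

/-- The members that contain a given slot form a chain, so a retrieval is counted at most `height F`
times. -/
theorem sum_levelCostFrom_le (hF : IsLaminar F) (C : Config k) (Cs : List (Config k)) :
    ∑ S ∈ F.toFinset, levelCostFrom S C Cs ≤ height F * costFrom C Cs := by
  induction Cs generalizing C with
  | nil => simp [levelCostFrom]
  | cons C' Cs ih =>
    simp only [levelCostFrom, costFrom, Finset.sum_add_distrib, mul_add]
    refine Nat.add_le_add ?_ (ih C')
    have : ∀ S : Finset (Fin k), levelRetrievals S C C' =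
        ∑ s ∈ Finset.univ.filter fun s => C' s ≠ none ∧ C' s ≠ C s, if s ∈ S then 1 else 0 := by
      intro S
      rw [← Finset.card_filter, levelRetrievals]
      congr 1
      ext s
      simp only [Finset.mem_filter, Finset.mem_univ, true_and]
      tauto
    simp only [this]
    rw [Finset.sum_comm, mul_comm, retrievals, ← smul_eq_mul]
    refine Finset.sum_le_card_nsmul _ _ _ fun s _ => ?_
    rw [← Finset.card_filter]
    refine card_le_height F (fun Q hQ => List.mem_toFinset.1 (Finset.mem_filter.1 hQ).1)
      fun Q hQ Q' hQ' => ?_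
    rw [Finset.mem_filter, List.mem_toFinset] at hQ hQ'
    exact (hF Q hQ.1 Q' hQ'.1).resolve_left fun hd => Finset.disjoint_left.1 hd hQ.2 hQ'.2

theorem exists_isSolution {σ : List (Request k)} (h : ∀ r ∈ σ, r.slots.Nonempty) :
    ∃ Cs, IsSolution σ Cs := by
  induction σ with
  | nil => exact ⟨[], .nil⟩
  | cons r σ ih =>
    obtain ⟨Cs, hCs⟩ := ih fun r' hr' => h r' (by simp [hr'])
    obtain ⟨s, hs⟩ := h r (by simp)
    exact ⟨(fun _ => some r.page) :: Cs, .cons ⟨s, hs, rfl⟩ hCs⟩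

/-- The lower bound on the optimum cost. -/
theorem sum_newCount_le {σ : List (Request k)} (h : IsInstance F σ) :
    ∑ S ∈ F.toFinset, newCount S (entries σ) ≤ height F * (height F * opt σ) := by
  obtain ⟨Cs₀, h₀⟩ := exists_isSolution fun r hr => h.nonempty r.slots (h.mem r hr)
  -- The infimum in `opt` is attained because a solution exists; over the empty set it would be `0`
  -- by convention.
  obtain ⟨Cs, h1, h2⟩ := Nat.sInf_mem (s := {c | ∃ Cs, IsSolution σ Cs ∧ cost Cs = c})
    ⟨_, Cs₀, h₀, rfl⟩
  calc ∑ S ∈ F.toFinset, newCount S (entries σ)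
      ≤ ∑ S ∈ F.toFinset, height F * levelCostFrom S (fun _ => none) Cs :=
        Finset.sum_le_sum fun S hS =>
          newCount_le h.laminar h.nonempty (List.mem_toFinset.1 hS) h1 h.mem
    _ = height F * ∑ S ∈ F.toFinset, levelCostFrom S (fun _ => none) Cs :=
        (Finset.mul_sum ..).symm
    _ ≤ height F * (height F * cost Cs) :=
        Nat.mul_le_mul_left _ (sum_levelCostFrom_le h.laminar _ Cs)
    _ = height F * (height F * opt σ) := by rw [h2, opt]

end LevelBound

/-! ### Consistent positions of the tokens in all slot sets -/

section Positions

variable {k : ℕ} {F : List (Finset (Fin k))}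

/-- `S` is the next larger member of the family after `Q`. -/
def Cover (F : List (Finset (Fin k))) (Q S : Finset (Fin k)) : Prop :=
  Q ⊂ S ∧ ∀ Q' ∈ F, ¬ (Q ⊂ Q' ∧ Q' ⊂ S)

instance (F : List (Finset (Fin k))) (Q S : Finset (Fin k)) : Decidable (Cover F Q S) := by
  unfold Cover
  infer_instance

theorem nested_of_mem (hF : IsLaminar F) {Q S : Finset (Fin k)} (hQ : Q ∈ F) (hS : S ∈ F)
    {x : Fin k} (h : x ∈ Q) (h' : x ∈ S) : Q ⊆ S ∨ S ⊆ Q :=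
  (hF Q hQ S hS).resolve_left fun hd => Finset.disjoint_left.1 hd h h'

/-- A maximal member among those that contain `Q` and lie strictly below `S` is covered by `S`, so
`S` is reached from `Q` by covers. -/
theorem chain_induction {Q : Finset (Fin k)} {P : Finset (Fin k) → Prop} (h0 : P Q)
    (h1 : ∀ S ∈ F, ∀ S' ∈ F, Q ⊆ S → Cover F S S' → P S → P S') (hQ : Q ∈ F)
    {S : Finset (Fin k)} (hS : S ∈ F) (hQS : Q ⊆ S) : P S := by
  classical
  induction hn : S.card using Nat.strong_induction_on generalizing S with
  | _ n ih =>
    by_cases hSQ : S = Q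
    · rwa [hSQ]
    have hne : (F.toFinset.filter fun Z => Q ⊆ Z ∧ Z ⊂ S).Nonempty :=
      ⟨Q, by simp [hQ, Finset.ssubset_iff_subset_ne.2 ⟨hQS, Ne.symm hSQ⟩]⟩
    obtain ⟨Z, hZ⟩ := Finset.exists_maximal hne
    have hZ1 := hZ.1
    simp only [Finset.mem_filter, List.mem_toFinset] at hZ1
    refine h1 Z hZ1.1 S hS hZ1.2.1 ⟨hZ1.2.2, fun Z' hZ' h => ?_⟩
      (ih _ (hn ▸ Finset.card_lt_card hZ1.2.2) hZ1.1 hZ1.2.1 rfl)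
    exact h.1.2 (hZ.2 (by simp [hZ', hZ1.2.1.trans h.1.1, h.2]) h.1.1)

/-- Insertion into a chain. -/
def insChain (S : Finset (Fin k)) (l : List (Finset (Fin k))) : List (Finset (Fin k)) :=
  l.filter (fun Q => decide (Q ⊂ S)) ++ S :: l.filter (fun Q => decide (S ⊂ Q))

/-- The members of the family between `Q` and `S`, in ascending order. -/
def chainUp (F : List (Finset (Fin k))) (Q S : Finset (Fin k)) : List (Finset (Fin k)) :=
  (F.filter fun Z => decide (Q ⊆ Z) && decide (Z ⊆ S)).foldr insChain []

theorem insChain_spec {S : Finset (Fin k)} {l : List (Finset (Fin k))}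
    (hl : l.Pairwise (· ⊂ ·)) (h : ∀ Q ∈ l, Q ⊆ S ∨ S ⊆ Q) :
    (insChain S l).Pairwise (· ⊂ ·) ∧ ∀ Q, Q ∈ insChain S l ↔ Q = S ∨ Q ∈ l := by
  constructor
  · rw [insChain, List.pairwise_append, List.pairwise_cons]
    refine ⟨hl.filter _, ⟨fun Q hQ => ?_, hl.filter _⟩, fun Q hQ Q' hQ' => ?_⟩
    · simpa using (List.mem_filter.1 hQ).2
    · have h1 : Q ⊂ S := by simpa using (List.mem_filter.1 hQ).2
      rcases List.mem_cons.1 hQ' with rfl | hQ'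
      · exact h1
      · have h2 : S ⊂ Q' := by simpa using (List.mem_filter.1 hQ').2
        exact h1.trans h2
  · intro Q
    simp only [insChain, List.mem_append, List.mem_cons, List.mem_filter, decide_eq_true_eq]
    constructor
    · rintro (h1 | h1 | h1)
      · exact Or.inr h1.1
      · exact Or.inl h1
      · exact Or.inr h1.1
    · rintro (h1 | h1)
      · exact Or.inr (Or.inl h1)
      · by_cases hQS : Q = S
        · exact Or.inr (Or.inl hQS)
        · rcases h Q h1 with h2 | h2
          · exact Or.inl ⟨h1, Finset.ssubset_iff_subset_ne.2 ⟨h2, hQS⟩⟩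
          · exact Or.inr (Or.inr ⟨h1, Finset.ssubset_iff_subset_ne.2 ⟨h2, Ne.symm hQS⟩⟩)

theorem chainUp_spec (hF : IsLaminar F) {Q : Finset (Fin k)} (hQ : Q.Nonempty)
    (S : Finset (Fin k)) : (chainUp F Q S).Pairwise (· ⊂ ·) ∧
      ∀ Z, Z ∈ chainUp F Q S ↔ Z ∈ F ∧ Q ⊆ Z ∧ Z ⊆ S := by
  obtain ⟨x, hx⟩ := hQ
  have key : ∀ l : List (Finset (Fin k)), (∀ Z ∈ l, Z ∈ F ∧ Q ⊆ Z) →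
      (l.foldr insChain []).Pairwise (· ⊂ ·) ∧ ∀ Z, Z ∈ l.foldr insChain [] ↔ Z ∈ l := by
    intro l
    induction l with
    | nil => simp
    | cons Z l ih =>
      intro h
      obtain ⟨h1, h2⟩ := ih fun Z' hZ' => h Z' (List.mem_cons_of_mem _ hZ')
      have hZ := h Z (List.mem_cons_self ..)
      obtain ⟨h3, h4⟩ := insChain_spec (S := Z) h1 fun Z' hZ' => by
        have hZ'' := h Z' (List.mem_cons_of_mem _ ((h2 Z').1 hZ'))
        exact nested_of_mem hF hZ''.1 hZ.1 (hZ''.2 hx) (hZ.2 hx)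
      refine ⟨h3, fun Z' => ?_⟩
      rw [List.foldr_cons, h4, h2, List.mem_cons]
  obtain ⟨h1, h2⟩ := key (F.filter fun Z => decide (Q ⊆ Z) && decide (Z ⊆ S)) fun Z hZ => by
    simp only [List.mem_filter, Bool.and_eq_true, decide_eq_true_eq] at hZ
    exact ⟨hZ.1, hZ.2.1⟩
  refine ⟨h1, fun Z => ?_⟩
  rw [chainUp, h2]
  simp

theorem eq_of_pairwise_ssubset {l l' : List (Finset (Fin k))} (h : l.Pairwise (· ⊂ ·))
    (h' : l'.Pairwise (· ⊂ ·)) (hm : ∀ Z, Z ∈ l ↔ Z ∈ l') : l = l' := by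
  have hn : l.Nodup := h.imp fun h => h.ne
  have hn' : l'.Nodup := h'.imp fun h => h.ne
  exact ((List.perm_ext_iff_of_nodup hn hn').2 hm).eq_of_pairwise
    (fun a b _ _ h1 h2 => absurd rfl (h1.trans h2).ne) h h'

theorem chainUp_self (hF : IsLaminar F) {Q : Finset (Fin k)} (hQ : Q.Nonempty) (hQF : Q ∈ F) :
    chainUp F Q Q = [Q] := by
  obtain ⟨h1, h2⟩ := chainUp_spec hF hQ Q
  refine eq_of_pairwise_ssubset h1 (List.pairwise_singleton _ _) fun Z => ?_
  rw [h2, List.mem_singleton]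
  constructor
  · rintro ⟨-, h3, h4⟩
    exact Finset.Subset.antisymm h4 h3
  · rintro rfl
    exact ⟨hQF, Finset.Subset.refl _, Finset.Subset.refl _⟩

theorem chainUp_cover (hF : IsLaminar F) {Q : Finset (Fin k)} (hQ : Q.Nonempty)
    {S S' : Finset (Fin k)} (hS : S ∈ F) (hS' : S' ∈ F) (hQS : Q ⊆ S) (h : Cover F S S') :
    chainUp F Q S' = chainUp F Q S ++ [S'] := by
  obtain ⟨h1, h2⟩ := chainUp_spec hF hQ S
  obtain ⟨h1', h2'⟩ := chainUp_spec hF hQ S'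
  refine eq_of_pairwise_ssubset h1' ?_ fun Z => ?_
  · rw [List.pairwise_append]
    refine ⟨h1, List.pairwise_singleton _ _, fun Z hZ Z' hZ' => ?_⟩
    rw [List.mem_singleton.1 hZ']
    exact Finset.ssubset_of_subset_of_ssubset ((h2 Z).1 hZ).2.2 h.1
  · rw [h2', List.mem_append, h2, List.mem_singleton]
    constructor
    · rintro ⟨h3, h4, h5⟩
      by_cases hZ : Z = S'
      · exact Or.inr hZ
      refine Or.inl ⟨h3, h4, ?_⟩
      obtain ⟨x, hx⟩ := hQ
      rcases nested_of_mem hF h3 hS (h4 hx) (hQS hx) with h6 | h6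
      · exact h6
      · by_cases hZS : Z = S
        · exact hZS.subset
        · exact absurd ⟨Finset.ssubset_iff_subset_ne.2 ⟨h6, Ne.symm hZS⟩,
            Finset.ssubset_iff_subset_ne.2 ⟨h5, hZ⟩⟩ (h.2 Z h3)
    · rintro (⟨h3, h4, h5⟩ | rfl)
      · exact ⟨h3, h4, h5.trans h.1.1⟩
      · exact ⟨hS', hQS.trans h.1.1, Finset.Subset.refl _⟩

/-! ### Exchanges along a sequence of slots -/

/-- One exchange; the state consists of the slot before and of the slot that is followed. -/
def trackStep (st : Option (Fin k) × Fin k) (b : Fin k) : Option (Fin k) × Fin k :=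
  (some b, st.1.elim st.2 fun a => if st.2 = a then b else if st.2 = b then a else st.2)

/-- The slot reached from `u` by exchanges of consecutive members of the list. -/
def track (ts : List (Fin k)) (u : Fin k) : Fin k := (ts.foldl trackStep (none, u)).2

theorem foldl_trackStep_fst (ts : List (Fin k)) (u : Fin k) :
    (ts.foldl trackStep (none, u)).1 = ts.getLast? := by
  induction ts using List.reverseRecOn with
  | nil => rfl
  | append_singleton ts b => simp [trackStep]

/-- One more slot composes a transposition on the left. Hence `track ts` is a permutation, and it
fixes all slots outside `ts`. -/
theorem track_append (ts : List (Fin k)) (a b u : Fin k) :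
    track (ts ++ [a] ++ [b]) u = Equiv.swap a b (track (ts ++ [a]) u) := by
  rw [track, List.foldl_append, List.foldl_cons, List.foldl_nil, trackStep, foldl_trackStep_fst]
  simp [Equiv.swap_apply_def, track]

theorem track_singleton (a u : Fin k) : track [a] u = u := rfl

theorem track_injective (ts : List (Fin k)) : Function.Injective (track ts) := by
  induction ts using List.reverseRecOn with
  | nil => exact fun a b h => h
  | append_singleton ts b ih =>
    rcases List.eq_nil_or_concat ts with rfl | ⟨ts, a, rfl⟩
    · exact fun a b h => h
    · intro u u' h
      rw [List.concat_eq_append, track_append, track_append] at h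
      exact ih (by simpa using h)

theorem track_of_notMem {ts : List (Fin k)} {u : Fin k} (h : u ∉ ts) : track ts u = u := by
  induction ts using List.reverseRecOn with
  | nil => rfl
  | append_singleton ts b ih =>
    rcases List.eq_nil_or_concat ts with rfl | ⟨ts, a, rfl⟩
    · rfl
    · simp only [List.concat_eq_append, List.mem_append, List.mem_singleton, not_or] at h ih ⊢
      rw [track_append, ih h.1, Equiv.swap_apply_of_ne_of_ne h.1.2 h.2]

/-- Each exchange carries the followed slot on to the next member of the list. For a route this
means that the first slot receives what was in the slot of `v` in `S`, so that `v` ends up in the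
same slot for all `S`. -/
theorem track_head (ts : List (Fin k)) (a b : Fin k) (h : (a :: ts).getLast? = some b) :
    track (a :: ts) a = b := by
  induction ts using List.reverseRecOn generalizing b with
  | nil => simpa [track_singleton] using h
  | append_singleton ts c ih =>
    obtain ⟨l, d, hl⟩ : ∃ l d, a :: ts = l ++ [d] := by
      rcases List.eq_nil_or_concat (a :: ts) with h' | ⟨l, d, h'⟩
      · simp at h'
      · exact ⟨l, d, by simpa using h'⟩
    have h1 : c = b := by
      rw [← List.cons_append, List.getLast?_concat] at h
      exact Option.some.inj h
    have h2 := ih d (by rw [hl]; simp)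
    rw [← List.cons_append, hl, track_append, ← hl, h2, Equiv.swap_apply_left, h1]

theorem track_of_forall_eq {ts : List (Fin k)} (h : ∀ a ∈ ts, ∀ b ∈ ts, a = b) (u : Fin k) :
    track ts u = u := by
  induction ts using List.reverseRecOn with
  | nil => rfl
  | append_singleton ts b ih =>
    rcases List.eq_nil_or_concat ts with rfl | ⟨ts, a, rfl⟩
    · rfl
    · simp only [List.concat_eq_append] at h ih ⊢
      rw [track_append, ih fun x hx y hy => h x (List.mem_append_left _ hx) y
        (List.mem_append_left _ hy), h a (by simp) b (by simp), Equiv.swap_self]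
      rfl

/-! ### The positions of the tokens -/

/-- The slot of `v`, or a slot of which the content may be evicted. -/
def slotOf (m : Fin k → Option (Tok k)) (B : List (Tok k)) (S : Finset (Fin k)) (v : Tok k) :
    Option (Fin k) :=
  ((List.finRange k).find? fun s => decide (m s = some v)).or
    ((List.finRange k).find? fun s => decide (s ∈ S) && (m s).elim true fun x => !decide (x ∈ B))

/-- The set below `R` that has `v` already, or `R`. -/
def baseOf (F : List (Finset (Fin k))) (M : Finset (Fin k) → Fin k → Option (Tok k)) (v : Tok k)
    (R : Finset (Fin k)) : Finset (Fin k) :=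
  (F.find? fun Q => decide (Cover F Q R) &&
    (List.finRange k).any fun s => decide (M Q s = some v)).getD R

/-- The slots of `v` in the sets between `Q` and `S`. -/
def route (F : List (Finset (Fin k))) (M : Finset (Fin k) → Fin k → Option (Tok k))
    (B : Finset (Fin k) → List (Tok k)) (v : Tok k) (Q S : Finset (Fin k)) : List (Fin k) :=
  (chainUp F Q S).filterMap fun Z => slotOf (M Z) (B Z) Z v

/-- The contents of the slots after a request to `v` in `R`. -/
def place (F : List (Finset (Fin k))) (M : Finset (Fin k) → Fin k → Option (Tok k))
    (B : Finset (Fin k) → List (Tok k)) (v : Tok k) (R S : Finset (Fin k)) (s : Fin k) :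
    Option (Tok k) :=
  if baseOf F M v R ⊆ S then
    if slotOf (M S) (B S) S v = some (track (route F M B v (baseOf F M v R) S) s) then some v
    else M S (track (route F M B v (baseOf F M v R) S) s)
  else M S s

/-- The invariant of the contents `M S` of the slots of the sets `S`. -/
structure PosInv (F : List (Finset (Fin k))) (M : Finset (Fin k) → Fin k → Option (Tok k)) :
    Prop where
  off : ∀ S ∈ F, ∀ a ∉ S, M S a = none
  inj : ∀ S ∈ F, ∀ a b x, M S a = some x → M S b = some x → a = b
  sub : ∀ S ∈ F, ∀ a x, M S a = some x → x.2 ⊆ S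
  link : ∀ Q ∈ F, ∀ S ∈ F, Cover F Q S → ∀ a b x, M Q a = some x → M S b = some x → a = b

/-- The situation at a request to `v` in `R`; the tokens `B S` must not be evicted from `S`. -/
structure ReqInv (F : List (Finset (Fin k))) (M : Finset (Fin k) → Fin k → Option (Tok k))
    (B : Finset (Fin k) → List (Tok k)) (v : Tok k) (R : Finset (Fin k)) : Prop extends
    PosInv F M where
  nonempty : ∀ S ∈ F, S.Nonempty
  laminar : IsLaminar F
  mem : R ∈ F
  tok_sub : v.2 ⊆ R
  tok_nonempty : v.2.Nonempty
  mem_keep : ∀ S ∈ F, R ⊆ S → v ∈ B S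
  card_keep : ∀ S ∈ F, R ⊆ S → (B S).length ≤ S.card

variable {M : Finset (Fin k) → Fin k → Option (Tok k)} {B : Finset (Fin k) → List (Tok k)}
  {v : Tok k} {R : Finset (Fin k)}

theorem baseOf_spec (F : List (Finset (Fin k))) (M : Finset (Fin k) → Fin k → Option (Tok k))
    (v : Tok k) (R : Finset (Fin k)) :
    (baseOf F M v R = R ∧ ∀ Q ∈ F, Cover F Q R → ∀ a, M Q a ≠ some v) ∨
      (baseOf F M v R ∈ F ∧ Cover F (baseOf F M v R) R ∧ ∃ a, M (baseOf F M v R) a = some v) := by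
  rw [baseOf]
  rcases hf : F.find? fun Q => decide (Cover F Q R) &&
    (List.finRange k).any fun s => decide (M Q s = some v) with _ | Q
  · refine Or.inl ⟨rfl, fun Q hQ hc a ha => ?_⟩
    have := List.find?_eq_none.1 hf Q hQ
    simp only [Bool.and_eq_true, decide_eq_true_eq, List.any_eq_true, List.mem_finRange,
      true_and, not_and, not_exists] at this
    exact this hc a ha
  · have h1 := List.find?_some hf
    simp only [Bool.and_eq_true, decide_eq_true_eq, List.any_eq_true, List.mem_finRange,
      true_and] at h1
    exact Or.inr ⟨List.mem_of_find?_eq_some hf, h1⟩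

theorem ReqInv.base_mem (h : ReqInv F M B v R) : baseOf F M v R ∈ F := by
  rcases baseOf_spec F M v R with h1 | h1
  · rw [h1.1]
    exact h.mem
  · exact h1.1

theorem baseOf_sub (F : List (Finset (Fin k))) (M : Finset (Fin k) → Fin k → Option (Tok k))
    (v : Tok k) (R : Finset (Fin k)) : baseOf F M v R ⊆ R := by
  rcases baseOf_spec F M v R with h1 | h1
  · rw [h1.1]
  · exact h1.2.1.1.1

/-- By laminarity a set above the base is comparable with `R`, and no member lies strictly between
the base and `R`. -/
theorem ReqInv.above (h : ReqInv F M B v R) {S : Finset (Fin k)} (hS : S ∈ F)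
    (hQS : baseOf F M v R ⊆ S) :
    R ⊆ S ∨ (S = baseOf F M v R ∧ Cover F S R ∧ ∃ a, M S a = some v) := by
  rcases baseOf_spec F M v R with h1 | ⟨h1, h2, h3⟩
  · rw [h1.1] at hQS
    exact Or.inl hQS
  by_cases hRS : R ⊆ S
  · exact Or.inl hRS
  obtain ⟨x, hx⟩ := h.nonempty _ h1
  have hSR : S ⊆ R :=
    (nested_of_mem h.laminar hS h.mem (hQS hx) (h2.1.1 hx)).resolve_right hRS
  have hS : S = baseOf F M v R := by
    by_contra hne
    exact h2.2 S hS ⟨Finset.ssubset_iff_subset_ne.2 ⟨hQS, Ne.symm hne⟩, ⟨hSR, hRS⟩⟩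
  exact Or.inr ⟨hS, hS ▸ ⟨h2, h3⟩⟩

/-- If `v` is absent and no content may be evicted, the slots of `S` hold `S.card` different tokens
of `B S` other than `v`, too many for `card_keep`. -/
theorem ReqInv.slot_spec (h : ReqInv F M B v R) {S : Finset (Fin k)} (hS : S ∈ F)
    (hQS : baseOf F M v R ⊆ S) : ∃ t ∈ S, slotOf (M S) (B S) S v = some t ∧
      (M S t = some v ∨ ((∀ a, M S a ≠ some v) ∧ R ⊆ S ∧ ∀ x, M S t = some x → x ∉ B S)) := by
  rw [slotOf]
  rcases h1 : (List.finRange k).find? fun s => decide (M S s = some v) with _ | t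
  · have h1' : ∀ a, M S a ≠ some v := fun a ha => by
      have := List.find?_eq_none.1 h1 a (List.mem_finRange a)
      simp [ha] at this
    have hRS : R ⊆ S := by
      rcases h.above hS hQS with hRS | ⟨-, -, a, ha⟩
      · exact hRS
      · exact absurd ha (h1' a)
    rcases h2 : (List.finRange k).find? fun s => decide (s ∈ S) &&
      (M S s).elim true fun x => !decide (x ∈ B S) with _ | t
    · exfalso
      have h2' : ∀ s ∈ S, ∃ x ∈ B S, M S s = some x := fun s hs => by
        have := List.find?_eq_none.1 h2 s (List.mem_finRange s)
        rcases hx : M S s with _ | x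
        · simp [hs, hx] at this
        · exact ⟨x, by simpa [hs, hx] using this, rfl⟩
      choose! f hf1 hf2 using h2'
      have hinj : Set.InjOn f S := fun a ha b hb hab =>
        h.inj S hS a b (f a) (hf2 a ha) (hab ▸ hf2 b hb)
      have hsub : insert v (S.image f) ⊆ (B S).toFinset := by
        intro x hx
        rw [List.mem_toFinset]
        rcases Finset.mem_insert.1 hx with rfl | hx
        · exact h.mem_keep S hS hRS
        · obtain ⟨s, hs, rfl⟩ := Finset.mem_image.1 hx
          exact hf1 s hs
      have hv : v ∉ S.image f := by
        intro hv
        obtain ⟨s, hs, rfl⟩ := Finset.mem_image.1 hv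
        exact h1' s (hf2 s hs)
      have h3 := Finset.card_le_card hsub
      rw [Finset.card_insert_of_notMem hv, Finset.card_image_of_injOn hinj] at h3
      have h4 := List.toFinset_card_le (B S)
      have h5 := h.card_keep S hS hRS
      omega
    · have h3 := List.find?_some h2
      rw [Bool.and_eq_true, decide_eq_true_eq] at h3
      refine ⟨t, h3.1, rfl, Or.inr ⟨h1', hRS, fun x hx => ?_⟩⟩
      simpa [hx] using h3.2
  · have h2 : M S t = some v := by simpa using List.find?_some h1
    refine ⟨t, ?_, rfl, Or.inl h2⟩
    by_contra ht
    rw [h.off S hS t ht] at h2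
    exact absurd h2 (by simp)

theorem ReqInv.slot_eq (h : ReqInv F M B v R) {S : Finset (Fin k)} (hS : S ∈ F)
    (hQS : baseOf F M v R ⊆ S) {a t : Fin k} (ht : slotOf (M S) (B S) S v = some t)
    (ha : M S a = some v) : t = a := by
  obtain ⟨t', -, h1, h2⟩ := h.slot_spec hS hQS
  obtain rfl : t = t' := Option.some.inj (ht.symm.trans h1)
  rcases h2 with h2 | h2
  · exact h.inj S hS t a v h2 ha
  · exact absurd ha (h2.1 a)

theorem ReqInv.route_self (h : ReqInv F M B v R) {t : Fin k}
    (ht : slotOf (M (baseOf F M v R)) (B (baseOf F M v R)) (baseOf F M v R) v = some t) :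
    route F M B v (baseOf F M v R) (baseOf F M v R) = [t] := by
  rw [route, chainUp_self h.laminar (h.nonempty _ h.base_mem) h.base_mem]
  simp [ht]

theorem ReqInv.route_cover (h : ReqInv F M B v R) {S S' : Finset (Fin k)} (hS : S ∈ F)
    (hS' : S' ∈ F) (hQS : baseOf F M v R ⊆ S) (hc : Cover F S S') {t : Fin k}
    (ht : slotOf (M S') (B S') S' v = some t) :
    route F M B v (baseOf F M v R) S' = route F M B v (baseOf F M v R) S ++ [t] := by
  rw [route, chainUp_cover h.laminar (h.nonempty _ h.base_mem) hS hS' hQS hc, route,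
    List.filterMap_append]
  simp [ht]

theorem ReqInv.route_last (h : ReqInv F M B v R) {S : Finset (Fin k)} (hS : S ∈ F)
    (hQS : baseOf F M v R ⊆ S) {t : Fin k} (ht : slotOf (M S) (B S) S v = some t) :
    ∃ l, route F M B v (baseOf F M v R) S = l ++ [t] := by
  revert t
  refine chain_induction (F := F) (Q := baseOf F M v R) (P := fun S => ∀ {t : Fin k},
    slotOf (M S) (B S) S v = some t → ∃ l, route F M B v (baseOf F M v R) S = l ++ [t])
    (fun {t} ht => ⟨[], h.route_self ht⟩) (fun S hS S' hS' hQ hc _ t ht => ?_) h.base_mem hS hQS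
  exact ⟨_, h.route_cover hS hS' hQ hc ht⟩

theorem ReqInv.route_head (h : ReqInv F M B v R) {S : Finset (Fin k)} (hS : S ∈ F)
    (hQS : baseOf F M v R ⊆ S) {t : Fin k}
    (ht : slotOf (M (baseOf F M v R)) (B (baseOf F M v R)) (baseOf F M v R) v = some t) :
    ∃ l, route F M B v (baseOf F M v R) S = t :: l := by
  refine chain_induction (F := F) (Q := baseOf F M v R)
    (P := fun S => ∃ l, route F M B v (baseOf F M v R) S = t :: l)
    ⟨[], h.route_self ht⟩ (fun S hS S' hS' hQ hc ih => ?_) h.base_mem hS hQS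
  obtain ⟨l, hl⟩ := ih
  obtain ⟨t', -, ht', -⟩ := h.slot_spec hS' (hQ.trans hc.1.1)
  exact ⟨l ++ [t'], by rw [h.route_cover hS hS' hQ hc ht', hl, List.cons_append]⟩

theorem ReqInv.mem_route (h : ReqInv F M B v R) {S : Finset (Fin k)} {s : Fin k}
    (hs : s ∈ route F M B v (baseOf F M v R) S) : ∃ Z ∈ F, baseOf F M v R ⊆ Z ∧ Z ⊆ S ∧ s ∈ Z ∧
      slotOf (M Z) (B Z) Z v = some s := by
  obtain ⟨Z, hZ, hs⟩ := List.mem_filterMap.1 hs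
  obtain ⟨h1, h2, h3⟩ := ((chainUp_spec h.laminar (h.nonempty _ h.base_mem) S).2 Z).1 hZ
  obtain ⟨t, h4, h5, -⟩ := h.slot_spec h1 h2
  obtain rfl : s = t := Option.some.inj (hs.symm.trans h5)
  exact ⟨Z, h1, h2, h3, h4, h5⟩

theorem ReqInv.place_of_above {S : Finset (Fin k)}
    (hQS : baseOf F M v R ⊆ S) {t : Fin k} (ht : slotOf (M S) (B S) S v = some t) (s : Fin k) :
    place F M B v R S s = if t = track (route F M B v (baseOf F M v R) S) s then some v
      else M S (track (route F M B v (baseOf F M v R) S) s) := by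
  rw [place, if_pos hQS, ht]
  simp only [Option.some.injEq]

theorem place_of_not_above {S : Finset (Fin k)} (hQS : ¬ baseOf F M v R ⊆ S) :
    place F M B v R S = M S := by
  funext s
  rw [place, if_neg hQS]

theorem ReqInv.place_base (h : ReqInv F M B v R) {a : Fin k}
    (ha : M (baseOf F M v R) a = some v) : place F M B v R (baseOf F M v R) =
      M (baseOf F M v R) := by
  funext s
  obtain ⟨t, -, ht, -⟩ := h.slot_spec h.base_mem (Finset.Subset.refl _)
  rw [ReqInv.place_of_above (Finset.Subset.refl _) ht, h.route_self ht, track_singleton]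
  split_ifs with hs
  · rw [← hs, h.slot_eq h.base_mem (Finset.Subset.refl _) ht ha, ha]
  · rfl

theorem ReqInv.place_of_not_sub (h : ReqInv F M B v R) {S : Finset (Fin k)} (hS : S ∈ F)
    (hRS : ¬ R ⊆ S) : place F M B v R S = M S := by
  by_cases hQS : baseOf F M v R ⊆ S
  · obtain ⟨rfl, -, a, ha⟩ := (h.above hS hQS).resolve_left hRS
    exact h.place_base ha
  · exact place_of_not_above hQS

/-- After the request `v` is in the same slot for all these sets. -/
theorem ReqInv.place_slot (h : ReqInv F M B v R) : ∃ t ∈ R, ∀ S ∈ F, R ⊆ S →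
    place F M B v R S t = some v := by
  obtain ⟨t, ht, hs, -⟩ := h.slot_spec h.base_mem (Finset.Subset.refl _)
  refine ⟨t, (baseOf_sub F M v R) ht, fun S hS hRS => ?_⟩
  have hQS := (baseOf_sub F M v R).trans hRS
  obtain ⟨t', -, ht', -⟩ := h.slot_spec hS hQS
  obtain ⟨l, hl⟩ := h.route_head hS hQS hs
  obtain ⟨l', hl'⟩ := h.route_last hS hQS ht'
  rw [ReqInv.place_of_above hQS ht', if_pos]
  rw [hl, track_head l t t']
  rw [← hl, hl']
  simp

/-- The contents are permuted, and only that of the slot chosen by `slotOf` is overwritten; it is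
`v` itself or a token outside `B S`. -/
theorem ReqInv.place_keep (h : ReqInv F M B v R) {S : Finset (Fin k)} (hS : S ∈ F)
    (hRS : R ⊆ S) {x : Tok k} (hx : x ∈ B S) (hxM : ∃ a, M S a = some x) :
    ∃ a, place F M B v R S a = some x := by
  have hQS := (baseOf_sub F M v R).trans hRS
  by_cases hxv : x = v
  · obtain ⟨t, -, ht⟩ := h.place_slot
    exact ⟨t, hxv ▸ ht S hS hRS⟩
  obtain ⟨a, ha⟩ := hxM
  obtain ⟨t, -, ht, ht'⟩ := h.slot_spec hS hQS
  obtain ⟨b, hb⟩ := (Finite.injective_iff_surjective.1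
    (track_injective (route F M B v (baseOf F M v R) S))) a
  refine ⟨b, ?_⟩
  rw [ReqInv.place_of_above hQS ht, hb, if_neg, ha]
  rintro rfl
  rcases ht' with ht' | ⟨-, -, ht'⟩
  · exact hxv (Option.some.inj (ha.symm.trans ht'))
  · exact ht' x ha hx

/-- The essential field is `link`. For two consecutive sets above the base, the permutations differ
by the exchange of the slots chosen for `v` in them; a common token other than `v` that survives is
in neither of these slots, so it stays in a common slot. If only the larger set is above the base, a
slot used by the smaller one cannot come from a proper intermediate set of the route, by the cover
relation. -/
theorem ReqInv.posInv_place (h : ReqInv F M B v R) : PosInv F (place F M B v R) := by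
  have hsub : ∀ S, (∀ s ∈ route F M B v (baseOf F M v R) S, s ∈ S) := fun S s hs => by
    obtain ⟨Z, -, -, h1, h2, -⟩ := h.mem_route hs
    exact h1 h2
  refine ⟨fun S hS a ha => ?_, fun S hS a b x hax hbx => ?_, fun S hS a x hax => ?_,
    fun Q' hQ' S' hS' hc a b x hax hbx => ?_⟩
  · by_cases hQS : baseOf F M v R ⊆ S
    · obtain ⟨t, htS, ht, -⟩ := h.slot_spec hS hQS
      rw [ReqInv.place_of_above hQS ht, track_of_notMem fun hr => ha (hsub S a hr), if_neg,
        h.off S hS a ha]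
      rintro rfl
      exact ha htS
    · rw [place_of_not_above hQS, h.off S hS a ha]
  · by_cases hQS : baseOf F M v R ⊆ S
    · obtain ⟨t, htS, ht, -⟩ := h.slot_spec hS hQS
      rw [ReqInv.place_of_above hQS ht] at hax hbx
      refine track_injective (route F M B v (baseOf F M v R) S) ?_
      split_ifs at hax hbx with h1 h2 h2
      · exact h1.symm.trans h2
      · rw [← hax] at hbx
        exact absurd (h.slot_eq hS hQS ht hbx) h2
      · rw [← hbx] at hax
        exact absurd (h.slot_eq hS hQS ht hax) h1
      · exact h.inj S hS _ _ x hax hbx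
    · rw [place_of_not_above hQS] at hax hbx
      exact h.inj S hS a b x hax hbx
  · by_cases hQS : baseOf F M v R ⊆ S
    · obtain ⟨t, htS, ht, -⟩ := h.slot_spec hS hQS
      rw [ReqInv.place_of_above hQS ht] at hax
      split_ifs at hax with h1
      · obtain rfl := Option.some.inj hax
        rcases h.above hS hQS with h2 | ⟨-, -, c, hcv⟩
        · exact h.tok_sub.trans h2
        · exact h.sub S hS c _ hcv
      · exact h.sub S hS _ x hax
    · rw [place_of_not_above hQS] at hax
      exact h.sub S hS a x hax
  · by_cases hQS' : baseOf F M v R ⊆ S'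
    swap
    · rw [place_of_not_above hQS'] at hbx
      rw [place_of_not_above fun hQ => hQS' (hQ.trans hc.1.1)] at hax
      exact h.link Q' hQ' S' hS' hc a b x hax hbx
    obtain ⟨t', htS', ht', -⟩ := h.slot_spec hS' hQS'
    by_cases hQQ' : baseOf F M v R ⊆ Q'
    · obtain ⟨t, htQ', ht, -⟩ := h.slot_spec hQ' hQQ'
      obtain ⟨l, hl⟩ := h.route_last hQ' hQQ' ht
      rw [ReqInv.place_of_above hQS' ht', h.route_cover hQ' hS' hQQ' hc ht', hl,
        track_append] at hbx
      rw [ReqInv.place_of_above hQQ' ht, hl] at hax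
      refine track_injective (l ++ [t]) ?_
      split_ifs at hax hbx with h1 h2 h2
      · rw [← h1]
        have := congrArg (Equiv.swap t t') h2
        rwa [Equiv.swap_apply_right, Equiv.swap_apply_self] at this
      · rw [← hax] at hbx
        exact absurd (h.slot_eq hS' hQS' ht' hbx) h2
      · rw [← hbx] at hax
        exact absurd (h.slot_eq hQ' hQQ' ht hax) h1
      · have h3 := h.link Q' hQ' S' hS' hc _ _ x hax hbx
        rw [← h3] at h2
        have h4 := congrArg (Equiv.swap t t') h3
        rw [Equiv.swap_apply_self, Equiv.swap_apply_of_ne_of_ne (Ne.symm h1) (Ne.symm h2)] at h4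
        exact h4
    · rw [place_of_not_above hQQ'] at hax
      rw [ReqInv.place_of_above hQS' ht'] at hbx
      split_ifs at hbx with h1
      · obtain rfl := Option.some.inj hbx
        by_cases hSQ : S' = baseOf F M v R
        · rcases baseOf_spec F M v R with h2 | ⟨-, -, c, hcv⟩
          · exact absurd hax (h2.2 Q' hQ' (h2.1 ▸ hSQ ▸ hc) a)
          · rw [hSQ] at h1 ht' hc
            rw [h.route_self ht', track_singleton] at h1
            rw [← h1, h.slot_eq h.base_mem (Finset.Subset.refl _) ht' hcv]
            exact h.link Q' hQ' _ h.base_mem hc a c v hax hcv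
        -- A set `Q'` that holds `v` but is not above the base meets `R`, because the set of `v` is
        -- nonempty. Hence `Q'` is below `R`, and `R = S'` by the cover relation. The base then also
        -- holds `v` and lies strictly between `Q'` and `S'`, a contradiction.
        · exfalso
          have hRS' : R ⊆ S' := (h.above hS' hQS').resolve_right fun h2 => hSQ h2.1
          obtain ⟨y, hy⟩ := h.tok_nonempty
          have hyQ' := h.sub Q' hQ' a v hax hy
          have hQ'R : Q' ⊆ R := (nested_of_mem h.laminar hQ' h.mem hyQ'
            (h.tok_sub hy)).resolve_right fun h2 => hQQ' ((baseOf_sub F M v R).trans h2)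
          have hQ'R' : Q' ⊂ R := Finset.ssubset_iff_subset_ne.2 ⟨hQ'R, fun h2 =>
            hQQ' (h2 ▸ (baseOf_sub F M v R))⟩
          have hRS : R = S' := by
            by_contra hne
            exact hc.2 R h.mem ⟨hQ'R', Finset.ssubset_iff_subset_ne.2 ⟨hRS', hne⟩⟩
          subst hRS
          rcases baseOf_spec F M v R with h2 | ⟨h2, h3, c, hcv⟩
          · exact hSQ h2.1.symm
          · have hyQ := h.sub _ h2 c v hcv hy
            have h4 := (nested_of_mem h.laminar h2 hQ' hyQ hyQ').resolve_left hQQ'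
            exact hc.2 _ h2 ⟨⟨h4, hQQ'⟩, h3.1⟩
      · have h2 := h.link Q' hQ' S' hS' hc a _ x hax hbx
        have haQ' : a ∈ Q' := by
          by_contra ha
          rw [h.off Q' hQ' a ha] at hax
          exact absurd hax (by simp)
        have h3 : a ∉ route F M B v (baseOf F M v R) S' := by
          intro hr
          obtain ⟨Z, z1, z2, z3, z4, z5⟩ := h.mem_route hr
          by_cases hZ : Z = S'
          · subst hZ
            exact h1 ((Option.some.inj (ht'.symm.trans z5)).trans h2)
          · have h4 := (nested_of_mem h.laminar hQ' z1 haQ' z4).resolve_right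
              fun h5 => hQQ' (z2.trans h5)
            exact hc.2 Z z1 ⟨⟨h4, fun h5 => hQQ' (z2.trans h5)⟩,
              Finset.ssubset_iff_subset_ne.2 ⟨z3, hZ⟩⟩
        exact track_injective (route F M B v (baseOf F M v R) S') ((track_of_notMem h3).trans h2)

end Positions

/-! ### The number of retrievals, and the algorithm -/

section Cost

variable {k : ℕ} {F : List (Finset (Fin k))}
  {M : Finset (Fin k) → Fin k → Option (Tok k)} {B : Finset (Fin k) → List (Tok k)}
  {v : Tok k} {R : Finset (Fin k)}

/-- The number of sets above `R` that do not have `v`. -/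
def faults (F : List (Finset (Fin k))) (M : Finset (Fin k) → Fin k → Option (Tok k)) (v : Tok k)
    (R : Finset (Fin k)) : ℕ :=
  (F.toFinset.filter fun S => R ⊆ S ∧ ¬ ∃ a, M S a = some v).card

/-- Consecutive sets that both hold `v` have it in the same slot, by `link`. A set without `v` thus
adds at most two slots to the route, its own one and that of the next set if this set holds `v`; the
start accounts for one more. -/
theorem ReqInv.card_route_le (h : ReqInv F M B v R) {S : Finset (Fin k)} (hS : S ∈ F)
    (hQS : baseOf F M v R ⊆ S) : (route F M B v (baseOf F M v R) S).toFinset.card ≤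
      2 * (F.toFinset.filter fun Z => baseOf F M v R ⊆ Z ∧ Z ⊆ S ∧ ¬ ∃ a, M Z a = some v).card +
        if ∃ a, M S a = some v then 1 else 0 := by
  refine chain_induction (F := F) (Q := baseOf F M v R)
    (P := fun S => (route F M B v (baseOf F M v R) S).toFinset.card ≤
      2 * (F.toFinset.filter fun Z => baseOf F M v R ⊆ Z ∧ Z ⊆ S ∧ ¬ ∃ a, M Z a = some v).card +
        if ∃ a, M S a = some v then 1 else 0) ?_ (fun S hS S' hS' hQ hc ih => ?_) h.base_mem hS hQS
  · obtain ⟨t, -, ht, -⟩ := h.slot_spec h.base_mem (Finset.Subset.refl _)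
    rw [h.route_self ht]
    split_ifs with hv
    · simp
    · have : 0 < (F.toFinset.filter fun Z => baseOf F M v R ⊆ Z ∧ Z ⊆ baseOf F M v R ∧
          ¬ ∃ a, M Z a = some v).card := Finset.card_pos.2 ⟨baseOf F M v R, by
        rw [Finset.mem_filter, List.mem_toFinset]
        exact ⟨h.base_mem, Finset.Subset.refl _, Finset.Subset.refl _, hv⟩⟩
      simp only [List.toFinset_cons, List.toFinset_nil, insert_empty_eq, Finset.card_singleton]
      omega
  · obtain ⟨t, -, ht, -⟩ := h.slot_spec hS hQ
    obtain ⟨t', -, ht', -⟩ := h.slot_spec hS' (hQ.trans hc.1.1)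
    have hroute := h.route_cover hS hS' hQ hc ht'
    have hset : (route F M B v (baseOf F M v R) S').toFinset =
        insert t' (route F M B v (baseOf F M v R) S).toFinset := by
      rw [hroute]
      ext x
      simp
    have hmono : (F.toFinset.filter fun Z => baseOf F M v R ⊆ Z ∧ Z ⊆ S ∧
          ¬ ∃ a, M Z a = some v) ⊆
        F.toFinset.filter fun Z => baseOf F M v R ⊆ Z ∧ Z ⊆ S' ∧ ¬ ∃ a, M Z a = some v := by
      intro Z hZ
      rw [Finset.mem_filter] at hZ ⊢
      exact ⟨hZ.1, hZ.2.1, hZ.2.2.1.trans hc.1.1, hZ.2.2.2⟩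
    have hle := Finset.card_insert_le t' (route F M B v (baseOf F M v R) S).toFinset
    rw [hset]
    by_cases hv' : ∃ a, M S' a = some v
    · have hcard := Finset.card_le_card hmono
      rw [if_pos hv']
      by_cases hv : ∃ a, M S a = some v
      · obtain ⟨a, ha⟩ := hv
        obtain ⟨a', ha'⟩ := hv'
        have h1 : t' = t := by
          rw [h.slot_eq hS hQ ht ha, h.slot_eq hS' (hQ.trans hc.1.1) ht' ha']
          exact (h.link S hS S' hS' hc a a' v ha ha').symm
        obtain ⟨l, hl⟩ := h.route_last hS hQ ht
        rw [Finset.insert_eq_of_mem (by rw [hl, h1]; simp)]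
        rw [if_pos ⟨a, ha⟩] at ih
        omega
      · rw [if_neg hv] at ih
        omega
    · have hlt : (F.toFinset.filter fun Z => baseOf F M v R ⊆ Z ∧ Z ⊆ S ∧
          ¬ ∃ a, M Z a = some v).card <
          (F.toFinset.filter fun Z => baseOf F M v R ⊆ Z ∧ Z ⊆ S' ∧
            ¬ ∃ a, M Z a = some v).card := by
        refine Finset.card_lt_card ⟨hmono, fun hsub => ?_⟩
        have := hsub (Finset.mem_filter.2 ⟨List.mem_toFinset.2 hS', hQ.trans hc.1.1,
          Finset.Subset.refl _, hv'⟩)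
        exact hc.1.2 (Finset.mem_filter.1 this).2.2.1
      have hite : (if ∃ a, M S a = some v then 1 else 0) ≤ 1 := by split_ifs <;> omega
      rw [if_neg hv']
      omega

/-- Slots off the route do not change, and with `f` faults the route has at most `2 * f + 1` slots,
which is at most `3 * f` unless `f = 0`. Without faults the route has only one slot, which already
holds `v`, and nothing changes. -/
theorem ReqInv.card_place_ne_le (h : ReqInv F M B v R) {S : Finset (Fin k)} (hS : S ∈ F)
    (hRS : R ⊆ S) :
    (Finset.univ.filter fun s => place F M B v R S s ≠ M S s).card ≤ 3 * faults F M v R := by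
  have hQS := (baseOf_sub F M v R).trans hRS
  obtain ⟨t, -, ht, -⟩ := h.slot_spec hS hQS
  obtain ⟨l, hl⟩ := h.route_last hS hQS ht
  have h1 := h.card_route_le hS hQS
  have h2 : (F.toFinset.filter fun Z => baseOf F M v R ⊆ Z ∧ Z ⊆ S ∧
      ¬ ∃ a, M Z a = some v).card ≤ faults F M v R := by
    refine Finset.card_le_card fun Z hZ => ?_
    rw [Finset.mem_filter, List.mem_toFinset] at hZ
    rw [Finset.mem_filter, List.mem_toFinset]
    refine ⟨hZ.1, ?_, hZ.2.2.2⟩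
    exact (h.above hZ.1 hZ.2.1).resolve_right fun h' => hZ.2.2.2 h'.2.2
  have hite : (if ∃ a, M S a = some v then 1 else 0) ≤ 1 := by split_ifs <;> omega
  by_cases hf : faults F M v R = 0
  · have hv : ∃ a, M S a = some v := by
      by_contra hv
      have : S ∈ F.toFinset.filter fun S => R ⊆ S ∧ ¬ ∃ a, M S a = some v :=
        Finset.mem_filter.2 ⟨List.mem_toFinset.2 hS, hRS, hv⟩
      rw [Finset.card_eq_zero.1 hf] at this
      simp at this
    obtain ⟨a, ha⟩ := hv
    have htrack := track_of_forall_eq (ts := route F M B v (baseOf F M v R) S)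
      fun x hx y hy => Finset.card_le_one.1 (by omega) x (List.mem_toFinset.2 hx) y
        (List.mem_toFinset.2 hy)
    rw [Finset.filter_eq_empty_iff.2, Finset.card_empty]
    · exact Nat.zero_le _
    · intro s _
      rw [ReqInv.place_of_above hQS ht, htrack]
      split_ifs with hs
      · rw [← hs, h.slot_eq hS hQS ht ha, ha]
        simp
      · simp
  · refine (Finset.card_le_card (t := (route F M B v (baseOf F M v R) S).toFinset) ?_).trans
      (by omega)
    intro s hs
    rw [Finset.mem_filter] at hs
    by_contra hs'
    rw [List.mem_toFinset] at hs'
    refine hs.2 ?_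
    rw [ReqInv.place_of_above hQS ht, track_of_notMem hs', if_neg]
    rintro rfl
    exact hs' (by rw [hl]; simp)

/-- The largest member of the family that contains a slot. -/
def rootOf (F : List (Finset (Fin k))) (s : Fin k) : Option (Finset (Fin k)) :=
  F.find? fun T => decide (s ∈ T) && F.all fun T' => !decide (T ⊂ T')

/-- The pages in the cache. -/
def configOf (F : List (Finset (Fin k))) (M : Finset (Fin k) → Fin k → Option (Tok k)) :
    Config k := fun s => (rootOf F s).elim none fun T => (M T s).map Prod.fst

theorem rootOf_spec {s : Fin k} {T : Finset (Fin k)} (h : rootOf F s = some T) :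
    T ∈ F ∧ s ∈ T ∧ ∀ T' ∈ F, ¬ T ⊂ T' := by
  have h1 := List.find?_some h
  simp only [Bool.and_eq_true, decide_eq_true_eq, List.all_eq_true, Bool.not_eq_true',
    decide_eq_false_iff_not] at h1
  exact ⟨List.mem_of_find?_eq_some h, h1⟩

theorem exists_rootOf {s : Fin k} {S : Finset (Fin k)} (hS : S ∈ F) (hs : s ∈ S) :
    ∃ T, rootOf F s = some T := by
  rcases h : rootOf F s with _ | T
  · exfalso
    obtain ⟨T, hT⟩ := Finset.exists_maximal (s := F.toFinset.filter fun T => s ∈ T)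
      ⟨S, by simp [hS, hs]⟩
    have hT1 := hT.1
    simp only [Finset.mem_filter, List.mem_toFinset] at hT1
    have := List.find?_eq_none.1 h T hT1.1
    simp only [Bool.and_eq_true, decide_eq_true_eq, List.all_eq_true, Bool.not_eq_true',
      decide_eq_false_iff_not, not_and, not_forall, not_not] at this
    obtain ⟨T', h1, h2⟩ := this hT1.2
    exact h2.2 (hT.2 (by simp [h1, h2.1 hT1.2]) h2.1)
  · exact ⟨T, rfl⟩

theorem ReqInv.satisfies (h : ReqInv F M B v R) :
    (configOf F (place F M B v R)).Satisfies ⟨v.1, R⟩ := by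
  obtain ⟨t, ht, h1⟩ := h.place_slot
  refine ⟨t, ht, ?_⟩
  obtain ⟨T, hT⟩ := exists_rootOf h.mem ht
  obtain ⟨h2, h3, h4⟩ := rootOf_spec hT
  have hRT : R ⊆ T := by
    rcases nested_of_mem h.laminar h.mem h2 ht h3 with h5 | h5
    · exact h5
    · by_contra h6
      exact h4 R h.mem ⟨h5, h6⟩
  simp only [configOf, hT, Option.elim_some, h1 T h2 hRT, Option.map_some]

/-- The configuration displays the arrays of the maximal members, and only that of the unique
maximal member above `R` is affected. -/
theorem ReqInv.retrievals_le (h : ReqInv F M B v R) :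
    retrievals (configOf F M) (configOf F (place F M B v R)) ≤ 3 * faults F M v R := by
  have key : ∀ s, configOf F (place F M B v R) s ≠ configOf F M s →
      ∃ T, T ∈ F ∧ R ⊆ T ∧ (∀ T' ∈ F, ¬ T ⊂ T') ∧ place F M B v R T s ≠ M T s := by
    intro s hs
    rcases hT : rootOf F s with _ | T
    · simp [configOf, hT] at hs
    · obtain ⟨h1, h2, h3⟩ := rootOf_spec hT
      simp only [configOf, hT, Option.elim_some] at hs
      refine ⟨T, h1, ?_, h3, fun h4 => hs (by rw [h4])⟩
      by_contra hRT
      rw [h.place_of_not_sub h1 hRT] at hs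
      exact hs rfl
  rcases (Finset.univ.filter fun s => configOf F (place F M B v R) s ≠ none ∧
    configOf F (place F M B v R) s ≠ configOf F M s).eq_empty_or_nonempty with h0 | ⟨s₀, hs₀⟩
  · rw [retrievals, h0]
    simp
  · obtain ⟨T, h1, h2, h3, -⟩ := key s₀ (Finset.mem_filter.1 hs₀).2.2
    refine le_trans (Finset.card_le_card fun s hs => ?_) (h.card_place_ne_le h1 h2)
    obtain ⟨T', h1', h2', h3', h4⟩ := key s (Finset.mem_filter.1 hs).2.2
    have hTT : T = T' := by
      obtain ⟨x, hx⟩ := h.nonempty R h.mem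
      by_contra hne
      rcases nested_of_mem h.laminar h1 h1' (h2 hx) (h2' hx) with h5 | h5
      · exact h3 T' h1' (Finset.ssubset_iff_subset_ne.2 ⟨h5, hne⟩)
      · exact h3' T h1 (Finset.ssubset_iff_subset_ne.2 ⟨h5, Ne.symm hne⟩)
    rw [Finset.mem_filter]
    exact ⟨Finset.mem_univ s, hTT ▸ h4⟩

/-! ### The algorithm -/

/-- The tokens of the requests within `S`. -/
def levelToks (S : Finset (Fin k)) (pre : List (Entry k)) : List (Tok k) :=
  (pre.filter fun e => decide (e.2 ⊆ S)).map Prod.fst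

/-- The tokens that must not be evicted from `S`, when `ord` determines the priorities. -/
def keep (ord : Finset (Fin k) → List (Tok k) → List (Tok k)) (pre : List (Entry k))
    (S : Finset (Fin k)) : List (Tok k) := basis (layers S pre) (ord S (levelToks S pre))

/-- The positions of the tokens after the given requests. -/
def positions (F : List (Finset (Fin k))) (ord : Finset (Fin k) → List (Tok k) → List (Tok k)) :
    List (Entry k) → Finset (Fin k) → Fin k → Option (Tok k)
  | [] => fun _ _ => none
  | e :: pre => place F (positions F ord pre) (keep ord (e :: pre)) e.1 e.2

/-- The number of requests within `S` to tokens that could be missing. -/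
def missCount (ord : Finset (Fin k) → List (Tok k) → List (Tok k)) (S : Finset (Fin k)) :
    List (Entry k) → ℕ
  | [] => 0
  | e :: pre => missCount ord S pre + if e.2 ⊆ S ∧ e.1 ∉ keep ord pre S then 1 else 0

/-- The total number of retrievals. -/
def totalCost (F : List (Finset (Fin k))) (ord : Finset (Fin k) → List (Tok k) → List (Tok k)) :
    List (Entry k) → ℕ
  | [] => 0
  | e :: pre => totalCost F ord pre +
      retrievals (configOf F (positions F ord pre)) (configOf F (positions F ord (e :: pre)))

/-- Priorities for which a request concerns only the requested token. -/
def GoodOrd (F : List (Finset (Fin k))) (ord : Finset (Fin k) → List (Tok k) → List (Tok k))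
    (full : List (Entry k)) : Prop :=
  ∀ S ∈ F, ∀ v l, v :: l <:+ levelToks S full → v ∈ ord S (v :: l) ∧
    ∀ T : List (List (Tok k)), T.flatten ⊆ l → v ∉ T.flatten →
      basis T (ord S (v :: l)) = basis T (ord S l)

theorem levelToks_cons_of_sub {S : Finset (Fin k)} {e : Entry k} (h : e.2 ⊆ S)
    (pre : List (Entry k)) : levelToks S (e :: pre) = e.1 :: levelToks S pre := by
  simp [levelToks, h]

theorem levelToks_cons_of_not_sub {S : Finset (Fin k)} {e : Entry k} (h : ¬ e.2 ⊆ S)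
    (pre : List (Entry k)) : levelToks S (e :: pre) = levelToks S pre := by
  simp [levelToks, h]

theorem flatten_layers_subset (S : Finset (Fin k)) (pre : List (Entry k)) :
    (layers S pre).flatten ⊆ levelToks S pre := by
  intro x hx
  obtain ⟨e, h1, rfl, h2⟩ := mem_layers hx
  exact List.mem_map_of_mem (List.mem_filter.2 ⟨h1, by simpa using h2⟩)

theorem GoodOrd.of_suffix {ord : Finset (Fin k) → List (Tok k) → List (Tok k)}
    {full pre : List (Entry k)} (h : GoodOrd F ord full) (hp : pre <:+ full) :
    GoodOrd F ord pre := fun S hS v l hl =>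
  h S hS v l (hl.trans ((hp.filter _).map _))

theorem keep_cons_of_not_sub (ord : Finset (Fin k) → List (Tok k) → List (Tok k))
    {S : Finset (Fin k)} {e : Entry k} (h : ¬ e.2 ⊆ S) (pre : List (Entry k)) :
    keep ord (e :: pre) S = keep ord pre S := by
  rw [keep, keep, layers_cons, if_neg h, levelToks_cons_of_not_sub h]

theorem GoodOrd.mem_keep {ord : Finset (Fin k) → List (Tok k) → List (Tok k)} {e : Entry k}
    {pre : List (Entry k)} (h : GoodOrd F ord (e :: pre)) {S : Finset (Fin k)} (hS : S ∈ F)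
    (he : e.2 ⊆ S) : e.1 ∈ keep ord (e :: pre) S := by
  have h1 := (h S hS e.1 (levelToks S pre)
    (by rw [levelToks_cons_of_sub he])).1
  rw [keep, layers_cons, if_pos he, levelToks_cons_of_sub he]
  exact mem_basis_reqLayers (nodup_layers S pre) h1

/-- With the requested token as the only new one in `keep`, all the others are already present in
the array by induction; `positions_spec` rests on this. -/
theorem GoodOrd.keep_subset {ord : Finset (Fin k) → List (Tok k) → List (Tok k)} {e : Entry k}
    {pre : List (Entry k)} (h : GoodOrd F ord (e :: pre)) {S : Finset (Fin k)} (hS : S ∈ F)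
    (he : e.2 ⊆ S) : keep ord (e :: pre) S ⊆ e.1 :: keep ord pre S := by
  have h1 := (h S hS e.1 (levelToks S pre)
    (by rw [levelToks_cons_of_sub he])).2
  rw [keep, layers_cons, if_pos he, levelToks_cons_of_sub he]
  exact basis_reqLayers_subset e.1 (nodup_layers S pre) fun T hT =>
    h1 T (List.Subset.trans hT (flatten_layers_subset S pre))

theorem reqInv_entry (hF : IsLaminar F) (hne : ∀ S ∈ F, S.Nonempty)
    {ord : Finset (Fin k) → List (Tok k) → List (Tok k)} {pre : List (Entry k)}
    (hpre : IsHistory F pre) {r : Request k} (hr : r.slots ∈ F)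
    (hord : GoodOrd F ord (entry pre r :: pre)) (hpos : PosInv F (positions F ord pre)) :
    ReqInv F (positions F ord pre) (keep ord (entry pre r :: pre)) (entry pre r).1
      (entry pre r).2 where
  toPosInv := hpos
  nonempty := hne
  laminar := hF
  mem := hr
  tok_sub := (hpre.isRep hF hne r.page).subset r.slots hr
  tok_nonempty := (hpre.isRep hF hne r.page).nonempty r.slots hr
  mem_keep := fun _ hS hRS => hord.mem_keep hS hRS
  card_keep := fun S hS _ => (length_basis_le _ _).trans (length_layers (hne S hS) _).le

/-- The invariant of the algorithm. -/
theorem positions_spec (hF : IsLaminar F) (hne : ∀ S ∈ F, S.Nonempty)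
    {ord : Finset (Fin k) → List (Tok k) → List (Tok k)} {pre : List (Entry k)}
    (hpre : IsHistory F pre) (hord : GoodOrd F ord pre) :
    PosInv F (positions F ord pre) ∧
      ∀ S ∈ F, ∀ x ∈ keep ord pre S, ∃ a, positions F ord pre S a = some x := by
  induction hpre with
  | nil =>
    refine ⟨⟨?_, ?_, ?_, ?_⟩, fun S _ x hx => ?_⟩
    · simp [positions]
    · simp [positions]
    · simp [positions]
    · simp [positions]
    · have := basis_subset_flatten _ _ hx
      simp [layers] at this
  | @cons pre r hpre hr ih =>
    obtain ⟨h1, h2⟩ := ih (hord.of_suffix (List.suffix_cons _ _))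
    have h3 := reqInv_entry hF hne hpre hr hord h1
    refine ⟨h3.posInv_place, fun S hS x hx => ?_⟩
    by_cases hRS : (entry pre r).2 ⊆ S
    · rcases List.mem_cons.1 (hord.keep_subset hS hRS hx) with rfl | hx'
      · obtain ⟨t, -, ht⟩ := h3.place_slot
        exact ⟨t, ht S hS hRS⟩
      · exact h3.place_keep hS hRS hx (h2 S hS x hx')
    · rw [keep_cons_of_not_sub ord hRS] at hx
      obtain ⟨a, ha⟩ := h2 S hS x hx
      exact ⟨a, by rw [positions, h3.place_of_not_sub hS hRS, ha]⟩

theorem satisfies_positions (hF : IsLaminar F) (hne : ∀ S ∈ F, S.Nonempty)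
    {ord : Finset (Fin k) → List (Tok k) → List (Tok k)} {pre : List (Entry k)}
    (hpre : IsHistory F pre) {r : Request k} (hr : r.slots ∈ F)
    (hord : GoodOrd F ord (entry pre r :: pre)) :
    (configOf F (positions F ord (entry pre r :: pre))).Satisfies r :=
  (reqInv_entry hF hne hpre hr hord
    (positions_spec hF hne hpre (hord.of_suffix (List.suffix_cons _ _))).1).satisfies

/-- The array of `S` holds all of `keep ord pre S`, so a set that lacks the requested token is
counted in `missCount`; each such fault costs at most three retrievals. -/
theorem totalCost_le (hF : IsLaminar F) (hne : ∀ S ∈ F, S.Nonempty)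
    {ord : Finset (Fin k) → List (Tok k) → List (Tok k)} {pre : List (Entry k)}
    (hpre : IsHistory F pre) (hord : GoodOrd F ord pre) :
    totalCost F ord pre ≤ 3 * ∑ S ∈ F.toFinset, missCount ord S pre := by
  induction hpre with
  | nil => simp [totalCost]
  | @cons pre r hpre hr ih =>
    have hord' := hord.of_suffix (List.suffix_cons _ _)
    obtain ⟨h1, h2⟩ := positions_spec hF hne hpre hord'
    have h3 := reqInv_entry hF hne hpre hr hord h1
    have h4 : faults F (positions F ord pre) (entry pre r).1 (entry pre r).2 ≤
        ∑ S ∈ F.toFinset, if (entry pre r).2 ⊆ S ∧ (entry pre r).1 ∉ keep ord pre S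
          then 1 else 0 := by
      rw [faults, ← Finset.card_filter]
      refine Finset.card_le_card fun S hS => ?_
      rw [Finset.mem_filter] at hS ⊢
      exact ⟨hS.1, hS.2.1, fun h => hS.2.2 (h2 S (List.mem_toFinset.1 hS.1) _ h)⟩
    have h5 := h3.retrievals_le
    have h6 := ih hord'
    simp only [totalCost, missCount, Finset.sum_add_distrib]
    rw [positions] at *
    omega

/-! ### Sequences of configurations -/

/-- The configurations at all times. -/
def configs (F : List (Finset (Fin k))) (ord : Finset (Fin k) → List (Tok k) → List (Tok k))
    (σ : List (Request k)) : List (Config k) :=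
  (List.range σ.length).map fun t => configOf F (positions F ord (entries (σ.take (t + 1))))

theorem configs_append (F : List (Finset (Fin k)))
    (ord : Finset (Fin k) → List (Tok k) → List (Tok k)) (σ : List (Request k)) (r : Request k) :
    configs F ord (σ ++ [r]) =
      configs F ord σ ++ [configOf F (positions F ord (entries (σ ++ [r])))] := by
  rw [configs, List.length_append, List.length_singleton, List.range_succ, List.map_append,
    List.map_singleton, List.take_of_length_le (by simp)]
  congr 1
  refine List.map_congr_left fun t ht => ?_
  rw [List.take_append_of_le_length (by have := List.mem_range.1 ht; omega)]

theorem costFrom_append (C : Config k) (Cs : List (Config k)) (C' : Config k) :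
    costFrom C (Cs ++ [C']) = costFrom C Cs + retrievals (Cs.getLast?.getD C) C' := by
  induction Cs generalizing C with
  | nil => simp [costFrom]
  | cons C₁ Cs ih =>
    rw [List.cons_append, costFrom, costFrom, ih, List.getLast?_cons]
    simp [add_assoc]

theorem cost_configs (F : List (Finset (Fin k)))
    (ord : Finset (Fin k) → List (Tok k) → List (Tok k)) (σ : List (Request k)) :
    cost (configs F ord σ) = totalCost F ord (entries σ) := by
  induction σ using List.reverseRecOn with
  | nil => rfl
  | append_singleton σ r ih =>
    have h0 : configOf F (positions F ord []) = fun _ => none := by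
      funext s
      rw [configOf]
      cases rootOf F s <;> rfl
    rw [configs_append, cost, costFrom_append, ← cost, ih, entries_append, totalCost]
    congr 2
    rcases List.eq_nil_or_concat σ with rfl | ⟨σ, r', rfl⟩
    · exact h0.symm
    · rw [List.concat_eq_append, configs_append]
      simp

theorem isSolution_configs (hF : IsLaminar F) (hne : ∀ S ∈ F, S.Nonempty)
    {ord : Finset (Fin k) → List (Tok k) → List (Tok k)} {σ : List (Request k)}
    (hm : ∀ r ∈ σ, r.slots ∈ F) (hord : GoodOrd F ord (entries σ)) :
    IsSolution σ (configs F ord σ) := by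
  induction σ using List.reverseRecOn with
  | nil => exact .nil
  | append_singleton σ r ih =>
    rw [configs_append]
    rw [entries_append] at hord ⊢
    have hm' : ∀ r' ∈ σ, r'.slots ∈ F := fun r' hr' => hm r' (by simp [hr'])
    refine List.rel_append (ih hm' (hord.of_suffix (List.suffix_cons _ _))) (.cons ?_ .nil)
    exact satisfies_positions hF hne (isHistory_entries σ hm') (hm r (by simp)) hord

end Cost

theorem loose_reqLayers_lt {V : Type*} [DecidableEq V] (v : V) {T : List (List V)}
    (hT : T ≠ []) : loose (reqLayers v T) < T.length := by
  have h1 := length_reqLayers v hT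
  rw [reqLayers, List.length_cons] at h1
  rw [reqLayers, loose, if_pos (List.length_singleton ..), ← h1]
  exact Nat.lt_succ_of_le (loose_le _)

theorem insertIdx_eq_take_append {V : Type*} (l : List V) (i : ℕ) (x : V) (h : i ≤ l.length) :
    l.insertIdx i x = l.take i ++ x :: l.drop i := by
  induction l generalizing i with
  | nil =>
    obtain rfl : i = 0 := by simpa using h
    rfl
  | cons y l ih =>
    cases i with
    | zero => rfl
    | succ i => simp [ih i (Nat.le_of_succ_le_succ h)]

/-! ### Miss counts of the three priority rules -/

section Totals

variable {k : ℕ} {F : List (Finset (Fin k))}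

/-! ### First come, first served -/

/-- Priorities by the time of the first request. -/
def detOrd (_ : Finset (Fin k)) (l : List (Tok k)) : List (Tok k) := l.reverse

theorem goodOrd_detOrd (full : List (Entry k)) : GoodOrd F detOrd full := by
  intro S _ v l _
  rw [detOrd, detOrd, List.reverse_cons]
  refine ⟨by simp, fun T _ hv => ?_⟩
  rw [basis_append_of_notMem hv, List.append_nil]

theorem layers_of_levelToks_eq_nil {S : Finset (Fin k)} {pre : List (Entry k)}
    (h : levelToks S pre = []) (ord : Finset (Fin k) → List (Tok k) → List (Tok k)) :
    missCount ord S pre = 0 := by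
  induction pre with
  | nil => rfl
  | cons e pre ih =>
    have he : ¬ e.2 ⊆ S := fun he => by
      rw [levelToks_cons_of_sub he] at h
      exact List.cons_ne_nil _ _ h
    rw [levelToks_cons_of_not_sub he] at h
    rw [missCount, ih h, if_neg fun h => he h.1]

theorem missCount_detOrd_add_loose_le {S : Finset (Fin k)} (hS : S.Nonempty)
    {pre : List (Entry k)} (h : levelToks S pre ≠ []) :
    missCount detOrd S pre + loose (layers S pre) ≤ S.card * newCount S pre := by
  induction pre with
  | nil => exact absurd rfl h
  | cons e pre ih =>
    rw [missCount, newCount, layers_cons]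
    by_cases he : e.2 ⊆ S
    -- The empty initial layers all count as loose, so the bound fails before the first request
    -- within `S`. This request is one miss and leaves fewer than `S.card` loose layers, which
    -- `S.card` pays for.
    · by_cases h0 : levelToks S pre = []
      · have hv : e.1 ∉ (layers S pre).flatten := fun hv => by
          have := flatten_layers_subset S pre hv
          simp [h0] at this
        have h1 := loose_reqLayers_lt e.1 (layers_ne_nil hS pre)
        rw [length_layers hS] at h1
        have h3 : (if e.2 ⊆ S ∧ e.1 ∉ keep detOrd pre S then 1 else 0) ≤ 1 := by
          split_ifs <;> omega
        have h4 : (if e.2 ⊆ S ∧ e.1 ∉ (layers S pre).flatten then 1 else 0) = 1 :=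
          if_pos ⟨he, hv⟩
        rw [layers_of_levelToks_eq_nil h0, if_pos he, h4, mul_add]
        omega
      · have h1 := loose_reqLayers (v := e.1) (nodup_layers S pre) (layers_ne_nil hS pre)
          (O := detOrd S (levelToks S pre)) fun x hx =>
            List.mem_reverse.2 (flatten_layers_subset S pre hx)
        have h2 := ih h0
        rw [length_layers hS] at h1
        rw [← keep] at h1
        simp only [he, true_and, if_true, mul_add]
        by_cases hv : e.1 ∈ (layers S pre).flatten <;> by_cases hk : e.1 ∈ keep detOrd pre S <;>
          simp only [hv, hk, if_true, if_false, not_true_eq_false, not_false_eq_true, mul_zero,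
            mul_one] at h1 ⊢ <;> omega
    · rw [levelToks_cons_of_not_sub he] at h
      rw [if_neg fun h => he h.1, if_neg he, if_neg fun h => he h.1]
      exact ih h

theorem missCount_detOrd_le {S : Finset (Fin k)} (hS : S.Nonempty) (pre : List (Entry k)) :
    missCount detOrd S pre ≤ S.card * newCount S pre := by
  by_cases h : levelToks S pre = []
  · rw [layers_of_levelToks_eq_nil h]
    exact Nat.zero_le _
  · exact (Nat.le_add_right _ _).trans (missCount_detOrd_add_loose_le hS h)

/-! ### Priorities by the future -/

/-- Priorities by the time of the next request. -/
def offOrd (full : List (Entry k)) (S : Finset (Fin k)) (l : List (Tok k)) : List (Tok k) :=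
  (levelToks S full).reverse.drop l.length ++ (levelToks S full).reverse

/-- In the chronological list, the part after the first `l.length` requests starts with `v`, the
next one. The complete list is appended in `offOrd` only to make every token occur in the order. -/
theorem offOrd_of_suffix {full : List (Entry k)} {S : Finset (Fin k)} {v : Tok k}
    {l : List (Tok k)} (h : v :: l <:+ levelToks S full) :
    offOrd full S l = v :: offOrd full S (v :: l) := by
  obtain ⟨t, ht⟩ := h
  have h1 : (levelToks S full).reverse = l.reverse ++ v :: t.reverse := by
    rw [← ht]
    simp
  rw [offOrd, offOrd, ← List.cons_append]
  congr 1
  rw [h1, List.length_cons, ← List.length_reverse (as := l), List.drop_left,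
    ← List.drop_drop, List.drop_left]
  rfl

theorem goodOrd_offOrd (full : List (Entry k)) : GoodOrd F (offOrd full) full := by
  intro S _ v l hl
  refine ⟨?_, fun T _ hv => ?_⟩
  · refine List.mem_append_right _ (List.mem_reverse.2 (hl.subset (List.mem_cons_self ..)))
  · rw [offOrd_of_suffix hl, basis, if_neg hv]

/-- The token requested next has the highest priority, so the greedy basis contains it whenever it
is in a layer. -/
theorem missCount_offOrd_le {S : Finset (Fin k)} {full pre : List (Entry k)} (h : pre <:+ full) :
    missCount (offOrd full) S pre ≤ newCount S pre := by
  induction pre with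
  | nil => exact le_rfl
  | cons e pre ih =>
    have h1 := ih ((List.suffix_cons _ _).trans h)
    rw [missCount, newCount]
    refine Nat.add_le_add h1 ?_
    by_cases he : e.2 ⊆ S
    · by_cases hv : e.1 ∈ (layers S pre).flatten
      · have h2 : e.1 :: levelToks S pre <:+ levelToks S full := by
          rw [← levelToks_cons_of_sub he]
          exact (h.filter _).map _
        have h3 : e.1 ∈ keep (offOrd full) pre S := by
          rw [keep, offOrd_of_suffix h2, basis, if_pos hv]
          exact List.mem_cons_self ..
        simp [hv, h3]
      · simp only [he, hv, not_false_eq_true, and_self, if_true]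
        split_ifs <;> omega
    · simp [he]

/-! ### Random priorities -/

/-- Priorities by random insertion. -/
def tapeOrd (ω : RandomTape) (_ : Finset (Fin k)) (l : List (Tok k)) : List (Tok k) :=
  randOrd ω l.dedup

theorem mem_randOrd {V : Type*} (ω : RandomTape) (l : List V) (x : V) :
    x ∈ randOrd ω l ↔ x ∈ l := by
  induction l with
  | nil => simp [randOrd]
  | cons y l ih =>
    rw [randOrd, List.mem_insertIdx, ih, List.mem_cons]
    rw [length_randOrd]
    exact Nat.le_of_lt_succ (ω (l.length, 0)).2

/-- A new token is inserted into the existing order, and a known one changes nothing since `dedup`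
drops its later request. So a single random order grows with time. -/
theorem goodOrd_tapeOrd (ω : RandomTape) (full : List (Entry k)) :
    GoodOrd F (tapeOrd ω) full := by
  intro S _ v l _
  refine ⟨(mem_randOrd ω _ v).2 (by simp), fun T _ hv => ?_⟩
  rw [tapeOrd, tapeOrd]
  by_cases h : v ∈ l
  · rw [List.dedup_cons_of_mem h]
  · rw [List.dedup_cons_of_notMem h, randOrd, insertIdx_eq_take_append,
      basis_append_of_notMem hv, List.take_append_drop]
    rw [length_randOrd]
    exact Nat.le_of_lt_succ (ω (l.dedup.length, 0)).2

theorem keep_congr {ord ord' : Finset (Fin k) → List (Tok k) → List (Tok k)} {n : ℕ}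
    (h : ∀ S l, l.length ≤ n → ord S l = ord' S l) {pre : List (Entry k)} (hp : pre.length ≤ n)
    (S : Finset (Fin k)) : keep ord pre S = keep ord' pre S := by
  rw [keep, keep, h]
  rw [levelToks, List.length_map]
  exact (List.length_filter_le _ _).trans hp

theorem missCount_congr {ord ord' : Finset (Fin k) → List (Tok k) → List (Tok k)} {n : ℕ}
    (h : ∀ S l, l.length ≤ n → ord S l = ord' S l) {pre : List (Entry k)} (hp : pre.length ≤ n)
    (S : Finset (Fin k)) : missCount ord S pre = missCount ord' S pre := by
  induction pre with
  | nil => rfl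
  | cons e pre ih =>
    have hp' : pre.length ≤ n := (Nat.le_succ _).trans hp
    rw [missCount, missCount, ih hp', keep_congr h hp']

theorem totalCost_congr {ord ord' : Finset (Fin k) → List (Tok k) → List (Tok k)} {n : ℕ}
    (h : ∀ S l, l.length ≤ n → ord S l = ord' S l) {pre : List (Entry k)} (hp : pre.length ≤ n) :
    positions F ord pre = positions F ord' pre ∧ totalCost F ord pre = totalCost F ord' pre := by
  induction pre with
  | nil => exact ⟨rfl, rfl⟩
  | cons e pre ih =>
    have hp' : pre.length ≤ n := (Nat.le_succ _).trans hp
    obtain ⟨h1, h2⟩ := ih hp'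
    have h3 : keep ord (e :: pre) = keep ord' (e :: pre) := funext fun S => keep_congr h hp S
    have h4 : positions F ord (e :: pre) = positions F ord' (e :: pre) := by
      rw [positions, positions, h1, h3]
    exact ⟨h4, by rw [totalCost, totalCost, h1, h2, h4]⟩

theorem tapeOrd_congr {n : ℕ} {ω ω' : RandomTape}
    (h : ∀ q ∈ (insCoords n : Set (ℕ × ℕ)), ω q = ω' q) (S : Finset (Fin k)) (l : List (Tok k))
    (hl : l.length ≤ n) : tapeOrd ω S l = tapeOrd ω' S l := by
  refine dependsOn_randOrd l.dedup fun q hq => h q ?_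
  have h1 := mem_insCoords.1 (Finset.mem_coe.1 hq)
  have h2 := (List.dedup_sublist l).length_le
  exact Finset.mem_coe.2 (mem_insCoords.2 ⟨by omega, h1.2⟩)

open MeasureTheory

theorem integrable_totalCost (F : List (Finset (Fin k))) (pre : List (Entry k)) :
    Integrable (fun ω => (totalCost F (tapeOrd ω) pre : ℝ)) tapeMeasure :=
  integrable_of_dependsOn (s := insCoords pre.length) fun ω ω' h => by
    simp only [(totalCost_congr (F := F) (tapeOrd_congr h) le_rfl).2]

theorem integrable_missCount (S : Finset (Fin k)) (pre : List (Entry k)) :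
    Integrable (fun ω => (missCount (tapeOrd ω) S pre : ℝ)) tapeMeasure :=
  integrable_of_dependsOn (s := insCoords pre.length) fun ω ω' h => by
    simp only [missCount_congr (tapeOrd_congr h) le_rfl]

/-- The layers do not depend on the tape, so at each time the probability of a miss is `missProb` of
the present layers. The expectations are added by linearity; no independence between different times
is needed. -/
theorem integral_missCount_add_pot_le {S : Finset (Fin k)} (hS : S.Nonempty)
    (pre : List (Entry k)) : ∫ ω, (missCount (tapeOrd ω) S pre : ℝ) ∂tapeMeasure +
      pot S.card (layers S pre) ≤ ((harmonic S.card : ℚ) : ℝ) * newCount S pre := by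
  obtain ⟨n, hn⟩ : ∃ n, S.card = n + 1 := ⟨S.card - 1, by have := Finset.card_pos.2 hS; omega⟩
  induction pre with
  | nil =>
    simp only [missCount, newCount, Nat.cast_zero, integral_zero, mul_zero, zero_add]
    rw [pot_of_flatten_eq_nil (by simp [layers])]
  | cons e pre ih =>
    by_cases he : e.2 ⊆ S
    · have h1 := missProb_add_pot_reqLayers_le (v := e.1) (nodup_layers S pre)
        ((length_layers hS pre).trans hn)
      have h2 : ∫ ω, ((if e.2 ⊆ S ∧ e.1 ∉ keep (tapeOrd ω) pre S then 1 else 0 : ℕ) : ℝ)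
          ∂tapeMeasure = missProb (n + 1) e.1 (layers S pre) := by
        rw [← insMean_notMem_basis (List.nodup_dedup (levelToks S pre)) (nodup_layers S pre)
          ((length_layers hS pre).trans hn) fun x hx =>
            List.mem_dedup.2 (flatten_layers_subset S pre hx), ← integral_randOrd]
        refine integral_congr_ae (Filter.Eventually.of_forall fun ω => ?_)
        simp only [he, true_and, keep, tapeOrd, ite_not]
        by_cases hv : e.1 ∈ basis (layers S pre) (randOrd ω (levelToks S pre).dedup) <;> simp [hv]
      have h3 : Integrable (fun ω =>
          ((if e.2 ⊆ S ∧ e.1 ∉ keep (tapeOrd ω) pre S then 1 else 0 : ℕ) : ℝ)) tapeMeasure :=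
        integrable_of_dependsOn (s := insCoords pre.length) fun ω ω' h => by
          simp only [keep_congr (tapeOrd_congr h) (le_refl pre.length)]
      simp only [missCount, Nat.cast_add, newCount]
      rw [integral_add (integrable_missCount S pre) h3, h2, layers_cons, if_pos he, hn, mul_add]
      rw [hn] at ih
      have h4 : ((if e.2 ⊆ S ∧ e.1 ∉ (layers S pre).flatten then 1 else 0 : ℕ) : ℝ) =
          if e.1 ∈ (layers S pre).flatten then 0 else 1 := by
        by_cases hv : e.1 ∈ (layers S pre).flatten <;> simp [he, hv]
      rw [h4]
      by_cases hv : e.1 ∈ (layers S pre).flatten <;>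
        simp only [hv, if_true, if_false] at h1 ⊢ <;> linarith
    · simp only [missCount, newCount, he, false_and, if_false, add_zero, layers_cons]
      exact ih

theorem integral_missCount_le {S : Finset (Fin k)} (hS : S.Nonempty) (pre : List (Entry k)) :
    ∫ ω, (missCount (tapeOrd ω) S pre : ℝ) ∂tapeMeasure ≤
      ((harmonic S.card : ℚ) : ℝ) * newCount S pre := by
  have h1 := integral_missCount_add_pot_le hS pre
  have h2 := pot_nonneg (n := S.card) (nodup_layers S pre)
  linarith

/-! ### Competitive ratios -/

theorem sum_missCount_le {σ : List (Request k)} (h : IsInstance F σ) {m : Finset (Fin k) → ℝ}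
    {c : ℝ} (hm : ∀ S ∈ F, m S ≤ c * newCount S (entries σ)) (hc : 0 ≤ c) :
    3 * ∑ S ∈ F.toFinset, m S ≤ 3 * (height F : ℝ) ^ 2 * c * opt σ := by
  have h1 : (∑ S ∈ F.toFinset, (newCount S (entries σ) : ℝ)) ≤
      height F * (height F * opt σ) := by exact_mod_cast sum_newCount_le h
  have h2 : ∑ S ∈ F.toFinset, m S ≤ c * ∑ S ∈ F.toFinset, (newCount S (entries σ) : ℝ) := by
    rw [Finset.mul_sum]
    exact Finset.sum_le_sum fun S hS => hm S (List.mem_toFinset.1 hS)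
  have h3 := mul_le_mul_of_nonneg_left h1 hc
  calc 3 * ∑ S ∈ F.toFinset, m S ≤ 3 * (c * (height F * (height F * opt σ))) := by linarith
    _ = 3 * (height F : ℝ) ^ 2 * c * opt σ := by ring

theorem cost_configs_le {σ : List (Request k)} (h : IsInstance F σ)
    {ord : Finset (Fin k) → List (Tok k) → List (Tok k)} (hord : GoodOrd F ord (entries σ))
    {c : ℕ} (hm : ∀ S ∈ F, missCount ord S (entries σ) ≤ c * newCount S (entries σ)) :
    (cost (configs F ord σ) : ℝ) ≤ 3 * (height F : ℝ) ^ 2 * c * opt σ := by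
  have h1 := totalCost_le h.laminar h.nonempty (isHistory_entries σ h.mem) hord
  rw [cost_configs]
  have h2 := sum_missCount_le h (m := fun S => missCount ord S (entries σ))
    (fun S hS => by exact_mod_cast hm S hS) (Nat.cast_nonneg c)
  exact le_trans (by exact_mod_cast h1) h2

theorem cost_detOrd_le {σ : List (Request k)} (h : IsInstance F σ) :
    (cost (configs F detOrd σ) : ℝ) ≤ 3 * (height F : ℝ) ^ 2 * k * opt σ := by
  refine cost_configs_le h (goodOrd_detOrd _) fun S hS => ?_
  refine (missCount_detOrd_le (h.nonempty S hS) _).trans (Nat.mul_le_mul_right _ ?_)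
  exact (Finset.card_le_univ S).trans (Fintype.card_fin k).le

theorem cost_offOrd_le {σ : List (Request k)} (h : IsInstance F σ) :
    (cost (configs F (offOrd (entries σ)) σ) : ℝ) ≤ 3 * (height F : ℝ) ^ 2 * opt σ := by
  have := cost_configs_le h (goodOrd_offOrd _) (c := 1) fun S hS => by
    rw [one_mul]
    exact missCount_offOrd_le List.suffix_rfl
  simpa using this

theorem harmonic_mono {m n : ℕ} (h : m ≤ n) : harmonic m ≤ harmonic n := by
  rw [harmonic, harmonic]
  refine Finset.sum_le_sum_of_subset_of_nonneg (Finset.range_subset_range.2 h) fun i _ _ => ?_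
  positivity

theorem integral_cost_tapeOrd_le {σ : List (Request k)} (h : IsInstance F σ) :
    Integrable (fun ω => (cost (configs F (tapeOrd ω) σ) : ℝ)) tapeMeasure ∧
      ∫ ω, (cost (configs F (tapeOrd ω) σ) : ℝ) ∂tapeMeasure ≤
        3 * (height F : ℝ) ^ 2 * ((harmonic k : ℚ) : ℝ) * opt σ := by
  simp only [cost_configs]
  refine ⟨integrable_totalCost F _, ?_⟩
  have h0 : ((0 : ℚ) : ℝ) ≤ ((harmonic k : ℚ) : ℝ) := by
    have := harmonic_mono (Nat.zero_le k)
    rw [harmonic_zero] at this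
    exact_mod_cast this
  rw [Rat.cast_zero] at h0
  refine le_trans ?_ (sum_missCount_le h
    (m := fun S => ∫ ω, (missCount (tapeOrd ω) S (entries σ) : ℝ) ∂tapeMeasure) (fun S hS => ?_)
    h0)
  · rw [← integral_finsetSum _ fun S _ => integrable_missCount S _, ← integral_const_mul]
    refine integral_mono (integrable_totalCost F _)
      ((integrable_finsetSum _ fun S _ => integrable_missCount S _).const_mul 3) fun ω => ?_
    have := totalCost_le h.laminar h.nonempty (isHistory_entries σ h.mem) (goodOrd_tapeOrd ω _)
    simp only
    exact_mod_cast this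
  · refine (integral_missCount_le (h.nonempty S hS) _).trans ?_
    refine mul_le_mul_of_nonneg_right ?_ (Nat.cast_nonneg _)
    exact_mod_cast harmonic_mono ((Finset.card_le_univ S).trans (Fintype.card_fin k).le)

end Totals

/-! ### Encodings -/

/-- Tokens. -/
def encTok {k : ℕ} (v : Tok k) : Data := .cons (encPage v.1) (encSlots v.2)

/-- Entries. -/
def encEntry {k : ℕ} (e : Entry k) : Data := .cons (encTok e.1) (encSlots e.2)

/-- Lists of tokens. -/
def encToks {k : ℕ} (l : List (Tok k)) : Data := encList (l.map encTok)

/-- Lists of entries. -/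
def encEntries {k : ℕ} (l : List (Entry k)) : Data := encList (l.map encEntry)

theorem encBool_injective : Function.Injective encBool := by
  intro a b h
  cases a <;> cases b <;> simp_all [encBool]

theorem encPage_injective : Function.Injective encPage := by
  intro p q h
  have h1 := List.map_injective_iff.2 encBool_injective (encList_injective h)
  have h2 := Nat.digits_two_eq_bits p
  rw [h1, ← Nat.digits_two_eq_bits] at h2
  exact Nat.digits_inj_iff.1 h2

theorem encSlots_injective {k : ℕ} : Function.Injective (encSlots (k := k)) := by
  intro S T h
  have h1 := List.map_inj_left.1 (encList_injective h)
  ext s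
  have h2 := encBool_injective (h1 s (List.mem_finRange s))
  simpa using h2

theorem encTok_injective {k : ℕ} : Function.Injective (encTok (k := k)) := by
  intro v w h
  simp only [encTok, Data.cons.injEq] at h
  exact Prod.ext (encPage_injective h.1) (encSlots_injective h.2)

theorem encOpt_injective {A : Type*} {f : A → Data} (hf : Function.Injective f) :
    Function.Injective (encOpt f) := by
  intro a b h
  cases a <;> cases b <;> simp_all [encOpt]
  exact hf h

theorem encUnary_injective : Function.Injective encUnary := by
  intro m n h
  have := size_encUnary m
  rw [h, size_encUnary] at this
  omega

theorem size_encSlots_le {k : ℕ} (S : Finset (Fin k)) : (encSlots S).size ≤ 4 * k + 1 := by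
  have h := size_encList_le_of_forall
    (l := (List.finRange k).map fun s => encBool (decide (s ∈ S))) (m := 3) (by
      intro x hx
      obtain ⟨s, -, rfl⟩ := List.mem_map.1 hx
      cases decide (s ∈ S) <;> simp [encBool, Data.size])
  rw [List.length_map, List.length_finRange] at h
  rw [encSlots]
  omega

namespace Comp

section Binders

variable {X : Type*} {e d : X → Data} {A B : X → Type*} {ea : ∀ x, A x → Data}
  {eb : ∀ x, B x → Data} {l : ∀ x, List (A x)}

/-- What can be computed from the environment can be computed under a binder. -/
theorem up {a : (Σ x, A x) → Data} (h : Comp e d) :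
    Comp (fun y : Σ x, A x => .cons (e y.1) (a y)) fun y => d y.1 :=
  h.weak Sigma.fst _

/-- The same for the two binders of a fold. -/
theorem upStep {b a : (Σ x, A x) → Data} (h : Comp e d) :
    Comp (fun y : Σ x, A x => .cons (.cons (e y.1) (b y)) (a y)) fun y => d y.1 :=
  (hd (refl _)).hd.trans (h.reindex Sigma.fst)

theorem elt {e a : X → Data} : Comp (fun y => .cons (e y) (a y)) a := last _ _

theorem acc {e b a : X → Data} : Comp (fun y => .cons (.cons (e y) (b y)) (a y)) b :=
  (hd (refl _)).tl

theorem of_bool {b : X → Bool} {p : X → Prop} [DecidablePred p]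
    (h : Comp e fun x => encBool (b x)) (hb : ∀ x, b x = true ↔ p x) :
    Comp e fun x => encBool (decide (p x)) :=
  h.congr fun x => by
    congr 1
    rw [Bool.eq_iff_iff, hb, decide_eq_true_eq]

theorem filterMap {C : X → Type*} {ec : ∀ x, C x → Data} {f : ∀ x, A x → Option (C x)}
    (hl : Comp e fun x => encList ((l x).map (ea x)))
    (hf : Comp (X := Σ x, A x) (fun y => .cons (e y.1) (ea _ y.2))
      fun y => encOpt (ec y.1) (f y.1 y.2)) :
    Comp e fun x => encList (((l x).filterMap (f x)).map (ec x)) := by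
  obtain ⟨p, hp⟩ := hl.size_le
  obtain ⟨r, hr⟩ := hf.size_le
  have := foldr_growth (eb := fun x (b : List (C x)) => encList (b.map (ec x)))
    (b0 := fun _ => []) (step := fun x a b => (f x a).elim b (· :: b))
    (r.comp (Polynomial.X + p + 1) + 1) hl (nil e) ?_ ?_
  · refine this.congr fun x => ?_
    congr 2
    induction l x with
    | nil => rfl
    | cons a t ih =>
      rw [List.foldr_cons, ih, List.filterMap_cons]
      cases f x a <;> rfl
  · have h := hf.reindex (Y := Σ x, List (C x) × A x) fun y => ⟨y.1, y.2.2⟩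
    have h' : Comp (fun y : Σ x, List (C x) × A x => Data.cons (.cons (e y.1)
        (encList (y.2.1.map (ec y.1)))) (ea y.1 y.2.2)) fun y => encOpt (ec y.1) (f y.1 y.2.2) :=
      ((hd (refl _)).hd.pair (last _ _)).trans h
    refine (h'.option acc (g := fun y c => .cons (ec y.1 c) (encList (y.2.1.map (ec y.1))))
      (elt.pair ((hd (refl _)).hd.tl))).congr ?_
    intro y
    cases f y.1 y.2.2 <;> rfl
  · intro x a ha b
    have h1 := size_le_encList (List.mem_map_of_mem (f := ea x) ha)
    have h2 := hp x
    have h3 := hr ⟨x, a⟩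
    have h4 := poly_mono r (m := (Data.cons (e x) (ea x a)).size)
      (n := (e x).size + p.eval (e x).size + 1) (by simp only [Data.size]; omega)
    cases hfa : f x a with
    | none =>
      simp only [Option.elim_none]
      omega
    | some c =>
      simp only [hfa, encOpt, Option.elim_some, encList, List.map_cons, Data.size,
        Polynomial.eval_add, Polynomial.eval_comp, Polynomial.eval_X, Polynomial.eval_one] at *
      omega

theorem flatten {l : ∀ x, List (List (A x))}
    (hl : Comp e fun x => encList ((l x).map fun t => encList (t.map (ea x)))) :
    Comp e fun x => encList ((l x).flatten.map (ea x)) := by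
  obtain ⟨p, hp⟩ := hl.size_le
  have := foldr_growth (A := fun x => List (A x)) (ea := fun x t => encList (t.map (ea x)))
    (eb := fun x (b : List (A x)) => encList (b.map (ea x)))
    (b0 := fun _ => []) (step := fun x a b => a ++ b) p hl (nil e)
    (append (l₁ := fun y : Σ x, List (A x) × List (A x) => y.2.2) (l₂ := fun y => y.2.1) elt acc) ?_
  · refine this.congr fun x => ?_
    congr 2
    induction l x with
    | nil => rfl
    | cons a t ih => rw [List.foldr_cons, ih, List.flatten_cons]
  · intro x a ha b
    have h1 := size_le_encList (List.mem_map_of_mem (f := fun t => encList (t.map (ea x))) ha)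
    have h2 := hp x
    have h3 := size_encList_append (a.map (ea x)) (b.map (ea x))
    rw [List.map_append]
    omega

theorem length (hl : Comp e fun x => encList ((l x).map (ea x))) :
    Comp e fun x => encUnary (l x).length :=
  (hl.map (g := fun _ _ => Data.nil) (nil _)).congr fun x => by
    rw [encUnary, List.map_const']

theorem drop {n : X → ℕ} (hn : Comp e fun x => encUnary (n x))
    (hl : Comp e fun x => encList ((l x).map (ea x))) :
    Comp e fun x => encList (((l x).drop (n x)).map (ea x)) :=
  (hn.tail_iterate hl).congr fun x => by rw [tail_iterate_encList, List.map_drop]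

theorem take {n : X → ℕ} (hn : Comp e fun x => encUnary (n x))
    (hl : Comp e fun x => encList ((l x).map (ea x))) :
    Comp e fun x => encList (((l x).take (n x)).map (ea x)) := by
  have h1 : Comp e fun x => encUnary ((l x).length - n x) :=
    (hn.tail_iterate hl.length).congr fun x => by
      rw [encUnary, tail_iterate_encList, List.drop_replicate, encUnary]
  -- A prefix is obtained by dropping `length - n` elements from the reversed list.
  refine (h1.drop hl.reverse).reverse.congr fun x => ?_
  congr 2
  rw [List.reverse_drop]
  simp only [List.length_reverse, List.reverse_reverse]
  by_cases h : n x ≤ (l x).length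
  · rw [Nat.sub_sub_self h]
  · rw [List.take_of_length_le (by omega), List.take_of_length_le (by omega)]

theorem takeWhile {p : ∀ x, A x → Bool} (hl : Comp e fun x => encList ((l x).map (ea x)))
    (hp : Comp (X := Σ x, A x) (fun y => .cons (e y.1) (ea _ y.2)) fun y => encBool (p y.1 y.2)) :
    Comp e fun x => encList (((l x).takeWhile (p x)).map (ea x)) := by
  obtain ⟨q, hq⟩ := hl.size_le
  have := foldr_growth (eb := fun x (b : List (A x)) => encList (b.map (ea x)))
    (b0 := fun _ => []) (step := fun x a b => if p x a = true then a :: b else []) (q + 1) hl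
    (nil e) ?_ ?_
  · refine this.congr fun x => ?_
    congr 2
    induction l x with
    | nil => rfl
    | cons a t ih =>
      rw [List.foldr_cons, ih, List.takeWhile_cons]
  · have h := hp.reindex (Y := Σ x, List (A x) × A x) fun y => ⟨y.1, y.2.2⟩
    have h' : Comp (fun y : Σ x, List (A x) × A x => Data.cons (.cons (e y.1)
        (encList (y.2.1.map (ea y.1)))) (ea y.1 y.2.2)) fun y => encBool (p y.1 y.2.2) :=
      ((hd (refl _)).hd.pair (last _ _)).trans h
    refine (ite h' ((last _ _).pair (hd (refl _)).tl) (nil _)).congr ?_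
    intro y
    split_ifs <;> rfl
  · intro x a ha b
    have h1 := size_le_encList (List.mem_map_of_mem (f := ea x) ha)
    have h2 := hq x
    simp only [Polynomial.eval_add, Polynomial.eval_one]
    split_ifs
    · simp only [encList, List.map_cons, Data.size]
      omega
    · simp only [encList, List.map_nil, Data.size]
      omega

theorem dropWhile {p : ∀ x, A x → Bool} (hl : Comp e fun x => encList ((l x).map (ea x)))
    (hp : Comp (X := Σ x, A x) (fun y => .cons (e y.1) (ea _ y.2)) fun y => encBool (p y.1 y.2)) :
    Comp e fun x => encList (((l x).dropWhile (p x)).map (ea x)) := by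
  refine ((hl.takeWhile hp).length.drop hl).congr fun x => ?_
  congr 2
  induction l x with
  | nil => rfl
  | cons a t ih =>
    rw [List.takeWhile_cons, List.dropWhile_cons]
    split_ifs
    · exact ih
    · rfl

end Binders

section Sets

variable {X : Type*} {e : X → Data} {k : X → ℕ} {S T : ∀ x, Finset (Fin (k x))}

theorem memSlots {s : ∀ x, Fin (k x)} (hS : Comp e fun x => encSlots (S x))
    (hs : Comp e fun x => encUnary (s x)) : Comp e fun x => encBool (decide (s x ∈ S x)) :=
  get (g := fun x s => encBool (decide (s ∈ S x))) hS hs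

theorem subset (hk : Comp e fun x => encUnary (k x)) (hS : Comp e fun x => encSlots (S x))
    (hT : Comp e fun x => encSlots (T x)) : Comp e fun x => encBool (decide (S x ⊆ T x)) :=
  of_bool (all (p := fun x s => !(decide (s ∈ S x) && !decide (s ∈ T x))) (slots hk)
    (not (and (memSlots hS.up elt) (not (memSlots hT.up elt))))) fun x => by
      simp [Finset.subset_iff, imp_iff_not_or]

theorem ssubset (hk : Comp e fun x => encUnary (k x)) (hS : Comp e fun x => encSlots (S x))
    (hT : Comp e fun x => encSlots (T x)) : Comp e fun x => encBool (decide (S x ⊂ T x)) :=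
  of_bool (and (subset hk hS hT) (not (subset hk hT hS))) fun x => by
    rw [Bool.and_eq_true, Bool.not_eq_true', decide_eq_true_eq, decide_eq_false_iff_not]
    rfl

end Sets

end Comp

/-! ### Programs for the operations on layers -/

section Layers

set_option linter.unusedSectionVars false

variable {V : Type*} [DecidableEq V]

/-- The encoding of a list of lists. -/
def encLists {V : Type*} (f : V → Data) (T : List (List V)) : Data :=
  encList (T.map fun t => encList (t.map f))

theorem truncLayers_eq (T : List (List V)) : truncLayers T = pushLayer (T.headD []) T.tail := by
  cases T <;> rfl

/-- The recursion is replaced by a search for the layer of `z`, for which there are programs. -/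
theorem contract_eq (z : V) (T : List (List V)) : contract z T =
    T.takeWhile (fun t => !decide (z ∈ t)) ++
      pushLayer (((T.dropWhile fun t => !decide (z ∈ t)).headD []).filter fun a => !decide (a = z))
        (T.dropWhile fun t => !decide (z ∈ t)).tail := by
  induction T with
  | nil => rfl
  | cons A T ih =>
    rw [contract, List.takeWhile_cons, List.dropWhile_cons]
    by_cases h : z ∈ A
    · simp [h]
    · simpa [h] using ih

/-- The layers change during the greedy choice, so the accumulator carries them along with the
chosen pages. -/
theorem basis_eq_foldl (T : List (List V)) (O : List V) : basis T O =
    (O.foldl (fun st z => if z ∈ st.1.flatten then (contract z st.1, z :: st.2) else st)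
      (T, ([] : List V))).2.reverse := by
  suffices H : ∀ (T : List (List V)) (B : List V), (O.foldl (fun st z =>
      if z ∈ st.1.flatten then (contract z st.1, z :: st.2) else st) (T, B)).2.reverse =
        B.reverse ++ basis T O by
    simpa using (H T []).symm
  induction O with
  | nil => simp [basis]
  | cons z O ih =>
    intro T B
    rw [List.foldl_cons, basis]
    split_ifs with h
    · rw [ih]
      simp
    · rw [ih]

variable {f : V → Data}

theorem size_pushLayer_le (A : List V) (T : List (List V)) :
    (encLists f (pushLayer A T)).size ≤ (encList (A.map f)).size + (encLists f T).size := by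
  cases T with
  | nil => simp [pushLayer]
  | cons B T =>
    have := size_encList_append (A.map f) (B.map f)
    simp only [encLists, pushLayer, List.map_cons, encList, Data.size, List.map_append]
    omega

theorem size_truncLayers_le (T : List (List V)) :
    (encLists f (truncLayers T)).size ≤ (encLists f T).size := by
  cases T with
  | nil => rfl
  | cons A T =>
    refine (size_pushLayer_le A T).trans ?_
    simp only [encLists, List.map_cons, encList, Data.size]
    omega

theorem size_encList_filter_le (p : V → Bool) (l : List V) :
    (encList ((l.filter p).map f)).size ≤ (encList (l.map f)).size := by
  induction l with
  | nil => rfl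
  | cons a l ih =>
    rw [List.filter_cons]
    split_ifs <;> simp only [List.map_cons, encList, Data.size] <;> omega

theorem size_contract_le (z : V) (T : List (List V)) :
    (encLists f (contract z T)).size ≤ (encLists f T).size := by
  induction T with
  | nil => rfl
  | cons A T ih =>
    rw [contract]
    split_ifs with h
    · refine (size_pushLayer_le _ T).trans ?_
      have := size_encList_filter_le (f := f) (fun a => decide (a ≠ z)) A
      simp only [encLists, List.map_cons, encList, Data.size] at *
      omega
    · simp only [encLists, List.map_cons, encList, Data.size] at *
      omega

theorem size_reqLayers_le (v : V) (T : List (List V)) :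
    (encLists f (reqLayers v T)).size ≤ (encLists f T).size + ((f v).size + 3) := by
  have h1 := size_contract_le (f := f) v T
  have h2 := size_truncLayers_le (f := f) T
  rw [reqLayers]
  split_ifs <;>
  · simp only [encLists, List.map_cons, encList, Data.size, List.map_nil] at *
    omega

end Layers

namespace Comp

section Layers

set_option linter.unusedSectionVars false

variable {X : Type*} {e : X → Data} {A : X → Type*} [∀ x, DecidableEq (A x)]
  {ea : ∀ x, A x → Data} {v w : ∀ x, A x} {l : ∀ x, List (A x)} {T : ∀ x, List (List (A x))}

theorem eq_of_injective (hea : ∀ x, Function.Injective (ea x)) (hv : Comp e fun x => ea x (v x))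
    (hw : Comp e fun x => ea x (w x)) : Comp e fun x => encBool (decide (v x = w x)) :=
  eq hv hw fun x => (hea x).eq_iff

theorem mem (hea : ∀ x, Function.Injective (ea x)) (hv : Comp e fun x => ea x (v x))
    (hl : Comp e fun x => encList ((l x).map (ea x))) :
    Comp e fun x => encBool (decide (v x ∈ l x)) :=
  of_bool (any (p := fun x a => decide (a = v x)) hl
    (eq_of_injective (fun y => hea y.1) elt hv.up)) fun x => by simp

theorem headD (hT : Comp e fun x => encLists (ea x) (T x)) :
    Comp e fun x => encList (((T x).headD []).map (ea x)) :=
  hT.hd.congr fun x => by cases T x <;> rfl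

theorem tail (hl : Comp e fun x => encList ((l x).map (ea x))) :
    Comp e fun x => encList ((l x).tail.map (ea x)) :=
  hl.tl.congr fun x => by cases l x <;> rfl

theorem pushLayer (hl : Comp e fun x => encList ((l x).map (ea x)))
    (hT : Comp e fun x => encLists (ea x) (T x)) :
    Comp e fun x => encLists (ea x) (pushLayer (l x) (T x)) := by
  refine (ite' (p := fun x => T x ≠ []) hT (fun x => by rw [encLists, encList_ne_nil]; simp)
    ((append hl hT.headD).pair hT.tl) (nil e)).congr fun x => ?_
  cases T x <;> rfl

theorem truncLayers (hT : Comp e fun x => encLists (ea x) (T x)) :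
    Comp e fun x => encLists (ea x) (truncLayers (T x)) :=
  (pushLayer hT.headD (T := fun x => (T x).tail) (tail hT)).congr fun x => by rw [truncLayers_eq]

theorem contract (hea : ∀ x, Function.Injective (ea x)) (hv : Comp e fun x => ea x (v x))
    (hT : Comp e fun x => encLists (ea x) (T x)) :
    Comp e fun x => encLists (ea x) (contract (v x) (T x)) := by
  have hp : Comp (X := Σ x, List (A x)) (fun y => .cons (e y.1) (encList (y.2.map (ea y.1))))
      fun y => encBool (!decide (v y.1 ∈ y.2)) :=
    (mem (fun y => hea y.1) hv.up elt).not
  have hD : Comp e fun x => encLists (ea x) ((T x).dropWhile fun t => !decide (v x ∈ t)) :=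
    dropWhile hT hp
  exact (append (A := fun x => List (A x)) (takeWhile hT hp) (pushLayer (filter hD.headD
    (eq_of_injective (fun y => hea y.1) elt hv.up).not)
      (T := fun x => ((T x).dropWhile fun t => !decide (v x ∈ t)).tail)
      (tail (A := fun x => List (A x)) hD))).congr fun x => by
    rw [contract_eq, encLists]

theorem reqLayers (hea : ∀ x, Function.Injective (ea x)) (hv : Comp e fun x => ea x (v x))
    (hT : Comp e fun x => encLists (ea x) (T x)) :
    Comp e fun x => encLists (ea x) (reqLayers (v x) (T x)) :=
  ((hv.pair (nil e)).pair (ite_prop (mem hea hv (flatten hT)) (contract hea hv hT)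
    (truncLayers hT))).congr fun x => by
      rw [SlotPaging.reqLayers]
      split_ifs <;> rfl

theorem basis (hea : ∀ x, Function.Injective (ea x)) (hT : Comp e fun x => encLists (ea x) (T x))
    (hl : Comp e fun x => encList ((l x).map (ea x))) :
    Comp e fun x => encList ((basis (T x) (l x)).map (ea x)) := by
  obtain ⟨p, hp⟩ := hl.size_le
  have := foldl_growth (B := fun x => List (List (A x)) × List (A x))
    (eb := fun x st => .cons (encLists (ea x) st.1) (encList (st.2.map (ea x))))
    (b0 := fun x => (T x, []))
    (step := fun x st z => if z ∈ st.1.flatten then (SlotPaging.contract z st.1, z :: st.2) else st)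
    p hl (hT.pair (nil e)) ?_ ?_
  · refine (reverse this.tl).congr fun x => ?_
    rw [basis_eq_foldl]
  · have h1 : Comp (X := Σ x, (List (List (A x)) × List (A x)) × A x)
        (fun y => .cons (.cons (e y.1) (.cons (encLists (ea y.1) y.2.1.1)
          (encList (y.2.1.2.map (ea y.1))))) (ea y.1 y.2.2)) fun y => encLists (ea y.1) y.2.1.1 :=
      acc.hd
    refine (ite_prop (mem (fun y => hea y.1) elt (flatten h1))
      ((contract (fun y => hea y.1) elt h1).pair (elt.pair acc.tl)) acc).congr fun y => ?_
    split_ifs <;> rfl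
  · intro x z hz st
    have h1 := size_contract_le (f := ea x) z st.1
    have h2 := hp x
    have h3 := size_le_encList (List.mem_map_of_mem (f := ea x) hz)
    split_ifs
    · simp only [Data.size, List.map_cons, encList]
      omega
    · omega

end Layers

end Comp

/-! ### Programs for the paging algorithm -/

/-- The contents of the slots. -/
def encArr {k : ℕ} (m : Fin k → Option (Tok k)) : Data :=
  encList ((List.finRange k).map fun s => encOpt encTok (m s))

/-- The contents of the slots for each member of the family. -/
def encPos {k : ℕ} (F : List (Finset (Fin k))) (M : Finset (Fin k) → Fin k → Option (Tok k)) :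
    Data := encList (F.map fun S => .cons (encSlots S) (encArr (M S)))

theorem encUnary_val_injective {k : ℕ} : Function.Injective fun s : Fin k => encUnary (s : ℕ) :=
  encUnary_injective.comp Fin.val_injective

/-- The priorities can be computed. -/
def CompOrd {X : Type*} {k : X → ℕ} (e : X → Data)
    (ord : ∀ x, Finset (Fin (k x)) → List (Tok (k x)) → List (Tok (k x))) : Prop :=
  Comp (X := Σ x, Finset (Fin (k x)) × List (Tok (k x)))
    (fun y => .cons (e y.1) (.cons (encSlots y.2.1) (encToks y.2.2)))
    fun y => encToks (ord y.1 y.2.1 y.2.2)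

namespace CompOrd

variable {X Y : Type*} {k : X → ℕ} {e : X → Data}
  {ord : ∀ x, Finset (Fin (k x)) → List (Tok (k x)) → List (Tok (k x))}

theorem trans {e' : Y → Data} {f : Y → X} (h : CompOrd e ord) (he : Comp e' fun y => e (f y)) :
    CompOrd e' fun y => ord (f y) :=
  (he.up.pair Comp.elt).trans
    (Comp.reindex h fun y : Σ y, Finset (Fin (k (f y))) × List (Tok (k (f y))) => ⟨f y.1, y.2⟩)

theorem apply (h : CompOrd e ord) {S : ∀ x, Finset (Fin (k x))} {l : ∀ x, List (Tok (k x))}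
    (hS : Comp e fun x => encSlots (S x)) (hl : Comp e fun x => encToks (l x)) :
    Comp e fun x => encToks (ord x (S x) (l x)) :=
  ((Comp.refl e).pair (hS.pair hl)).trans (Comp.reindex h fun x => ⟨x, S x, l x⟩)

end CompOrd

namespace Comp

section Paging

variable {X : Type*} {e : X → Data} {k : X → ℕ} {S T Q R : ∀ x, Finset (Fin (k x))}
  {F : ∀ x, List (Finset (Fin (k x)))} {pre : ∀ x, List (Entry (k x))} {v : ∀ x, Tok (k x)}
  {m : ∀ x, Fin (k x) → Option (Tok (k x))} {B : ∀ x, List (Tok (k x))} {p : X → Page}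
  {ord : ∀ x, Finset (Fin (k x)) → List (Tok (k x)) → List (Tok (k x))}

theorem card (hk : Comp e fun x => encUnary (k x)) (hS : Comp e fun x => encSlots (S x)) :
    Comp e fun x => encUnary (S x).card :=
  (length (filter (p := fun x s => decide (s ∈ S x)) (slots hk) (memSlots hS.up elt))).congr
    fun x => by
      rw [← List.toFinset_card_of_nodup ((List.nodup_finRange _).filter _)]
      congr 2
      ext s
      simp

theorem layers (hk : Comp e fun x => encUnary (k x)) (hS : Comp e fun x => encSlots (S x))
    (hpre : Comp e fun x => encEntries (pre x)) :
    Comp e fun x => encLists encTok (layers (S x) (pre x)) := by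
  obtain ⟨q, hq⟩ := hpre.size_le
  refine foldr_growth (eb := fun x => encLists encTok) (ea := fun x => encEntry)
    (step := fun x a T => if a.2 ⊆ S x then SlotPaging.reqLayers a.1 T else T) (q + 3) hpre
    ((card hk hS).congr fun x => by rw [encLists, List.map_replicate]; rfl) ?_ ?_
  · refine (ite_prop (subset hk.upStep (S := fun y => y.2.2.2) elt.tl hS.upStep)
      (reqLayers (fun _ => encTok_injective) (v := fun y => y.2.2.1) elt.hd acc) acc).congr
      fun y => ?_
    split_ifs <;> rfl
  · intro x a ha T
    have h1 := size_reqLayers_le (f := encTok) a.1 T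
    have h2 := hq x
    have h3 := size_le_encList (List.mem_map_of_mem (f := encEntry) ha)
    rw [encEntries] at h2
    simp only [encEntry, Data.size, Polynomial.eval_add, Polynomial.eval_ofNat] at *
    split_ifs <;> omega

theorem levelToks (hk : Comp e fun x => encUnary (k x)) (hS : Comp e fun x => encSlots (S x))
    (hpre : Comp e fun x => encEntries (pre x)) :
    Comp e fun x => encToks (levelToks (S x) (pre x)) :=
  (map (filter (p := fun x (a : Entry (k x)) => decide (a.2 ⊆ S x)) (ea := fun x => encEntry) hpre
    (subset hk.up (S := fun y : Σ x, Entry (k x) => y.2.2) elt.tl hS.up)) (g := fun x a => encTok a.1)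
      elt.hd).congr fun x => by
        rw [encToks, SlotPaging.levelToks, List.map_map]
        rfl

theorem keep (hk : Comp e fun x => encUnary (k x)) (hS : Comp e fun x => encSlots (S x))
    (hpre : Comp e fun x => encEntries (pre x)) (hord : CompOrd e ord) :
    Comp e fun x => encToks (keep (ord x) (pre x) (S x)) :=
  basis (fun _ => encTok_injective) (layers hk hS hpre) (hord.apply hS (levelToks hk hS hpre))

theorem rep (hk : Comp e fun x => encUnary (k x)) (hpre : Comp e fun x => encEntries (pre x))
    (hp : Comp e fun x => encPage (p x)) (hR : Comp e fun x => encSlots (R x)) :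
    Comp e fun x => encSlots (rep (pre x) (p x) (R x)) := by
  refine (option (find? (p := fun x (a : Entry (k x)) => decide (a.1.1 = p x) && decide (a.2 ⊆ R x))
    (ea := fun x => encEntry) hpre (and
      (eq_of_injective (A := fun _ => Page) (ea := fun _ => encPage) (fun _ => encPage_injective)
        (v := fun y : Σ x, Entry (k x) => y.2.1.1) elt.hd.hd hp.up)
      (subset hk.up (S := fun y : Σ x, Entry (k x) => y.2.2) elt.tl hR.up))) hR
      (g := fun x a => encSlots a.1.2) elt.hd.tl).congr fun x => ?_
  rw [SlotPaging.rep]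
  cases List.find? _ _ <;> rfl

theorem entries {σ : ∀ x, List (Request (k x))} (hk : Comp e fun x => encUnary (k x))
    (hσ : Comp e fun x => encList ((σ x).map encRequest)) :
    Comp e fun x => encEntries (entries (σ x)) := by
  obtain ⟨q, hq⟩ := hσ.size_le
  obtain ⟨r, hr⟩ := hk.size_le
  refine foldl_growth (ea := fun x => encRequest) (eb := fun x => encEntries)
    (step := fun x pre r => entry pre r :: pre) (q + 2 * r + 3) hσ (nil e) ?_ ?_
  · exact ((elt.hd.pair (rep (X := Σ x, List (Entry (k x)) × Request (k x)) hk.upStep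
      (pre := fun y => y.2.1) acc (p := fun y => y.2.2.page) elt.hd
      (R := fun y => y.2.2.slots) elt.tl)).pair elt.tl).pair acc
  · intro x a ha pre
    have h1 := size_encSlots_le (SlotPaging.rep pre a.page a.slots)
    have h2 := hq x
    have h3 := size_le_encList (List.mem_map_of_mem (f := encRequest) ha)
    have h4 := hr x
    rw [size_encUnary] at h4
    simp only [encEntries, entry, List.map_cons, encList, encEntry, encTok, encRequest, Data.size,
      Polynomial.eval_add, Polynomial.eval_mul, Polynomial.eval_ofNat] at *
    omega

theorem orElse {A : X → Type*} {ea : ∀ x, A x → Data} {o o' : ∀ x, Option (A x)}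
    (h : Comp e fun x => encOpt (ea x) (o x)) (h' : Comp e fun x => encOpt (ea x) (o' x)) :
    Comp e fun x => encOpt (ea x) ((o x).or (o' x)) :=
  (ite' h (fun x => encOpt_ne_nil _ _) h h').congr fun x => by
    cases o x <;> simp

theorem eqSome {s : ∀ x, Fin (k x)} (hm : Comp e fun x => encArr (m x))
    (hs : Comp e fun x => encUnary (s x)) (hv : Comp e fun x => encTok (v x)) :
    Comp e fun x => encBool (decide (m x (s x) = some (v x))) :=
  eq (d₂ := fun x => .cons .nil (encTok (v x))) (get hm hs) ((nil e).pair hv) fun x =>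
    (encOpt_injective encTok_injective).eq_iff (b := some (v x))

theorem slotOf (hk : Comp e fun x => encUnary (k x)) (hm : Comp e fun x => encArr (m x))
    (hB : Comp e fun x => encToks (B x)) (hS : Comp e fun x => encSlots (S x))
    (hv : Comp e fun x => encTok (v x)) :
    Comp e fun x => encOpt (fun s : Fin (k x) => encUnary (s : ℕ))
      (slotOf (m x) (B x) (S x) (v x)) := by
  have hB' : Comp (fun y : Σ x, Fin (k x) => .cons (e y.1) (encUnary (y.2 : ℕ)))
    fun y => encToks (B y.1) := hB.up
  refine orElse (find? (slots hk) (eqSome (m := fun y => m y.1) hm.up elt hv.up))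
    (find? (slots hk) (and (memSlots hS.up elt) ?_))
  refine (option (o := fun y : Σ x, Fin (k x) => m y.1 y.2) (ea := fun _ => encTok) (get
      (g := fun (y : Σ x, Fin (k x)) s => encOpt encTok (m y.1 s)) hm.up elt)
    (const _ (encBool true)) (g := fun y a => encBool (!decide (a ∈ B y.1)))
    (not (of_bool (mem (fun _ => encTok_injective) (v := fun y => y.2) elt
      (l := fun y : Σ y : Σ x, Fin (k x), Tok (k y.1) => B y.1.1) hB'.up)
      fun y => by simp))).congr fun y => ?_
  cases m y.1 y.2 <;> rfl

end Paging

end Comp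

/-- The two filters in `insChain` select disjoint parts of the list, so an insertion adds one
element instead of doubling the size. -/
theorem size_insChain_le {k : ℕ} (f : Finset (Fin k) → Data) (S : Finset (Fin k))
    (l : List (Finset (Fin k))) :
    (encList ((insChain S l).map f)).size ≤ (encList (l.map f)).size + ((f S).size + 1) := by
  have h : (encList ((l.filter fun Q => decide (Q ⊂ S)).map f)).size +
      (encList ((l.filter fun Q => decide (S ⊂ Q)).map f)).size ≤
        (encList (l.map f)).size + 1 := by
    induction l with
    | nil => simp [encList, Data.size]
    | cons Q l ih =>
      by_cases h1 : Q ⊂ S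
      · have h2 : ¬ S ⊂ Q := fun h2 => (h1.trans h2).ne rfl
        simp only [List.filter_cons, h1, h2, decide_true, decide_false, if_true, List.map_cons,
          encList, Data.size, Bool.false_eq_true, if_false]
        omega
      · by_cases h2 : S ⊂ Q
        · simp only [List.filter_cons, h1, h2, decide_true, decide_false, if_true, List.map_cons,
            encList, Data.size, Bool.false_eq_true, if_false]
          omega
        · simp only [List.filter_cons, h1, h2, decide_false, List.map_cons,
            encList, Data.size, Bool.false_eq_true, if_false]
          omega
  have h1 := size_encList_append ((l.filter fun Q => decide (Q ⊂ S)).map f)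
    ((S :: l.filter fun Q => decide (S ⊂ Q)).map f)
  rw [insChain, List.map_append]
  simp only [List.map_cons, encList, Data.size] at h1 ⊢
  omega

namespace Comp

section Paging

variable {X : Type*} {e : X → Data} {k : X → ℕ} {S Q R : ∀ x, Finset (Fin (k x))}
  {F : ∀ x, List (Finset (Fin (k x)))} {c : ∀ x, Finset (Fin (k x)) → Data} {v : ∀ x, Tok (k x)}
  {M : ∀ x, Finset (Fin (k x)) → Fin (k x) → Option (Tok (k x))}
  {B : ∀ x, Finset (Fin (k x)) → List (Tok (k x))}

theorem cover (hk : Comp e fun x => encUnary (k x))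
    (hF : Comp e fun x => encList ((F x).map fun S => .cons (encSlots S) (c x S)))
    (hQ : Comp e fun x => encSlots (Q x)) (hS : Comp e fun x => encSlots (S x)) :
    Comp e fun x => encBool (decide (Cover (F x) (Q x) (S x))) :=
  of_bool (and (ssubset hk hQ hS) (all (ea := fun x S => .cons (encSlots S) (c x S))
    (p := fun x Q' => !(decide (Q x ⊂ Q') && decide (Q' ⊂ S x))) hF
    (not (and (ssubset hk.up hQ.up (T := fun y : Σ x, Finset (Fin (k x)) => y.2) elt.hd)
      (ssubset hk.up (S := fun y : Σ x, Finset (Fin (k x)) => y.2) elt.hd hS.up))))) fun x => by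
    simp [Cover, imp_iff_not_or]

theorem baseOf (hk : Comp e fun x => encUnary (k x)) (hM : Comp e fun x => encPos (F x) (M x))
    (hv : Comp e fun x => encTok (v x)) (hR : Comp e fun x => encSlots (R x)) :
    Comp e fun x => encSlots (baseOf (F x) (M x) (v x) (R x)) := by
  let e' : (Σ x, Finset (Fin (k x))) → Data := fun y =>
    .cons (e y.1) (.cons (encSlots y.2) (encArr (M y.1 y.2)))
  have hv' : Comp e' fun y => encTok (v y.1) := hv.up
  have hm : Comp e' fun y => encArr (M y.1 y.2) := elt.tl
  refine (option (ea := fun x S => .cons (encSlots S) (encArr (M x S)))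
    (find? (p := fun x Q => decide (Cover (F x) Q (R x)) &&
      (List.finRange (k x)).any fun s => decide (M x Q s = some (v x))) hM
      (and (cover hk.up (F := fun y : Σ x, Finset (Fin (k x)) => F y.1)
        (c := fun y S => encArr (M y.1 S)) hM.up (Q := fun y => y.2) elt.hd hR.up)
        (any (slots hk.up) (eqSome
          (m := fun y : Σ y : Σ x, Finset (Fin (k x)), Fin (k y.1) => M y.1.1 y.1.2) hm.up elt
          hv'.up)))) hR (g := fun x Q => encSlots Q) elt.hd).congr fun x => ?_
  rw [SlotPaging.baseOf]
  cases List.find? _ _ <;> rfl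

theorem chainUp (hk : Comp e fun x => encUnary (k x))
    (hF : Comp e fun x => encList ((F x).map fun S => .cons (encSlots S) (c x S)))
    (hQ : Comp e fun x => encSlots (Q x)) (hS : Comp e fun x => encSlots (S x)) :
    Comp e fun x => encList ((chainUp (F x) (Q x) (S x)).map fun S =>
      .cons (encSlots S) (c x S)) := by
  have hl := filter (ea := fun x S => .cons (encSlots S) (c x S))
    (p := fun x Z => decide (Q x ⊆ Z) && decide (Z ⊆ S x)) hF
    (and (subset hk.up hQ.up (T := fun y : Σ x, Finset (Fin (k x)) => y.2) elt.hd)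
      (subset hk.up (S := fun y : Σ x, Finset (Fin (k x)) => y.2) elt.hd hS.up))
  obtain ⟨q, hq⟩ := hl.size_le
  refine foldr_growth (A := fun x => Finset (Fin (k x))) (B := fun x => List (Finset (Fin (k x))))
    (ea := fun x S => .cons (encSlots S) (c x S))
    (eb := fun x l => encList (l.map fun S => .cons (encSlots S) (c x S)))
    (step := fun x => insChain) q hl (nil e) ?_ ?_
  · let e' : (Σ x, List (Finset (Fin (k x))) × Finset (Fin (k x))) → Data := fun y =>
      .cons (.cons (e y.1) (encList (y.2.1.map fun S => .cons (encSlots S) (c y.1 S))))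
        (.cons (encSlots y.2.2) (c y.1 y.2.2))
    have hk' : Comp e' fun y => encUnary (k y.1) := hk.upStep
    have ha : Comp e' fun y => encSlots y.2.2 := elt.hd
    exact append (A := fun y : Σ x, List (Finset (Fin (k x))) × Finset (Fin (k x)) =>
        Finset (Fin (k y.1))) (ea := fun y S => .cons (encSlots S) (c y.1 S))
      (filter acc (ssubset hk'.up (S := fun z : Σ y : (Σ x, List (Finset (Fin (k x))) ×
        Finset (Fin (k x))), Finset (Fin (k y.1)) => z.2) elt.hd ha.up))
      (pair elt (filter acc (ssubset hk'.up ha.up (T := fun z : Σ y : (Σ x,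
        List (Finset (Fin (k x))) × Finset (Fin (k x))), Finset (Fin (k y.1)) => z.2) elt.hd)))
  · intro x a ha l
    have h1 := size_insChain_le (fun S => .cons (encSlots S) (c x S)) a l
    have h2 := hq x
    have h3 := size_le_encList (List.mem_map_of_mem
      (f := fun S => Data.cons (encSlots S) (c x S)) ha)
    omega

theorem eqFin {s t : ∀ x, Fin (k x)} (hs : Comp e fun x => encUnary (s x : ℕ))
    (ht : Comp e fun x => encUnary (t x : ℕ)) : Comp e fun x => encBool (decide (s x = t x)) :=
  eq hs ht fun _ => encUnary_val_injective.eq_iff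

theorem track {l : ∀ x, List (Fin (k x))} {u : ∀ x, Fin (k x)}
    (hk : Comp e fun x => encUnary (k x))
    (hl : Comp e fun x => encList ((l x).map fun s : Fin (k x) => encUnary (s : ℕ)))
    (hu : Comp e fun x => encUnary (u x : ℕ)) :
    Comp e fun x => encUnary (track (l x) (u x) : ℕ) := by
  obtain ⟨q, hq⟩ := hk.size_le
  refine (foldl_growth (A := fun x => Fin (k x)) (ea := fun x s => encUnary (s : ℕ))
    (eb := fun x (st : Option (Fin (k x)) × Fin (k x)) =>
      .cons (encOpt (fun s : Fin (k x) => encUnary (s : ℕ)) st.1) (encUnary (st.2 : ℕ)))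
    (b0 := fun x => (none, u x)) (step := fun x => trackStep) (2 * q + 3) hl ((nil e).pair hu)
    ?_ ?_).tl
  · let e' : (Σ x, (Option (Fin (k x)) × Fin (k x)) × Fin (k x)) → Data := fun y =>
      .cons (.cons (e y.1) (.cons (encOpt (fun s : Fin (k y.1) => encUnary (s : ℕ)) y.2.1.1)
        (encUnary (y.2.1.2 : ℕ)))) (encUnary (y.2.2 : ℕ))
    have h1 : Comp e' fun y => encUnary (y.2.1.2 : ℕ) := acc.tl
    have h2 : Comp e' fun y => encUnary (y.2.2 : ℕ) := elt
    have h3 : Comp e' fun y => encOpt (fun s : Fin (k y.1) => encUnary (s : ℕ)) y.2.1.1 := acc.hd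
    refine ((nil _).pair h2).pair ((h3.option h1
      (g := fun y a => encUnary ((if y.2.1.2 = a then y.2.2 else
        if y.2.1.2 = y.2.2 then a else y.2.1.2 : Fin (k y.1)) : ℕ)) ?_).congr fun y => ?_)
    · refine (ite_prop (eqFin h1.up elt) h2.up
        (ite_prop (eqFin h1.up h2.up) elt h1.up)).congr fun y => ?_
      split_ifs <;> rfl
    · obtain ⟨x, ⟨_ | a, u⟩, b⟩ := y <;> rfl
  · intro x a ha st
    have h1 := hq x
    rw [size_encUnary] at h1
    have h2 := a.2
    have h3 := (trackStep st a).2.2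
    simp only [trackStep, encOpt, Data.size, size_encUnary, Polynomial.eval_add,
      Polynomial.eval_mul, Polynomial.eval_ofNat] at h3 ⊢
    omega

theorem route (hk : Comp e fun x => encUnary (k x)) (hM : Comp e fun x => encPos (F x) (M x))
    (hB : Comp (X := Σ x, Finset (Fin (k x))) (fun y => .cons (e y.1) (encSlots y.2))
      fun y => encToks (B y.1 y.2)) (hv : Comp e fun x => encTok (v x))
    (hQ : Comp e fun x => encSlots (Q x)) (hS : Comp e fun x => encSlots (S x)) :
    Comp e fun x => encList ((route (F x) (M x) (B x) (v x) (Q x) (S x)).map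
      fun s : Fin (k x) => encUnary (s : ℕ)) := by
  have hB' : Comp (fun y : Σ x, Finset (Fin (k x)) =>
      .cons (e y.1) (.cons (encSlots y.2) (encArr (M y.1 y.2)))) fun y => encToks (B y.1 y.2) :=
    ((hd (refl _)).pair (hd (last _ _))).trans hB
  exact filterMap (ea := fun x S => .cons (encSlots S) (encArr (M x S)))
    (chainUp hk hM hQ hS) (slotOf hk.up (m := fun y : Σ x, Finset (Fin (k x)) => M y.1 y.2) elt.tl
      hB' (S := fun y => y.2) elt.hd hv.up)

theorem place (hk : Comp e fun x => encUnary (k x)) (hM : Comp e fun x => encPos (F x) (M x))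
    (hB : Comp (X := Σ x, Finset (Fin (k x))) (fun y => .cons (e y.1) (encSlots y.2))
      fun y => encToks (B y.1 y.2)) (hv : Comp e fun x => encTok (v x))
    (hR : Comp e fun x => encSlots (R x)) :
    Comp e fun x => encPos (F x) (place (F x) (M x) (B x) (v x) (R x)) := by
  let e' : (Σ x, Finset (Fin (k x))) → Data := fun y =>
    .cons (e y.1) (.cons (encSlots y.2) (encArr (M y.1 y.2)))
  have hk' : Comp e' fun y => encUnary (k y.1) := hk.up
  have hM' : Comp e' fun y => encPos (F y.1) (M y.1) := hM.up
  have hv' : Comp e' fun y => encTok (v y.1) := hv.up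
  have hQ : Comp e' fun y => encSlots (SlotPaging.baseOf (F y.1) (M y.1) (v y.1) (R y.1)) :=
    (baseOf hk hM hv hR).up
  have hS : Comp e' fun y => encSlots y.2 := elt.hd
  have hm : Comp e' fun y => encArr (M y.1 y.2) := elt.tl
  have hB' : Comp (X := Σ y : Σ x, Finset (Fin (k x)), Finset (Fin (k y.1)))
      (fun y => .cons (e' y.1) (encSlots y.2)) fun y => encToks (B y.1.1 y.2) :=
    ((hd (refl _)).hd.pair elt).trans (hB.reindex
      fun y : Σ y : Σ x, Finset (Fin (k x)), Finset (Fin (k y.1)) => ⟨y.1.1, y.2⟩)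
  have hB₁ : Comp e' fun y => encToks (B y.1 y.2) := ((hd (refl _)).pair (hd (last _ _))).trans hB
  have ht := slotOf hk' hm hB₁ hS hv'
  have hr := route hk' hM' (B := fun y => B y.1) hB' hv' hQ hS
  refine map (A := fun x => Finset (Fin (k x))) hM (elt.hd.pair (map (slots hk')
    (g := fun (y : Σ x, Finset (Fin (k x))) s => encOpt encTok
      (SlotPaging.place (F y.1) (M y.1) (B y.1) (v y.1) (R y.1) y.2 s))
    ?_))
  let e'' : (Σ y : Σ x, Finset (Fin (k x)), Fin (k y.1)) → Data := fun z =>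
    .cons (e' z.1) (encUnary (z.2 : ℕ))
  let u : ∀ z : (Σ y : Σ x, Finset (Fin (k x)), Fin (k y.1)), Fin (k z.1.1) := fun z =>
    SlotPaging.track (SlotPaging.route (F z.1.1) (M z.1.1) (B z.1.1) (v z.1.1)
      (SlotPaging.baseOf (F z.1.1) (M z.1.1) (v z.1.1) (R z.1.1)) z.1.2) z.2
  have hu : Comp e'' fun z => encUnary (u z : ℕ) := track hk'.up hr.up elt
  have hm' : Comp e'' fun z => encArr (M z.1.1 z.1.2) := hm.up
  have ht' : Comp e'' fun z => encOpt (fun s : Fin (k z.1.1) => encUnary (s : ℕ))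
    (SlotPaging.slotOf (M z.1.1 z.1.2) (B z.1.1 z.1.2) z.1.2 (v z.1.1)) := ht.up
  refine (ite_prop (subset hk'.up hQ.up hS.up) (ite_prop
    (eq (p := fun z => SlotPaging.slotOf (M z.1.1 z.1.2) (B z.1.1 z.1.2) z.1.2 (v z.1.1) =
      some (u z)) ht' ((nil _).pair hu) fun z =>
      (encOpt_injective encUnary_val_injective).eq_iff (b := some _)) ((nil _).pair hv'.up)
    (get hm' hu)) (get hm' elt)).congr fun z => ?_
  rw [SlotPaging.place]
  split_ifs <;> rfl

end Paging

end Comp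

section Positions

variable {k : ℕ} {F : List (Finset (Fin k))}
  {ord : Finset (Fin k) → List (Tok k) → List (Tok k)}

/-- The arrays contain only tokens of past entries. This bounds the size of all reachable states,
which the fold in `Comp.positions` requires. -/
theorem mem_of_positions {pre : List (Entry k)} {S : Finset (Fin k)} {s : Fin k} {v : Tok k}
    (h : positions F ord pre S s = some v) : ∃ a ∈ pre, a.1 = v := by
  induction pre generalizing s with
  | nil => simp [positions] at h
  | cons a pre ih =>
    have hM : ∀ {s}, positions F ord pre S s = some v → ∃ b ∈ a :: pre, b.1 = v := fun h => by
      obtain ⟨b, hb, rfl⟩ := ih h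
      exact ⟨b, List.mem_cons_of_mem _ hb, rfl⟩
    rw [positions, place] at h
    split_ifs at h
    · exact ⟨a, List.mem_cons_self .., Option.some_injective _ h⟩
    · exact hM h
    · exact hM h

theorem size_encPos_positions_le {pre : List (Entry k)} {n : ℕ}
    (h : ∀ a ∈ pre, (encTok a.1).size ≤ n) : (encPos F (positions F ord pre)).size ≤
      F.length * (4 * k + 1 + (k * (n + 2 + 1) + 1) + 1 + 1) + 1 := by
  have h1 : ∀ S, (encArr (positions F ord pre S)).size ≤ k * (n + 2 + 1) + 1 := fun S => by
    refine (size_encList_le_of_forall (m := n + 2) ?_).trans (by simp)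
    intro x hx
    obtain ⟨s, -, rfl⟩ := List.mem_map.1 hx
    rcases hs : positions F ord pre S s with _ | v
    · simp [encOpt, Data.size]
    · obtain ⟨a, ha, rfl⟩ := mem_of_positions hs
      have := h a ha
      simp only [encOpt, Data.size]
      omega
  refine (size_encList_le_of_forall (m := 4 * k + 1 + (k * (n + 2 + 1) + 1) + 1) ?_).trans
    (by simp)
  intro x hx
  obtain ⟨S, -, rfl⟩ := List.mem_map.1 hx
  have := h1 S
  have := size_encSlots_le S
  simp only [Data.size]
  omega

/-- The step needs the entries so far to compute `keep`, so the accumulator contains them besides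
the arrays. -/
theorem positions_eq_foldl (pre : List (Entry k)) : pre.reverse.foldl (fun st a =>
    (a :: st.1, place F st.2 (keep ord (a :: st.1)) a.1 a.2))
      (([], fun _ _ => none) : List (Entry k) × (Finset (Fin k) → Fin k → Option (Tok k))) =
        (pre, positions F ord pre) := by
  induction pre with
  | nil => rfl
  | cons a pre ih =>
    rw [List.reverse_cons, List.foldl_append, ih]
    rfl

end Positions

namespace Comp

section Paging

variable {X : Type*} {e : X → Data} {k : X → ℕ} {F : ∀ x, List (Finset (Fin (k x)))}
  {pre : ∀ x, List (Entry (k x))} {M : ∀ x, Finset (Fin (k x)) → Fin (k x) → Option (Tok (k x))}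
  {ord : ∀ x, Finset (Fin (k x)) → List (Tok (k x)) → List (Tok (k x))}

theorem positions (hk : Comp e fun x => encUnary (k x))
    (hF : Comp e fun x => encList ((F x).map encSlots))
    (hpre : Comp e fun x => encEntries (pre x)) (hord : CompOrd e ord) :
    Comp e fun x => encPos (F x) (positions (F x) (ord x) (pre x)) := by
  obtain ⟨p, hp⟩ := hpre.size_le
  obtain ⟨q, hq⟩ := hk.size_le
  obtain ⟨r, hr⟩ := hF.size_le
  let e' : (Σ x, (List (Entry (k x)) × (Finset (Fin (k x)) → Fin (k x) → Option (Tok (k x)))) ×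
      Entry (k x)) → Data := fun y => .cons (.cons (e y.1) (.cons (encEntries y.2.1.1)
        (encPos (F y.1) y.2.1.2))) (encEntry y.2.2)
  have hk' : Comp e' fun y => encUnary (k y.1) := hk.upStep
  have hpre' : Comp e' fun y => encEntries (y.2.2 :: y.2.1.1) := elt.pair acc.hd
  have hord' : CompOrd e' fun y => ord y.1 := hord.trans (hd (refl _)).hd
  have hM : Comp e' fun y => encPos (F y.1) y.2.1.2 := acc.tl
  have hv : Comp e' fun y => encTok y.2.2.1 := elt.hd
  have hR : Comp e' fun y => encSlots y.2.2.2 := elt.tl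
  let e'' : (Σ y : (Σ x, (List (Entry (k x)) × (Finset (Fin (k x)) → Fin (k x) →
      Option (Tok (k x)))) × Entry (k x)), Finset (Fin (k y.1))) → Data := fun z =>
        .cons (e' z.1) (encSlots z.2)
  have hB : Comp e'' fun z =>
      encToks (SlotPaging.keep (ord z.1.1) (z.1.2.2 :: z.1.2.1.1) z.2) :=
    keep (e := e'') (k := fun z => k z.1.1) (ord := fun z => ord z.1.1) hk'.up elt hpre'.up
      (hord'.trans (f := Sigma.fst) (hd (refl _)))
  have hstep := hpre'.pair (place hk' hM (B := fun y => SlotPaging.keep (ord y.1)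
    (y.2.2 :: y.2.1.1)) hB hv hR)
  refine (foldl (A := fun x => Entry (k x)) (ea := fun x => encEntry) (l := fun x => (pre x).reverse)
    (eb := fun x (st : List (Entry (k x)) × (Finset (Fin (k x)) → Fin (k x) → Option (Tok (k x)))) =>
      .cons (encEntries st.1) (encPos (F x) st.2))
    (b0 := fun x => ([], fun _ _ => none))
    (step := fun x st a => (a :: st.1, SlotPaging.place (F x) st.2
      (SlotPaging.keep (ord x) (a :: st.1)) a.1 a.2))
    (p + (r * (4 * q + 1 + (q * (p + 2 + 1) + 1) + 1 + 1) + 1) + 1) (reverse hpre)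
    ((nil e).pair (map hF (elt.pair (map (slots hk.up) (nil _)))))
    (hstep.reindex Subtype.val) ?_).tl.congr fun x => ?_
  · intro x l' hl'
    obtain ⟨pre', rfl⟩ : ∃ pre' : List (Entry (k x)), l' = pre'.reverse :=
      ⟨l'.reverse, l'.reverse_reverse.symm⟩
    rw [positions_eq_foldl]
    obtain ⟨t, ht⟩ := List.reverse_prefix.1 hl'
    have h1 := hp x
    have h2 : ∀ a ∈ pre', (encTok a.1).size ≤ p.eval (e x).size := fun a ha => by
      have h3 : a ∈ pre x := ht ▸ List.mem_append_right _ ha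
      have h4 := size_le_encList (List.mem_map_of_mem (f := encEntry) h3)
      rw [encEntries] at h1
      simp only [encEntry, Data.size] at h4
      omega
    have h3 : (encEntries pre').size ≤ p.eval (e x).size := by
      refine le_trans ?_ h1
      have := size_encList_append (t.map encEntry) (pre'.map encEntry)
      have := Data.size_pos (encList (t.map encEntry))
      rw [encEntries, encEntries, ← ht, List.map_append]
      omega
    have h4 := size_encPos_positions_le (F := F x) (ord := ord x) h2
    have h5 := hq x
    rw [size_encUnary] at h5
    have h6 : (F x).length ≤ r.eval (e x).size := by
      have := length_lt_encList ((F x).map encSlots)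
      have := hr x
      rw [List.length_map] at *
      omega
    have h7 : (encPos (F x) (SlotPaging.positions (F x) (ord x) pre')).size ≤
        r.eval (e x).size * (4 * q.eval (e x).size + 1 + (q.eval (e x).size *
          (p.eval (e x).size + 2 + 1) + 1) + 1 + 1) + 1 := by
      refine h4.trans ?_
      have : k x ≤ q.eval (e x).size := by omega
      gcongr
    simp only [Data.size, Polynomial.eval_add, Polynomial.eval_mul, Polynomial.eval_one,
      Polynomial.eval_ofNat]
    omega
  · rw [positions_eq_foldl]
    rfl

theorem configOf (hk : Comp e fun x => encUnary (k x)) (hM : Comp e fun x => encPos (F x) (M x)) :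
    Comp e fun x => encConfig (configOf (F x) (M x)) := by
  let e' : (Σ x, Fin (k x)) → Data := fun y => .cons (e y.1) (encUnary (y.2 : ℕ))
  let e'' : (Σ y : (Σ x, Fin (k x)), Finset (Fin (k y.1))) → Data := fun z =>
    .cons (e' z.1) (.cons (encSlots z.2) (encArr (M z.1.1 z.2)))
  have hk' : Comp e' fun y => encUnary (k y.1) := hk.up
  have hM' : Comp e' fun y => encPos (F y.1) (M y.1) := hM.up
  have hM'' : Comp e'' fun z => encPos (F z.1.1) (M z.1.1) := hM'.up
  have hs : Comp e' fun y => encUnary (y.2 : ℕ) := elt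
  have hS : Comp e'' fun z => encSlots z.2 := elt.hd
  have hm : Comp e'' fun z => encArr (M z.1.1 z.2) := elt.tl
  have hk'' : Comp e'' fun z => encUnary (k z.1.1) := hk'.up
  have hall : Comp e'' fun z => encBool ((F z.1.1).all fun T => !decide (z.2 ⊂ T)) :=
    all (e := e'') (A := fun z => Finset (Fin (k z.1.1)))
      (ea := fun z S => .cons (encSlots S) (encArr (M z.1.1 S))) (l := fun z => F z.1.1) hM''
        (not (ssubset hk''.up hS.up (T := fun w : Σ z : (Σ y : (Σ x, Fin (k x)),
          Finset (Fin (k y.1))), Finset (Fin (k z.1.1)) => w.2) elt.hd))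
  have hroot : Comp e' fun y => encOpt (fun S => .cons (encSlots S) (encArr (M y.1 S)))
      (rootOf (F y.1) y.2) :=
    find? (e := e') (ea := fun y S => .cons (encSlots S) (encArr (M y.1 S))) hM'
      (and (memSlots hS hs.up) hall)
  refine map (slots hk) ((option hroot (nil e')
    (g := fun y S => encSlot ((M y.1 S y.2).map Prod.fst)) ?_).congr fun y => ?_)
  · refine (option (ea := fun _ => encTok) (get (s := fun z => z.1.2) hm hs.up) (nil e'')
      (g := fun _ v => .cons .nil (encPage v.1)) ((nil _).pair elt.hd)).congr fun z => ?_
    cases M z.1.1 z.2 z.1.2 <;> rfl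
  · rw [SlotPaging.configOf]
    cases rootOf (F y.1) y.2 <;> rfl

end Paging

end Comp

/-! ### Programs that read the random tape -/

/-- The tape with the numbers of all but the first rows replaced by `0`. -/
def truncTape (N : ℕ) (ω : RandomTape) : RandomTape := fun q => if q.1 < N then ω q else 0

theorem randOrd_truncTape {V : Type*} {N : ℕ} (ω : RandomTape) {l : List V} (h : l.length ≤ N) :
    randOrd (truncTape N ω) l = randOrd ω l := by
  induction l with
  | nil => rfl
  | cons x l ih =>
    rw [List.length_cons] at h
    rw [randOrd, randOrd, ih (by omega), truncTape, if_pos (by simpa using h)]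

theorem randOrd_eq_foldr {V : Type*} (ω : RandomTape) (l : List V) :
    randOrd ω l = l.foldr (fun x b => b.take (ω (b.length, 0)) ++ x :: b.drop (ω (b.length, 0)))
      [] := by
  induction l with
  | nil => rfl
  | cons x l ih =>
    rw [List.foldr_cons, ← ih, length_randOrd, randOrd, insertIdx_eq_take_append]
    rw [length_randOrd]
    exact Nat.le_of_lt_succ (ω (l.length, 0)).2

theorem size_encTape_le (N : ℕ) (ω : RandomTape) :
    (encTape N ω).size ≤ N * (N * (2 * N + 1 + 1) + 1 + 1) + 1 := by
  refine (size_encList_le_of_forall (m := N * (2 * N + 1 + 1) + 1) ?_).trans (by simp)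
  intro y hy
  obtain ⟨m, hm, rfl⟩ := List.mem_map.1 hy
  refine (size_encList_le_of_forall (m := 2 * N + 1) ?_).trans (by simp)
  intro z hz
  obtain ⟨i, -, rfl⟩ := List.mem_map.1 hz
  rw [size_encUnary]
  have := (ω (m, i)).2
  have := List.mem_range.1 hm
  omega

/-- Beyond the encoded rows the program meets `nil`, which is `0` in unary; this is why `truncTape`
has the value `0` there. -/
theorem tail_iterate_encTape (N : ℕ) (ω : RandomTape) (m : ℕ) :
    (Data.tl^[m] (encTape N ω)).hd.hd = encUnary (truncTape N ω (m, 0) : ℕ) := by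
  rw [encTape, Comp.tail_iterate_encList]
  by_cases h : m < N
  · obtain ⟨n, rfl⟩ : ∃ n, N = n + 1 := ⟨N - 1, by omega⟩
    rw [List.drop_eq_getElem_cons (by simpa using h), List.getElem_map, List.getElem_range,
      List.range_succ_eq_map, truncTape, if_pos h]
    rfl
  · rw [List.drop_of_length_le (by simpa using h), truncTape, if_neg h]
    rfl

theorem length_entries {k : ℕ} (σ : List (Request k)) : (entries σ).length = σ.length := by
  induction σ using List.reverseRecOn with
  | nil => rfl
  | append_singleton σ r ih =>
    rw [entries, List.foldl_append, ← entries]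
    simp [ih]

namespace Comp

variable {X : Type*} {e : X → Data} {A : X → Type*} {ea : ∀ x, A x → Data} {l : ∀ x, List (A x)}

theorem dedup [∀ x, DecidableEq (A x)] (hea : ∀ x, Function.Injective (ea x))
    (hl : Comp e fun x => encList ((l x).map (ea x))) :
    Comp e fun x => encList ((l x).dedup.map (ea x)) := by
  obtain ⟨p, hp⟩ := hl.size_le
  refine (foldr_growth (eb := fun x (b : List (A x)) => encList (b.map (ea x)))
    (b0 := fun _ => []) (step := fun x a b => if a ∈ b then b else a :: b) p hl (nil e)
    ((ite_prop (mem (e := fun y : Σ x, List (A x) × A x =>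
      .cons (.cons (e y.1) (encList (y.2.1.map (ea y.1)))) (ea y.1 y.2.2)) (fun y => hea y.1) elt
      (l := fun y => y.2.1) acc) acc (elt.pair acc)).congr fun y => ?_) ?_).congr fun x => ?_
  · split_ifs <;> rfl
  · intro x a ha b
    have h1 := size_le_encList (List.mem_map_of_mem (f := ea x) ha)
    have h2 := hp x
    split_ifs
    · omega
    · simp only [encList, List.map_cons, Data.size]
      omega
  · congr 2
    induction l x with
    | nil => rfl
    | cons a t ih =>
      rw [List.foldr_cons, ih]
      split_ifs with h
      · rw [List.dedup_cons_of_mem (List.mem_dedup.1 h)]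
      · rw [List.dedup_cons_of_notMem (mt List.mem_dedup.2 h)]

theorem randOrd {N : X → ℕ} {ω : X → RandomTape} (hω : Comp e fun x => encTape (N x) (ω x))
    (hl : Comp e fun x => encList ((l x).map (ea x))) :
    Comp e fun x => encList ((randOrd (truncTape (N x) (ω x)) (l x)).map (ea x)) := by
  obtain ⟨p, hp⟩ := hl.size_le
  let e' : (Σ x, List (A x) × A x) → Data := fun y =>
    .cons (.cons (e y.1) (encList (y.2.1.map (ea y.1)))) (ea y.1 y.2.2)
  have hb : Comp e' fun y => encList (y.2.1.map (ea y.1)) := acc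
  have hi : Comp e' fun y => encUnary (truncTape (N y.1) (ω y.1) (y.2.1.length, 0) : ℕ) :=
    (tail_iterate hb.length hω.upStep).hd.hd.congr fun y => tail_iterate_encTape _ _ _
  refine (foldr_growth (eb := fun x (b : List (A x)) => encList (b.map (ea x)))
    (b0 := fun _ => []) (step := fun x a b => b.take (truncTape (N x) (ω x) (b.length, 0)) ++
      a :: b.drop (truncTape (N x) (ω x) (b.length, 0))) p hl (nil e)
    (append (hi.take hb) (elt.pair (hi.drop hb))) ?_).congr fun x => ?_
  · intro x a ha b
    have h1 := size_le_encList (List.mem_map_of_mem (f := ea x) ha)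
    have h2 := hp x
    generalize (truncTape (N x) (ω x) (b.length, 0) : ℕ) = i
    have h3 := size_encList_append ((b.take i).map (ea x)) ((b.drop i).map (ea x))
    have h4 := size_encList_append ((b.take i).map (ea x)) ((a :: b.drop i).map (ea x))
    rw [← List.map_append, List.take_append_drop] at h3
    rw [← List.map_append] at h4
    simp only [encList, List.map_cons, Data.size] at h4
    omega
  · rw [randOrd_eq_foldr]

end Comp

namespace CompOrd

variable {X : Type*} {e : X → Data} {k : X → ℕ}

theorem detOrd : CompOrd e fun x => detOrd (k := k x) :=
  Comp.reverse (l := fun y : Σ x, Finset (Fin (k x)) × List (Tok (k x)) => y.2.2)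
    (ea := fun _ => encTok) Comp.elt.tl

theorem offOrd {full : ∀ x, List (Entry (k x))} (hk : Comp e fun x => encUnary (k x))
    (hfull : Comp e fun x => encEntries (full x)) : CompOrd e fun x => offOrd (full x) := by
  let e' : (Σ x, Finset (Fin (k x)) × List (Tok (k x))) → Data := fun y =>
    .cons (e y.1) (.cons (encSlots y.2.1) (encToks y.2.2))
  have hS : Comp e' fun y => encSlots y.2.1 := Comp.elt.hd
  have hl : Comp e' fun y => encToks y.2.2 := Comp.elt.tl
  have hL := Comp.reverse (Comp.levelToks (e := e') hk.up hS hfull.up)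
  exact Comp.append (Comp.drop (Comp.length hl) hL) hL

theorem tapeOrd {N : X → ℕ} {ω : X → RandomTape} (hω : Comp e fun x => encTape (N x) (ω x)) :
    CompOrd e fun x => tapeOrd (k := k x) (truncTape (N x) (ω x)) :=
  Comp.randOrd (l := fun y : Σ x, Finset (Fin (k x)) × List (Tok (k x)) => y.2.2.dedup)
    (ea := fun _ => encTok) hω.up (Comp.dedup (fun _ => encTok_injective) Comp.elt.tl)

end CompOrd

/-! ### The algorithms -/

/-- The instances, as far as their form is concerned. -/
abbrev Inst := Σ k : ℕ, List (Finset (Fin k)) × List (Request k)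

/-- The deterministic online algorithm. -/
def detAlgorithm : OnlineAlgorithm := fun _ F σ => configOf F (positions F detOrd (entries σ))

/-- The randomized online algorithm. -/
def randAlgorithm : RandomizedOnlineAlgorithm := fun ω _ F σ =>
  configOf F (positions F (tapeOrd ω) (entries σ))

/-- The offline algorithm. -/
def offAlgorithm : OfflineAlgorithm := fun _ F σ => configs F (offOrd (entries σ)) σ

theorem detAlgorithm_isPolyTime : detAlgorithm.IsPolyTime := by
  let e : Inst → Data := fun x => encInput x.2.1 x.2.2
  have h := Comp.refl e
  have hk : Comp e fun x => encUnary x.1 := h.hd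
  have hF : Comp e fun x => encList (x.2.1.map encSlots) := h.tl.hd
  have hσ : Comp e fun x => encList (x.2.2.map encRequest) := h.tl.tl
  obtain ⟨P, p, hP⟩ := hk.configOf (hk.positions hF (hk.entries hσ) CompOrd.detOrd)
  exact ⟨P, p, fun k F σ _ => hP ⟨k, F, σ⟩⟩

theorem length_le_size_encInput {k : ℕ} (F : List (Finset (Fin k))) (σ : List (Request k)) :
    σ.length ≤ (encInput F σ).size := by
  have := length_lt_encList (σ.map encRequest)
  rw [List.length_map] at this
  simp only [encInput, Data.size]
  omega

theorem randAlgorithm_isPolyTime : randAlgorithm.IsPolyTime := by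
  let e : Inst × RandomTape → Data := fun x =>
    .cons (encInput x.1.2.1 x.1.2.2) (encTape (encInput x.1.2.1 x.1.2.2).size x.2)
  have h := Comp.refl e
  have hk : Comp e fun x => encUnary x.1.1 := h.hd.hd
  have hω : Comp e fun x => encTape (encInput x.1.2.1 x.1.2.2).size x.2 := h.tl
  have hF : Comp e fun x => encList (x.1.2.1.map encSlots) := h.hd.tl.hd
  have hσ : Comp e fun x => encList (x.1.2.2.map encRequest) := h.hd.tl.tl
  obtain ⟨P, p, hP⟩ := hk.configOf (hk.positions hF (hk.entries hσ) (CompOrd.tapeOrd hω))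
  -- The program is timed in the size of instance and tape together; composition with the bound of
  -- `size_encTape_le` leaves only the size of the instance. The tape is cut at exactly this size,
  -- hence the polynomial `.X`.
  refine ⟨P, p.comp (.X + (.X * (.X * (2 * .X + 1 + 1) + 1 + 1) + 1) + 1), .X,
    fun k F σ _ ω => ?_⟩
  obtain ⟨n, hn, hr⟩ := hP (⟨k, F, σ⟩, ω)
  -- Lists of tokens are no longer than the request sequence, so the rows that were cut off are
  -- never read.
  have h1 : positions F (tapeOrd (truncTape (encInput F σ).size ω)) (entries σ) =
      positions F (tapeOrd ω) (entries σ) :=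
    (totalCost_congr (n := (encInput F σ).size) (fun S l hl => randOrd_truncTape ω
      ((List.dedup_sublist l).length_le.trans hl))
      ((length_entries σ).le.trans (length_le_size_encInput F σ))).1
  rw [Polynomial.eval_X]
  simp only [h1] at hr
  refine ⟨n, hn.trans ?_, hr⟩
  have h2 := size_encTape_le (encInput F σ).size ω
  simp only [Polynomial.eval_comp, Polynomial.eval_add, Polynomial.eval_mul, Polynomial.eval_X,
    Polynomial.eval_one, Polynomial.eval_ofNat]
  exact poly_mono p (by simp only [e, Data.size]; omega)

theorem offAlgorithm_isPolyTime : offAlgorithm.IsPolyTime := by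
  let e : Inst → Data := fun x => encInput x.2.1 x.2.2
  have h := Comp.refl e
  have hk : Comp e fun x => encUnary x.1 := h.hd
  have hσ : Comp e fun x => encList (x.2.2.map encRequest) := h.tl.tl
  have hord : CompOrd e fun x => offOrd (entries x.2.2) := .offOrd hk (hk.entries hσ)
  let e' : (Σ x : Inst, Fin x.2.2.length) → Data := fun y => .cons (e y.1) (encUnary (y.2 : ℕ))
  have hk' : Comp e' fun y => encUnary y.1.1 := hk.up
  have hF' : Comp e' fun y => encList (y.1.2.1.map encSlots) := h.tl.hd.up
  have hσ' : Comp e' fun y => encList ((y.1.2.2.take (y.2 + 1)).map encRequest) :=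
    Comp.take ((Comp.nil e').pair Comp.elt) hσ.up
  obtain ⟨P, p, hP⟩ := (Comp.slots hσ.length).map (g := fun x i => encConfig (configOf x.2.1
    (positions x.2.1 (offOrd (entries x.2.2)) (entries (x.2.2.take (i + 1)))))) (hk'.configOf (hk'.positions hF'
    (hk'.entries hσ') (hord.trans (f := Sigma.fst) (.hd (.refl _)))))
  refine ⟨P, p, fun k F σ _ => ?_⟩
  obtain ⟨n, hn, hr⟩ := hP ⟨k, F, σ⟩
  refine ⟨n, hn, ?_⟩
  rw [offAlgorithm, configs, ← List.map_coe_finRange_eq_range, List.map_map, List.map_map]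
  exact hr

end SlotPaging

theorem mainTheorem3 :
    (∃ A : OnlineAlgorithm, A.IsPolyTime ∧
      A.IsCompetitive (fun h k => 3 * (h : ℝ) ^ 2 * (k : ℝ))) ∧
    (∃ A : RandomizedOnlineAlgorithm, RandomizedOnlineAlgorithm.IsPolyTime A ∧
      RandomizedOnlineAlgorithm.IsCompetitive A
        (fun h k => 3 * (h : ℝ) ^ 2 * ((harmonic k : ℚ) : ℝ))) ∧
    (∃ A : OfflineAlgorithm, OfflineAlgorithm.IsPolyTime A ∧
      OfflineAlgorithm.IsApproximation A (fun h _ => 3 * (h : ℝ) ^ 2)) := by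
  refine ⟨⟨detAlgorithm, detAlgorithm_isPolyTime, 0, fun k F σ h => ⟨?_, ?_⟩⟩,
    ⟨randAlgorithm, randAlgorithm_isPolyTime, 0, fun k F σ h => ⟨fun ω => ?_, ?_, ?_⟩⟩,
    ⟨offAlgorithm, offAlgorithm_isPolyTime, fun k F σ h => ⟨?_, ?_⟩⟩⟩
  · exact isSolution_configs h.laminar h.nonempty h.mem (goodOrd_detOrd _)
  · rw [add_zero]
    exact cost_detOrd_le h
  · exact isSolution_configs h.laminar h.nonempty h.mem (goodOrd_tapeOrd ω _)
  · exact (integral_cost_tapeOrd_le h).1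
  · rw [add_zero]
    exact (integral_cost_tapeOrd_le h).2
  · exact isSolution_configs h.laminar h.nonempty h.mem (goodOrd_offOrd _)
  · exact cost_offOrd_le h
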